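/- **Setting.** Let $T>0$ and let $X=(X_t)_{t\in[0,T]}$ be a continuous zero-mean Gaussian process with $X_0=0$ a.s. on a probability space $(\Omega,\mathcal F,P)$ whose $\sigma$-field is, up to null sets, generated by $X$; prolong $X$ to $\mathbb R$ by $X_s=X_0$ ($s<0$), $X_s=X_T$ ($s>T$). Suppose $X$ has a covariance measure: a finite signed measure $\mu$ on $[0,T]^2$ with $\mu(]a_1,b_1]\times]a_2,b_2])=R(b_1,b_2)+R(a_1,a_2)-R(a_1,b_2)-R(b_1,a_2)$ for all rectangles in $[0,T]^2$, where $R(s,t)=\mathrm{Cov}(X_s,X_t)$. Put $$\langle\varphi,\psi\rangle_{\mathcal H}=\int\varphi(u)\psi(v)\,d\mu(u,v),\qquad \|\varphi\|^2_{|\mathcal H|}=\int|\varphi(u)||\varphi(v)|\,d|\mu|(u,v),$$ let $L_\mu$ be the set of Borel functions $\varphi$ on $[0,T]$ with $\|\varphi\|_{|\mathcal H|}<\infty$, and suppose that $L_\mu$ is a vector space. Let $L_{\mu,2}$ be the set of $\phi:[0,T]^2\to\mathbb R$ with $\phi(t_1,\cdot)\in L_\mu$ for all $t_1$ and $\|\phi\|^2_{|\mathcal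 H|\otimes|\mathcal H|}=\int\|\phi(t_1,\cdot)\|_{|\mathcal H|}\|\phi(t_2,\cdot)\|_{|\mathcal H|}\,d|\mu|(t_1,t_2)<\infty$. The Wiener integral $\int\varphi\,dX$, $\varphi\in L_\mu$, is the extension, continuous from $\|\cdot\|_{\mathcal H}$ to $L^2(\Omega)$, of $\int 1_{]a,b]}dX=X_b-X_a$. $Cyl$ is the set of $F=f(\int\varphi_1dX,\dots,\int\varphi_ndX)$ with $f\in C_b^\infty(\mathbb R^n)$, $\varphi_i\in L_\mu$; for these $D_tF=\sum_i\partial_if(\int\varphi_1dX,\dots)\varphi_i(t)$. $Cyl(L_\mu)$ is the set of $u_t=\sum_\ell\psi_\ell(t)G_\ell$ (finite sums), $\psi_\ell\in L_\mu$, $G_\ell\in Cyl$. A random variable $F\in L^2(\Omega)$ lies in $\mathbb D^{1,2}$ with derivative $DF:\Omega\to L_\mu$ if some $F_n\in Cyl$ satisfy $F_n\to F$ in $L^2(\Omega)$ and $E\|DF_n-DF\|^2_{\mathcal H}\to0$. A process $Y:\Omega\to L_\mu$ lies in $|\mathbb D^{1,2}(L_\mu)|$ with derivative $DY:\Omega\to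 L_{\mu,2}$, $(t_1,t_2)\mapsto D_{t_1}Y_{t_2}$, if some $u_n\in Cyl(L_\mu)$ satisfy $E\|Y-u_n\|^2_{|\mathcal H|}\to0$ and $E\|Du_n-DY\|^2_{|\mathcal H|\otimes|\mathcal H|}\to0$. A process $u$ with $E\|u\|^2_{|\mathcal H|}<\infty$ is in $Dom(\delta)$ with Skorohod integral $\int_0^Tu\,\delta X=Z$ if $Z\in L^2(\Omega)$ has mean zero and $E(FZ)=E\langle DF,u\rangle_{\mathcal H}$ for all $F\in Cyl$; $\int_0^tu\,\delta X=\int_0^Tu1_{[0,t]}\,\delta X$. The forward integral $\int_0^tY\,d^-X$ (resp. backward integral $\int_0^tY\,d^+X$) is the limit in probability, as $\varepsilon\downarrow0$, of $\int_0^tY_s\frac{X_{s+\varepsilon}-X_s}{\varepsilon}ds$ (resp. $\int_0^tY_s\frac{X_s-X_{s-\varepsilon}}{\varepsilon}ds$). **Assumptions on $\mu$.** Let $D_t=\{(s,s):0\le s\le t\}$. i) $\mathcal E(t)=\mu(D_t)$ is absolutely continuous: $\mathcal E(t)=\int_0^t\mathcal E'(s)ds$ for $t\in[0,T]$, with $\mathcal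 E'$ integrable on $[0,T]$. ii) The off-diagonal part $\mu_{od}(A)=\mu(A\setminus D_T)$ is absolutely continuous with respect to Lebesgue measure; its (integrable) density is denoted $\frac{\partial^2R}{\partial s_1\partial s_2}$. **Assumptions on $Y$.** Let $Y=(Y_t)_{t\in[0,T]}$ be a jointly measurable process (not necessarily càdlàg). a) $\sup_{t\le T}|Y_t|$ is dominated by a square integrable random variable. b) $Y\in|\mathbb D^{1,2}(L_\mu)|$ with a jointly measurable derivative $(t_1,t_2,\omega)\mapsto D_{t_1}Y_{t_2}(\omega)$ such that for Lebesgue-almost every $t_2\in[0,T]$ the random variable $Y_{t_2}$ lies in $\mathbb D^{1,2}$ with derivative $t_1\mapsto D_{t_1}Y_{t_2}$; and there is a square integrable $Z_2$ with $|D_{t_1}Y_{t_2}|\le Z_2$ a.s. for Lebesgue-almost all $(t_1,t_2)\in[0,T]^2$. **Conclusion.** Suppose that for Lebesgue-almost every $t\in[0,T]$ the limit $$D_tY_{t-}=\lim_{\varepsilon\downarrow0}\frac1\varepsilon\int_{t-\varepsilon}^tD_tY_s\,ds\qquad\Big(\text{resp. } D_tY_{t+}=\lim_{\varepsilon\downarrow0}\frac1\varepsilon\int_t^{t+\varepsilon}D_tY_s\,ds\Big)$$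 exists a.s. Then $Y\in Dom(\delta)$; the limit $D_{t_1}Y_{t_2-}=\lim_{\varepsilon\downarrow0}\frac1\varepsilon\int_{t_2-\varepsilon}^{t_2}D_{t_1}Y_s\,ds$ (resp. $D_{t_1}Y_{t_2+}$) exists a.s. for $|\mu|$-almost every $(t_1,t_2)$; the integrands below are a.s. integrable; and for every $t\in[0,T]$, $Y1_{[0,t]}\in Dom(\delta)$, the forward (resp. backward) integral of $Y$ up to $t$ exists, and $$\int_0^tY\,d^{-}X=\int_0^tY\,\delta X+\int_{[0,T]\times[0,t]}D_{t_1}Y_{t_2-}\,d\mu(t_1,t_2)$$ $$=\int_0^tY\,\delta X+\int_0^tD_sY_{s-}\,\mathcal E'(s)\,ds+\int_{[0,T]\times[0,t]}D_{t_1}Y_{t_2}\frac{\partial^2R}{\partial s_1\partial s_2}(t_1,t_2)\,dt_1dt_2$$ (resp. the same formulas with $d^+X$, $D_{t_1}Y_{t_2+}$ and $D_sY_{s+}$). In particular, for $t=T$, $$\int_0^TY\,d^-X=\int_0^TY\,\delta X+\int_0^TD_tY_{t-}\,\mathcal E'(t)\,dt+\int_{[0,T]^2}D_{t_1}Y_{t_2}\frac{\partial^2R}{\partial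 s_1\partial s_2}(t_1,t_2)\,dt_1dt_2 .$$ -/

import Mathlib

open MeasureTheory ProbabilityTheory Filter Set
open scoped Topology ENNReal

noncomputable section

namespace CovMeasure

/-! ### Covariance measure -/

/-- The square `[0,T]²`. -/
def square (T : ℝ) : Set (ℝ × ℝ) := Icc 0 T ×ˢ Icc 0 T

/-- The part `D_t = {(s,s) : 0 ≤ s ≤ t}` of the diagonal. -/
def diagUpTo (t : ℝ) : Set (ℝ × ℝ) := {p | p.1 = p.2 ∧ 0 ≤ p.1 ∧ p.1 ≤ t}

/-- The signed measure `μ` (carried by `[0,T]²`) is a covariance measure of the process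
`(X_t)_{t ∈ [0,T]}`: on each rectangle `]a₁,b₁] × ]a₂,b₂] ⊆ [0,T]²` it equals the planar increment
of the covariance function `R(s,t) = Cov(X_s, X_t)`. -/
structure IsCovarianceMeasure {Ω : Type*} [MeasurableSpace Ω] (X : ℝ → Ω → ℝ) (P : Measure Ω)
    (T : ℝ) (μ : SignedMeasure (ℝ × ℝ)) : Prop where
  carried : ∀ A : Set (ℝ × ℝ), MeasurableSet A → Disjoint A (square T) → μ A = 0
  rect : ∀ a₁ b₁ a₂ b₂ : ℝ, 0 ≤ a₁ → a₁ ≤ b₁ → b₁ ≤ T → 0 ≤ a₂ → a₂ ≤ b₂ → b₂ ≤ T →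
    μ (Ioc a₁ b₁ ×ˢ Ioc a₂ b₂) =
      cov[X b₁, X b₂; P] + cov[X a₁, X a₂; P] - cov[X a₁, X b₂; P] - cov[X b₁, X a₂; P]

/-- The energy function `𝓔(t) = μ(D_t)`. -/
def energy (μ : SignedMeasure (ℝ × ℝ)) (t : ℝ) : ℝ := μ (diagUpTo t)

/-- The off-diagonal part `μ_od(A) = μ(A \ D_T)`. -/
def offDiagPart (μ : SignedMeasure (ℝ × ℝ)) (T : ℝ) (A : Set (ℝ × ℝ)) : ℝ := μ (A \ diagUpTo T)

/-! ### The space `L_μ` -/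

/-- `‖φ‖²_{|H|} = ∫∫ |φ(u)| |φ(v)| d|μ|(u,v)`. -/
def absNormSq (μ : SignedMeasure (ℝ × ℝ)) (φ : ℝ → ℝ) : ℝ≥0∞ :=
  ∫⁻ p, ‖φ p.1‖ₑ * ‖φ p.2‖ₑ ∂μ.variation

/-- `φ ∈ L_μ`. As `μ` is carried by `[0,T]²`, only the values of `φ` on `[0,T]` matter. -/
def MemL (μ : SignedMeasure (ℝ × ℝ)) (φ : ℝ → ℝ) : Prop :=
  Measurable φ ∧ absNormSq μ φ < ∞

/-- `⟨φ, ψ⟩_H = ∫∫ φ(u) ψ(v) dμ(u,v)`. -/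
def hInner (μ : SignedMeasure (ℝ × ℝ)) (φ ψ : ℝ → ℝ) : ℝ :=
  ∫ᵛ p, φ p.1 * ψ p.2 ∂•μ

/-- `‖φ‖²_{|H| ⊗ |H|} = ∫∫ ‖φ(t₁,·)‖_{|H|} ‖φ(t₂,·)‖_{|H|} d|μ|(t₁,t₂)`. -/
def absNormSq₂ (μ : SignedMeasure (ℝ × ℝ)) (φ : ℝ → ℝ → ℝ) : ℝ≥0∞ :=
  ∫⁻ p, absNormSq μ (φ p.1) ^ (1 / 2 : ℝ) * absNormSq μ (φ p.2) ^ (1 / 2 : ℝ) ∂μ.variation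

/-- `φ ∈ L_{μ,2}`. -/
def MemL₂ (μ : SignedMeasure (ℝ × ℝ)) (T : ℝ) (φ : ℝ → ℝ → ℝ) : Prop :=
  (∀ t₁ ∈ Icc 0 T, MemL μ (φ t₁)) ∧ absNormSq₂ μ φ < ∞

/-! ### Wiener integral -/

/-- Step functions `∑ cᵢ 1_{]aᵢ,bᵢ]}` on `[0,T]`. -/
structure Step (T : ℝ) where
  n : ℕ
  c : Fin n → ℝ
  a : Fin n → ℝ
  b : Fin n → ℝ
  a_nonneg : ∀ i, 0 ≤ a i
  a_le_b : ∀ i, a i ≤ b i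
  b_le : ∀ i, b i ≤ T

/-- The function `∑ cᵢ 1_{]aᵢ,bᵢ]}`. -/
def Step.fn {T : ℝ} (φ : Step T) (s : ℝ) : ℝ :=
  ∑ i, φ.c i * (Ioc (φ.a i) (φ.b i)).indicator (fun _ => 1) s

/-- The elementary integral `∑ cᵢ (X_{bᵢ} - X_{aᵢ})`. -/
def Step.integral {Ω : Type*} {T : ℝ} (φ : Step T) (X : ℝ → Ω → ℝ) (ω : Ω) : ℝ :=
  ∑ i, φ.c i * (X (φ.b i) ω - X (φ.a i) ω)

section Malliavin

variable {Ω : Type*} [MeasurableSpace Ω] (X : ℝ → Ω → ℝ) (P : Measure Ω) (T : ℝ)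
  (μ : SignedMeasure (ℝ × ℝ))

/-- `W = ∫₀ᵀ φ dX`, the Wiener integral of `φ`: the continuous extension, with respect to `‖·‖_H`,
of the elementary integral. -/
def IsWienerIntegral (φ : ℝ → ℝ) (W : Ω → ℝ) : Prop :=
  MemLp W 2 P ∧ ∃ φₙ : ℕ → Step T,
    Tendsto (fun k => hInner μ (fun s => (φₙ k).fn s - φ s) (fun s => (φₙ k).fn s - φ s))
      atTop (𝓝 0) ∧
    Tendsto (fun k => eLpNorm (fun ω => (φₙ k).integral X ω - W ω) 2 P) atTop (𝓝 0)

/-! ### Malliavin derivative -/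

/-- Smooth cylindrical random variables `F = f(∫φ₁dX, …, ∫φₙdX)`, `f ∈ C_b^∞(ℝⁿ)`, `φᵢ ∈ L_μ`. -/
structure Cyl where
  n : ℕ
  f : (Fin n → ℝ) → ℝ
  f_smooth : ContDiff ℝ (⊤ : ℕ∞) f
  f_bdd : ∀ k : ℕ, ∃ C : ℝ, ∀ x, ‖iteratedFDeriv ℝ k f x‖ ≤ C
  φ : Fin n → ℝ → ℝ
  φ_mem : ∀ i, MemL μ (φ i)
  W : Fin n → Ω → ℝ
  isWiener : ∀ i, IsWienerIntegral X P T μ (φ i) (W i)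

variable {X P T μ}

/-- The random variable `F`. -/
def Cyl.val (F : Cyl X P T μ) (ω : Ω) : ℝ := F.f (fun i => F.W i ω)

/-- The Malliavin derivative `D_t F = ∑ᵢ ∂ᵢf(∫φ₁dX, …, ∫φₙdX) φᵢ(t)`. -/
def Cyl.deriv (F : Cyl X P T μ) (t : ℝ) (ω : Ω) : ℝ :=
  ∑ i, fderiv ℝ F.f (fun j => F.W j ω) (Pi.single i 1) * F.φ i t

variable (X P T μ)

/-- `Cyl(L_μ)`: the processes `u_t = ∑_ℓ ψ_ℓ(t) G_ℓ` with `ψ_ℓ ∈ L_μ`, `G_ℓ ∈ Cyl`. -/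
structure CylProc where
  n : ℕ
  ψ : Fin n → ℝ → ℝ
  ψ_mem : ∀ l, MemL μ (ψ l)
  G : Fin n → Cyl X P T μ

variable {X P T μ}

/-- `u_t`. -/
def CylProc.val (u : CylProc X P T μ) (t : ℝ) (ω : Ω) : ℝ := ∑ l, u.ψ l t * (u.G l).val ω

/-- `(t₁, t₂) ↦ D_{t₁} u_{t₂}`. -/
def CylProc.deriv (u : CylProc X P T μ) (t₁ t₂ : ℝ) (ω : Ω) : ℝ :=
  ∑ l, u.ψ l t₂ * (u.G l).deriv t₁ ω

variable (X P T μ)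

/-- `F ∈ 𝔻^{1,2}` and the (`L_μ`-valued) random function `DF` is its Malliavin derivative: for some
cylindrical `Fₙ`, `Fₙ → F` in `L²(Ω)` and `E‖DFₙ - DF‖²_H → 0`. -/
def HasMalliavinDeriv (F : Ω → ℝ) (DF : ℝ → Ω → ℝ) : Prop :=
  MemLp F 2 P ∧ (∀ᵐ ω ∂P, MemL μ (fun t => DF t ω)) ∧
  ∃ Fₙ : ℕ → Cyl X P T μ,
    Tendsto (fun k => eLpNorm (fun ω => (Fₙ k).val ω - F ω) 2 P) atTop (𝓝 0) ∧
    Tendsto (fun k => ∫⁻ ω, ENNReal.ofReal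
      (hInner μ (fun t => (Fₙ k).deriv t ω - DF t ω) (fun t => (Fₙ k).deriv t ω - DF t ω)) ∂P)
      atTop (𝓝 0)

/-- `Y ∈ |𝔻^{1,2}(L_μ)|` with derivative `DY`, where `DY t₁ t₂ = D_{t₁} Y_{t₂}`: for some `uₙ` in
`Cyl(L_μ)`, `E‖Y - uₙ‖²_{|H|} → 0` and `E‖Duₙ - DY‖²_{|H| ⊗ |H|} → 0`. -/
def HasMalliavinDerivProc (Y : ℝ → Ω → ℝ) (DY : ℝ → ℝ → Ω → ℝ) : Prop :=
  (∀ᵐ ω ∂P, MemL μ (fun t => Y t ω)) ∧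
  (∀ᵐ ω ∂P, MemL₂ μ T (fun t₁ t₂ => DY t₁ t₂ ω)) ∧
  ∃ uₙ : ℕ → CylProc X P T μ,
    Tendsto (fun k => ∫⁻ ω, absNormSq μ (fun t => Y t ω - (uₙ k).val t ω) ∂P) atTop (𝓝 0) ∧
    Tendsto (fun k => ∫⁻ ω, absNormSq₂ μ
      (fun t₁ t₂ => (uₙ k).deriv t₁ t₂ ω - DY t₁ t₂ ω) ∂P) atTop (𝓝 0)

/-! ### Skorohod integral -/

/-- `u ∈ Dom(δ)` and `Z = ∫₀ᵀ u δX`: `u ∈ L²(Ω; L_μ)`, `Z` is square integrable with zero mean, and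
`E(F Z) = E⟨DF, u⟩_H` for every cylindrical `F`. -/
def IsSkorohodIntegral (u : ℝ → Ω → ℝ) (Z : Ω → ℝ) : Prop :=
  Measurable (fun q : ℝ × Ω => u q.1 q.2) ∧
  ∫⁻ ω, absNormSq μ (fun t => u t ω) ∂P < ∞ ∧
  MemLp Z 2 P ∧ ∫ ω, Z ω ∂P = 0 ∧
  ∀ F : Cyl X P T μ,
    ∫ ω, F.val ω * Z ω ∂P = ∫ ω, hInner μ (fun s => F.deriv s ω) (fun s => u s ω) ∂P

end Malliavin

/-! ### Forward and backward integrals -/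

/-- The prolongation by continuity of `(X_t)_{t ∈ [0,T]}` to `ℝ`. -/
def prolong {Ω : Type*} (X : ℝ → Ω → ℝ) (T s : ℝ) (ω : Ω) : ℝ := X (max 0 (min s T)) ω

/-- `J = ∫₀ᵗ Y d⁻X`: limit in probability, as `ε ↓ 0`, of `∫₀ᵗ Y_s (X_{s+ε} - X_s)/ε ds`. -/
def IsForwardIntegral {Ω : Type*} [MeasurableSpace Ω] (X : ℝ → Ω → ℝ) (P : Measure Ω) (T : ℝ)
    (Y : ℝ → Ω → ℝ) (t : ℝ) (J : Ω → ℝ) : Prop :=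
  AEStronglyMeasurable J P ∧
  TendstoInMeasure P
    (fun ε ω => ∫ s in (0 : ℝ)..t, Y s ω * ((prolong X T (s + ε) ω - prolong X T s ω) / ε))
    (𝓝[>] (0 : ℝ)) J

/-- `J = ∫₀ᵗ Y d⁺X`: limit in probability, as `ε ↓ 0`, of `∫₀ᵗ Y_s (X_s - X_{s-ε})/ε ds`. -/
def IsBackwardIntegral {Ω : Type*} [MeasurableSpace Ω] (X : ℝ → Ω → ℝ) (P : Measure Ω) (T : ℝ)
    (Y : ℝ → Ω → ℝ) (t : ℝ) (J : Ω → ℝ) : Prop :=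
  AEStronglyMeasurable J P ∧
  TendstoInMeasure P
    (fun ε ω => ∫ s in (0 : ℝ)..t, Y s ω * ((prolong X T s ω - prolong X T (s - ε) ω) / ε))
    (𝓝[>] (0 : ℝ)) J

/-! ### The traces `D_{t₁}Y_{t₂-}` and `D_{t₁}Y_{t₂+}` -/

section Traces

variable {Ω : Type*} (DY : ℝ → ℝ → Ω → ℝ) (t₁ t₂ : ℝ) (ω : Ω)

/-- `ε⁻¹ ∫_{t₂-ε}^{t₂} D_{t₁}Y_s ds`. -/
def leftMean (ε : ℝ) : ℝ := ε⁻¹ * ∫ s in (t₂ - ε)..t₂, DY t₁ s ω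

/-- `ε⁻¹ ∫_{t₂}^{t₂+ε} D_{t₁}Y_s ds`. -/
def rightMean (ε : ℝ) : ℝ := ε⁻¹ * ∫ s in t₂..(t₂ + ε), DY t₁ s ω

/-- The limit defining `D_{t₁}Y_{t₂-}` exists. -/
def HasLeftTrace : Prop := ∃ l : ℝ, Tendsto (leftMean DY t₁ t₂ ω) (𝓝[>] 0) (𝓝 l)

/-- The limit defining `D_{t₁}Y_{t₂+}` exists. -/
def HasRightTrace : Prop := ∃ l : ℝ, Tendsto (rightMean DY t₁ t₂ ω) (𝓝[>] 0) (𝓝 l)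

/-- `D_{t₁}Y_{t₂-}` (meaningful where `HasLeftTrace` holds). -/
def leftTrace : ℝ := limUnder (𝓝[>] (0 : ℝ)) (leftMean DY t₁ t₂ ω)

/-- `D_{t₁}Y_{t₂+}` (meaningful where `HasRightTrace` holds). -/
def rightTrace : ℝ := limUnder (𝓝[>] (0 : ℝ)) (rightMean DY t₁ t₂ ω)

end Traces

end CovMeasure

end

open CovMeasure

noncomputable section

namespace CovMeasure

/-! ### Integration against a signed measure with a density. -/

section SignedDensity

variable {α : Type*} [MeasurableSpace α] {m₀ : Measure α} {ρ : α → ℝ}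

/-! Both integrals are limits of `ε⁻¹ ∫₀ᵗ Y_s Δ_s ds`, where `Δ_s` is the increment of `X` over the
window `]s - dε, s + (1-d)ε]`: `d = 0` is the forward and `d = 1` the backward case, and everything
is proved for `d ∈ [0,1]`. Subtracting and adding `⟨DY_s, 1_window⟩_H` under the integral splits it,
path by path, into two terms (`inv_mul_integral_eq`).

The first term is the average of `Y_s Δ_s - ⟨DY_s, 1_window⟩_H` and converges in `L²(Ω)` to the
Skorohod integral. The reason is the isometry formula `integral_corr_mul_corr`, which gives the
scalar product of two such corrected increments as `E[FG]⟨1,1'⟩ + E[⟨DF,1'⟩⟨DG,1⟩]`. After averaging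
over both windows the right-hand side consists of integrals of sliding means of `Y` and `DY` with
respect to `μ` and `μ ⊗ μ`; as the two widths tend to `0` independently, these converge by
Lebesgue's differentiation theorem and domination. Convergence of scalar products forces convergence
in `L²` (`exists_memLp_of_tendsto_integral_mul`). The limit is recognised as a Skorohod integral by
passing to the limit in the duality formula `integral_val_mul_corr`.

The second term is, by Fubini, the `μ`-integral of the mean of `s ↦ D_{t₁}Y_s` near `t₂`. It
converges almost surely by dominated convergence as soon as these means converge `|μ|`-almost
everywhere. Off the diagonal this is again Lebesgue's theorem, with limit `D_{t₁}Y_{t₂}`; on the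
diagonal it is the assumption on the traces (`ae_ae_hasTrace'`, `tendsto_integral_smear`).

Assumptions i) and ii) enter through `eq_withDensityᵥ_glueDensity`: `μ` has a density with respect
to length on the diagonal plus area on the square. Hence both marginals of `|μ|` are absolutely
continuous, and Lebesgue-almost-everywhere statements in one variable hold `|μ|`-almost everywhere.
The isometry and duality formulas come from Gaussian integration by parts
(`integral_comp_mul_of_hasGaussianLaw`) for cylindrical variables and pass to Malliavin
differentiable variables by `L²` limits. This passage needs the Cauchy-Schwarz inequality for
`⟨·,·⟩_H` (`hInner_sq_le`), which holds because the form is a limit of covariances of regularized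
Wiener integrals. -/

theorem integral_withDensityᵥ (hρ : Integrable ρ m₀) {f : α → ℝ}
    (hf : Integrable f (m₀.withDensityᵥ ρ).variation) :
    ∫ᵛ x, f x ∂•(m₀.withDensityᵥ ρ) = ∫ x, f x * ρ x ∂m₀ := by
  rw [Measure.variation_withDensityᵥ hρ] at hf
  have hp : IsFiniteMeasure (m₀.withDensity fun x => ENNReal.ofReal (ρ x)) :=
    isFiniteMeasure_withDensity_ofReal hρ.2
  have hn : IsFiniteMeasure (m₀.withDensity fun x => ENNReal.ofReal (-ρ x)) :=
    isFiniteMeasure_withDensity_ofReal hρ.neg.2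
  have lep : ∀ x, ENNReal.ofReal (ρ x) ≤ ‖ρ x‖ₑ := fun x => by
    rw [← ofReal_norm]; exact ENNReal.ofReal_le_ofReal (le_abs_self _)
  have len : ∀ x, ENNReal.ofReal (-ρ x) ≤ ‖ρ x‖ₑ := fun x => by
    rw [← ofReal_norm]; exact ENNReal.ofReal_le_ofReal (neg_le_abs _)
  have hfp : Integrable f (m₀.withDensity fun x => ENNReal.ofReal (ρ x)) :=
    hf.mono_measure (withDensity_mono (Eventually.of_forall lep))
  have hfn : Integrable f (m₀.withDensity fun x => ENNReal.ofReal (-ρ x)) :=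
    hf.mono_measure (withDensity_mono (Eventually.of_forall len))
  -- Multiplication of reals is commutative, so the pairing equals its flip, the shape needed to
  -- turn integrals against positive measures into Bochner integrals.
  have hB : (ContinuousLinearMap.lsmul ℝ ℝ : ℝ →L[ℝ] ℝ →L[ℝ] ℝ)
      = (ContinuousLinearMap.lsmul ℝ ℝ).flip := by
    ext; simp
  rw [withDensityᵥ_eq_withDensity_pos_part_sub_withDensity_neg_part hρ,
    VectorMeasure.integral_sub_vectorMeasure, hB, VectorMeasure.integral_toSignedMeasure,
    VectorMeasure.integral_toSignedMeasure]
  · have h1 := hρ.aestronglyMeasurable.aemeasurable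
    have h2 : AEMeasurable (fun x => -ρ x) m₀ := h1.neg
    rw [integral_withDensity_eq_integral_toReal_smul₀ h1.ennreal_ofReal
        (Eventually.of_forall fun _ => ENNReal.ofReal_lt_top),
      integral_withDensity_eq_integral_toReal_smul₀ h2.ennreal_ofReal
        (Eventually.of_forall fun _ => ENNReal.ofReal_lt_top), ← integral_sub]
    · congr with x
      simp only [smul_eq_mul, ENNReal.toReal_ofReal']
      rw [← sub_mul, mul_comm]
      congr 1
      rcases le_total 0 (ρ x) with h | h <;> simp [h]
    · exact (integrable_withDensity_iff_integrable_smul₀' h1.ennreal_ofReal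
        (Eventually.of_forall fun _ => ENNReal.ofReal_lt_top)).1 hfp
    · exact (integrable_withDensity_iff_integrable_smul₀' h2.ennreal_ofReal
        (Eventually.of_forall fun _ => ENNReal.ofReal_lt_top)).1 hfn
  · simpa [VectorMeasure.Integrable] using hfp
  · simpa [VectorMeasure.Integrable] using hfn

/-- The polar decomposition `dμ = θ d|μ|`, with `θ` the sign of the density. It turns every vector
measure integral below into a Bochner integral, where Fubini and dominated convergence apply. The
sign is `1` at zeros of the density, so that `|θ| = 1` everywhere. -/
theorem exists_sign_integral_withDensityᵥ (hρ : Integrable ρ m₀) :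
    ∃ θ : α → ℝ, Measurable θ ∧ (∀ x, |θ x| = 1) ∧
      ∀ f : α → ℝ, ∫ᵛ x, f x ∂•(m₀.withDensityᵥ ρ) =
        ∫ x, f x * θ x ∂(m₀.withDensityᵥ ρ).variation := by
  obtain ⟨ρ', hρ', he⟩ := hρ.aestronglyMeasurable
  have habs : ∀ x, |(if 0 ≤ ρ' x then 1 else -1 : ℝ)| = 1 := fun x => by split_ifs <;> simp
  have hθ : Measurable fun x => (if 0 ≤ ρ' x then 1 else -1 : ℝ) :=
    Measurable.ite (measurableSet_le measurable_const hρ'.measurable) measurable_const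
      measurable_const
  refine ⟨_, hθ, habs, fun f => ?_⟩
  by_cases hf : Integrable f (m₀.withDensityᵥ ρ).variation
  · rw [integral_withDensityᵥ hρ hf, Measure.variation_withDensityᵥ hρ,
      integral_withDensity_eq_integral_toReal_smul₀ hρ.aestronglyMeasurable.enorm
        (Eventually.of_forall fun _ => enorm_lt_top)]
    refine integral_congr_ae ?_
    filter_upwards [he] with x hx
    rw [toReal_enorm, smul_eq_mul, Real.norm_eq_abs, mul_left_comm, hx]
    split_ifs with h
    · rw [abs_of_nonneg h, mul_one]
    · rw [abs_of_neg (not_le.1 h)]; ring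
  -- Without integrability both sides are `0` by convention, because multiplication by `θ` does not
  -- affect integrability. This is why `f` is arbitrary.
  · rw [VectorMeasure.integral_undef hf, integral_undef]
    intro h
    refine hf ((h.mul_bdd (c := 1) hθ.aestronglyMeasurable
      (Eventually.of_forall fun x => (habs x).le)).congr (Eventually.of_forall fun x => ?_))
    have := abs_mul_abs_self (if 0 ≤ ρ' x then 1 else -1 : ℝ)
    rw [habs] at this
    simp only [mul_assoc, ← this, mul_one]

end SignedDensity

/-! ### Density of the covariance measure on and off the diagonal. -/

section Structure

/-- Lebesgue measure on `[0,T]`. -/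
abbrev leb (T : ℝ) : Measure ℝ := volume.restrict (Icc 0 T)

/-- The sum of the length on the diagonal and the area of `[0,T]²`. -/
def refMeasure (T : ℝ) : Measure (ℝ × ℝ) := (leb T).map (fun s => (s, s)) + (leb T).prod (leb T)

/-- The function equal to `E'` on the diagonal and to `r` off the diagonal. -/
def glueDensity (E' : ℝ → ℝ) (r : ℝ × ℝ → ℝ) (p : ℝ × ℝ) : ℝ := if p.1 = p.2 then E' p.1 else r p

theorem leb_prod_leb (T : ℝ) : (leb T).prod (leb T) = volume.restrict (square T) := by
  rw [Measure.prod_restrict]; rfl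

theorem measurable_diag : Measurable (fun s : ℝ => (s, s)) := measurable_id.prodMk measurable_id

theorem ae_ne_leb_prod (T : ℝ) : ∀ᵐ p ∂(leb T).prod (leb T), p.1 ≠ p.2 := by
  have hms : MeasurableSet {p : ℝ × ℝ | p.1 = p.2} := measurableSet_eq_fun measurable_fst measurable_snd
  rw [ae_iff]
  simp only [ne_eq, not_not]
  rw [Measure.measure_prod_null hms]
  refine Eventually.of_forall fun x => ?_
  have : Prod.mk x ⁻¹' {p : ℝ × ℝ | p.1 = p.2} = {x} := by ext; simp [eq_comm]
  simp [this]

theorem glueDensity_ae_eq (T : ℝ) (E' : ℝ → ℝ) (r : ℝ × ℝ → ℝ) :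
    glueDensity E' r =ᵐ[(leb T).prod (leb T)] r := by
  filter_upwards [ae_ne_leb_prod T] with p hp using if_neg hp

variable {T : ℝ} {E' : ℝ → ℝ} {r : ℝ × ℝ → ℝ}

theorem measurableEmbedding_diag : MeasurableEmbedding (fun s : ℝ => (s, s)) := by
  have hr : MeasurableSet (range fun s : ℝ => (s, s)) := by
    have : (range fun s : ℝ => (s, s)) = {p : ℝ × ℝ | p.1 = p.2} := by
      ext ⟨x, y⟩; simp
    rw [this]
    exact measurableSet_eq_fun measurable_fst measurable_snd
  exact MeasurableEmbedding.of_measurable_inverse (g := Prod.fst) measurable_diag hr measurable_fst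
    fun _ => rfl

theorem integrable_refMeasure_mul_iff (f : ℝ × ℝ → ℝ) :
    Integrable (fun p => f p * glueDensity E' r p) (refMeasure T) ↔
      IntegrableOn (fun s => f (s, s) * E' s) (Icc 0 T) ∧
      IntegrableOn (fun p => f p * r p) (square T) := by
  rw [refMeasure, integrable_add_measure, measurableEmbedding_diag.integrable_map_iff,
    IntegrableOn, IntegrableOn, ← leb_prod_leb]
  refine and_congr ?_ (integrable_congr ?_)
  · simp [Function.comp_def, glueDensity]
  · filter_upwards [glueDensity_ae_eq T E' r] with p hp
    rw [hp]

theorem integral_refMeasure_mul {f : ℝ × ℝ → ℝ}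
    (h : Integrable (fun p => f p * glueDensity E' r p) (refMeasure T)) :
    ∫ p, f p * glueDensity E' r p ∂(refMeasure T) =
      (∫ s in Icc 0 T, f (s, s) * E' s) + ∫ p in square T, f p * r p := by
  have h' := h
  rw [refMeasure, integrable_add_measure] at h'
  rw [refMeasure, integral_add_measure h'.1 h'.2, measurableEmbedding_diag.integral_map,
    ← leb_prod_leb]
  congr 1
  · simp [glueDensity]
  · refine integral_congr_ae ?_
    filter_upwards [glueDensity_ae_eq T E' r] with p hp
    rw [hp]

/-- The diagonal part of `μ`, projected to the line, has distribution function `energy μ`, so it is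
`E' ds`; the off-diagonal part is `r` times area. The diagonal is null for area, so the two
densities glue into one. -/
theorem eq_withDensityᵥ_glueDensity {μ : SignedMeasure (ℝ × ℝ)}
    (hcar : ∀ A : Set (ℝ × ℝ), MeasurableSet A → Disjoint A (square T) → μ A = 0)
    (hE'int : IntegrableOn E' (Icc 0 T))
    (hE' : ∀ t ∈ Icc 0 T, energy μ t = ∫ s in (0 : ℝ)..t, E' s)
    (hrint : IntegrableOn r (square T))
    (hr : ∀ A : Set (ℝ × ℝ), MeasurableSet A → A ⊆ square T → offDiagPart μ T A = ∫ p in A, r p)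
    (hT : 0 < T) :
    Integrable (glueDensity E' r) (refMeasure T) ∧
      μ = (refMeasure T).withDensityᵥ (glueDensity E' r) := by
  have hint : Integrable (glueDensity E' r) (refMeasure T) := by
    have := (integrable_refMeasure_mul_iff (T := T) (E' := E') (r := r) (fun _ => 1)).2
      ⟨by simpa using hE'int, by simpa using hrint⟩
    simpa using this
  refine ⟨hint, ?_⟩
  have hmdiag : ∀ t, MeasurableSet (diagUpTo t) := fun t =>
    ((isClosed_eq continuous_fst continuous_snd).inter
      ((isClosed_le continuous_const continuous_fst).inter
        (isClosed_le continuous_fst continuous_const))).measurableSet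
  have hmsq : MeasurableSet (square T) := measurableSet_Icc.prod measurableSet_Icc
  -- Half-lines generate the Borel sets and form a π-system, so comparing distribution functions
  -- suffices.
  have hdiag : (μ.restrict (diagUpTo T)).map Prod.fst = (leb T).withDensityᵥ E' := by
    have key : ∀ B : Set ℝ, MeasurableSet B →
        (μ.restrict (diagUpTo T)).map Prod.fst B = μ (Prod.fst ⁻¹' B ∩ diagUpTo T) := by
      intro B hB
      rw [VectorMeasure.map_apply _ measurable_fst hB,
        VectorMeasure.restrict_apply _ (hmdiag T) (measurable_fst hB)]
    have key2 : ∀ a, (μ.restrict (diagUpTo T)).map Prod.fst (Iic a)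
        = (leb T).withDensityᵥ E' (Iic a) := by
      intro a
      rw [key _ measurableSet_Iic, withDensityᵥ_apply hE'int measurableSet_Iic,
        Measure.restrict_restrict measurableSet_Iic]
      rcases lt_or_ge a 0 with ha | ha
      · have h1 : Prod.fst ⁻¹' Iic a ∩ diagUpTo T = ∅ := by
          ext p; simp only [diagUpTo]; grind
        have h2 : Iic a ∩ Icc 0 T = ∅ := by ext p; grind
        rw [h1, h2]; simp
      · have h1 : Prod.fst ⁻¹' Iic a ∩ diagUpTo T = diagUpTo (min a T) := by
          ext p; simp only [diagUpTo, mem_inter_iff, mem_preimage, mem_Iic, mem_ofPred_eq, le_min_iff]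
          tauto
        have h2 : Iic a ∩ Icc 0 T = Icc 0 (min a T) := by
          ext p; simp only [mem_inter_iff, mem_Iic, mem_Icc, le_min_iff]; tauto
        have h3 := hE' (min a T) ⟨le_min ha hT.le, min_le_right _ _⟩
        rw [h1, h2, integral_Icc_eq_integral_Ioc,
          ← intervalIntegral.integral_of_le (le_min ha hT.le), ← h3, energy]
    refine VectorMeasure.ext_of_generateFrom (range Iic) ?_ ?_ ?_ ?_
    · rintro _ ⟨a, rfl⟩; exact key2 a
    · rw [← borel_eq_generateFrom_Iic]; exact BorelSpace.measurable_eq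
    · simpa using isPiSystem_image_Iic (univ : Set ℝ)
    -- The whole line is not a half-line; its mass is compared through `Iic T`, which already
    -- carries both measures.
    · have h1 := key2 T
      rw [key _ measurableSet_Iic] at h1
      rw [key _ MeasurableSet.univ]
      have h2 : Prod.fst ⁻¹' Iic T ∩ diagUpTo T = Prod.fst ⁻¹' univ ∩ diagUpTo T := by
        ext p; simp only [diagUpTo]; grind
      rw [← h2, h1, withDensityᵥ_apply hE'int measurableSet_Iic,
        withDensityᵥ_apply hE'int MeasurableSet.univ, Measure.restrict_restrict measurableSet_Iic,
        Measure.restrict_univ]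
      congr 2
      ext x; grind
  ext A hA
  have h1 : μ A = μ (A ∩ square T) := by
    rw [← VectorMeasure.of_add_of_sdiff (hA.inter hmsq) hA inter_subset_left,
      hcar (A \ (A ∩ square T)) (hA.diff (hA.inter hmsq)), add_zero]
    rw [Set.disjoint_left]; grind
  have h2 : A ∩ square T ∩ diagUpTo T = Prod.fst ⁻¹' ((fun s : ℝ => (s, s)) ⁻¹' A) ∩ diagUpTo T := by
    ext ⟨x, y⟩; simp only [diagUpTo, square]; grind
  have h3 : μ (A ∩ square T) = μ (A ∩ square T ∩ diagUpTo T) + ∫ p in A ∩ square T, r p := by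
    rw [← hr _ (hA.inter hmsq) inter_subset_right, offDiagPart,
      ← VectorMeasure.of_add_of_sdiff ((hA.inter hmsq).inter (hmdiag T)) (hA.inter hmsq)
        inter_subset_left, sdiff_self_inter]
  have h4 : μ (A ∩ square T ∩ diagUpTo T) = ∫ s in (fun s : ℝ => (s, s)) ⁻¹' A ∩ Icc 0 T, E' s := by
    have := congrArg (fun κ => κ ((fun s : ℝ => (s, s)) ⁻¹' A)) hdiag
    rw [VectorMeasure.map_apply _ measurable_fst (measurable_diag hA),
      VectorMeasure.restrict_apply _ (hmdiag T) (measurable_fst (measurable_diag hA)),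
      withDensityᵥ_apply hE'int (measurable_diag hA),
      Measure.restrict_restrict (measurable_diag hA)] at this
    rw [h2, this]
  rw [h1, h3, h4, withDensityᵥ_apply hint hA, ← integral_indicator hA]
  have h5 : A.indicator (glueDensity E' r) = fun p => A.indicator 1 p * glueDensity E' r p := by
    ext p; by_cases hp : p ∈ A <;> simp [hp]
  rw [h5, integral_refMeasure_mul]
  · congr 1
    · rw [← integral_indicator ((measurable_diag hA).inter measurableSet_Icc),
        ← integral_indicator measurableSet_Icc]
      congr with s
      by_cases h : (s, s) ∈ A <;> by_cases h' : s ∈ Icc 0 T <;> simp [indicator, h, h']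
    · rw [← integral_indicator (hA.inter hmsq), ← integral_indicator hmsq]
      congr with s
      by_cases h : s ∈ A <;> by_cases h' : s ∈ square T <;> simp [indicator, h, h']
  · rw [← h5]; exact hint.indicator hA

theorem ae_refMeasure {p : ℝ × ℝ → Prop} (h1 : ∀ᵐ s ∂leb T, p (s, s))
    (h2 : ∀ᵐ q ∂(leb T).prod (leb T), p q) : ∀ᵐ q ∂refMeasure T, p q := by
  rw [refMeasure, ae_add_measure_iff, measurableEmbedding_diag.ae_map_iff]
  exact ⟨h1, h2⟩

theorem quasiMeasurePreserving_fst_refMeasure :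
    Measure.QuasiMeasurePreserving Prod.fst (refMeasure T) (leb T) := by
  refine ⟨measurable_fst, Measure.AbsolutelyContinuous.mk fun s hs h0 => ?_⟩
  have h : ∀ᵐ x ∂leb T, x ∉ s := measure_eq_zero_iff_ae_notMem.1 h0
  rw [Measure.map_apply measurable_fst hs, measure_eq_zero_iff_ae_notMem]
  exact ae_refMeasure h (Measure.quasiMeasurePreserving_fst.ae h)

theorem quasiMeasurePreserving_snd_refMeasure :
    Measure.QuasiMeasurePreserving Prod.snd (refMeasure T) (leb T) := by
  refine ⟨measurable_snd, Measure.AbsolutelyContinuous.mk fun s hs h0 => ?_⟩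
  have h : ∀ᵐ x ∂leb T, x ∉ s := measure_eq_zero_iff_ae_notMem.1 h0
  rw [Measure.map_apply measurable_snd hs, measure_eq_zero_iff_ae_notMem]
  exact ae_refMeasure h (Measure.quasiMeasurePreserving_snd.ae h)

end Structure

/-- The signed measure `μ` is `E' ds` on the diagonal of `[0,T]²` plus `r` off the diagonal. -/
structure HasGlueDensity (T : ℝ) (E' : ℝ → ℝ) (r : ℝ × ℝ → ℝ) (μ : SignedMeasure (ℝ × ℝ)) :
    Prop where
  integrable : Integrable (glueDensity E' r) (refMeasure T)
  eq_withDensityᵥ : μ = (refMeasure T).withDensityᵥ (glueDensity E' r)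

namespace HasGlueDensity

variable {T : ℝ} {E' : ℝ → ℝ} {r : ℝ × ℝ → ℝ} {μ : SignedMeasure (ℝ × ℝ)}

theorem variation_eq (h : HasGlueDensity T E' r μ) :
    μ.variation = (refMeasure T).withDensity fun p => ‖glueDensity E' r p‖ₑ := by
  rw [h.eq_withDensityᵥ, Measure.variation_withDensityᵥ h.integrable]

theorem variation_ac (h : HasGlueDensity T E' r μ) : μ.variation ≪ refMeasure T := by
  rw [h.variation_eq]; exact withDensity_absolutelyContinuous _ _

theorem ae_variation (h : HasGlueDensity T E' r μ) {p : ℝ × ℝ → Prop}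
    (h1 : ∀ᵐ s ∂leb T, p (s, s)) (h2 : ∀ᵐ q ∂(leb T).prod (leb T), p q) :
    ∀ᵐ q ∂μ.variation, p q :=
  h.variation_ac (ae_refMeasure h1 h2)

/-- The first marginal of `|μ|` is absolutely continuous: the diagonal part projects to length and
the rest to a multiple of length. Through this and `qmp_snd`, Lebesgue's differentiation theorem
becomes available under `|μ|`. -/
theorem qmp_fst (h : HasGlueDensity T E' r μ) :
    Measure.QuasiMeasurePreserving Prod.fst μ.variation (leb T) :=
  quasiMeasurePreserving_fst_refMeasure.mono_left h.variation_ac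

theorem qmp_snd (h : HasGlueDensity T E' r μ) :
    Measure.QuasiMeasurePreserving Prod.snd μ.variation (leb T) :=
  quasiMeasurePreserving_snd_refMeasure.mono_left h.variation_ac

theorem integrable_mul (h : HasGlueDensity T E' r μ) {f : ℝ × ℝ → ℝ}
    (hf : Integrable f μ.variation) :
    Integrable (fun p => f p * glueDensity E' r p) (refMeasure T) := by
  have hm := h.integrable.aestronglyMeasurable
  rw [h.variation_eq, integrable_withDensity_iff_integrable_smul₀' hm.enorm
    (Eventually.of_forall fun _ => enorm_lt_top)] at hf
  have hg : Measurable fun x : ℝ => (if 0 ≤ x then 1 else -1 : ℝ) :=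
    Measurable.ite measurableSet_Ici measurable_const measurable_const
  refine (hf.mul_bdd (c := 1) (hg.comp_aemeasurable hm.aemeasurable).aestronglyMeasurable
    (Eventually.of_forall fun p => ?_)).congr (Eventually.of_forall fun p => ?_)
  · simp only [Function.comp_apply]; split_ifs <;> simp
  · simp only [toReal_enorm, smul_eq_mul, Real.norm_eq_abs, Function.comp_apply]
    split_ifs with h0
    · rw [abs_of_nonneg h0]; ring
    · rw [abs_of_neg (not_le.1 h0)]; ring

theorem integrableOn_diag (h : HasGlueDensity T E' r μ) {f : ℝ × ℝ → ℝ}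
    (hf : Integrable f μ.variation) : IntegrableOn (fun s => f (s, s) * E' s) (Icc 0 T) :=
  ((integrable_refMeasure_mul_iff f).1 (h.integrable_mul hf)).1

theorem integrableOn_square (h : HasGlueDensity T E' r μ) {f : ℝ × ℝ → ℝ}
    (hf : Integrable f μ.variation) : IntegrableOn (fun p => f p * r p) (square T) :=
  ((integrable_refMeasure_mul_iff f).1 (h.integrable_mul hf)).2

theorem integral_eq (h : HasGlueDensity T E' r μ) {f : ℝ × ℝ → ℝ}
    (hf : Integrable f μ.variation) :
    ∫ᵛ p, f p ∂•μ = (∫ s in Icc 0 T, f (s, s) * E' s) + ∫ p in square T, f p * r p := by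
  rw [← integral_refMeasure_mul (h.integrable_mul hf), h.eq_withDensityᵥ,
    integral_withDensityᵥ h.integrable]
  rwa [← h.eq_withDensityᵥ]

theorem exists_sign (h : HasGlueDensity T E' r μ) :
    ∃ θ : ℝ × ℝ → ℝ, Measurable θ ∧ (∀ x, |θ x| = 1) ∧
      ∀ f : ℝ × ℝ → ℝ, ∫ᵛ x, f x ∂•μ = ∫ x, f x * θ x ∂μ.variation := by
  rw [h.eq_withDensityᵥ]; exact exists_sign_integral_withDensityᵥ h.integrable

end HasGlueDensity

instance (μ : SignedMeasure (ℝ × ℝ)) : IsFiniteMeasure μ.variation := by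
  rw [← SignedMeasure.totalVariation_eq_variation, SignedMeasure.totalVariation]
  infer_instance

end CovMeasure

end

noncomputable section

namespace CovMeasure

/-! ### Square integrable functions -/

section LTwo

variable {Ω : Type*} [MeasurableSpace Ω] {P : Measure Ω}

/-- Expanding `‖z_i - z_j‖²` gives three scalar products with the same limit `C`, hence the limit `C
- 2C + C = 0`, and the family is Cauchy. -/
theorem exists_tendsto_of_tendsto_inner {H ι : Type*} [NormedAddCommGroup H] [InnerProductSpace ℝ H]
    [CompleteSpace H] {l : Filter ι} [l.NeBot] {z : ι → H} {C : ℝ}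
    (h : Tendsto (fun p : ι × ι => inner ℝ (z p.1) (z p.2)) (l ×ˢ l) (𝓝 C)) :
    ∃ x, Tendsto z l (𝓝 x) := by
  have hd : Tendsto (fun p : ι × ι => dist (z p.1) (z p.2) ^ 2) (l ×ˢ l) (𝓝 0) := by
    have h1 : Tendsto (fun p : ι × ι => inner ℝ (z p.1) (z p.1)) (l ×ˢ l) (𝓝 C) :=
      h.comp (tendsto_fst.prodMk tendsto_fst)
    have h2 : Tendsto (fun p : ι × ι => inner ℝ (z p.2) (z p.2)) (l ×ˢ l) (𝓝 C) :=
      h.comp (tendsto_snd.prodMk tendsto_snd)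
    have h3 := (h1.sub (h.const_mul 2)).add h2
    refine (h3.congr fun p => ?_).trans (by ring_nf; rfl)
    rw [dist_eq_norm, norm_sub_sq_real, real_inner_self_eq_norm_sq, real_inner_self_eq_norm_sq]
  have hd' : Tendsto (fun p : ι × ι => dist (z p.1) (z p.2)) (l ×ˢ l) (𝓝 0) := by
    have := (Real.continuous_sqrt.tendsto 0).comp hd
    rw [Real.sqrt_zero] at this
    exact this.congr fun p => Real.sqrt_sq dist_nonneg
  have hc : Cauchy (l.map z) := by
    refine cauchy_map_iff.2 ⟨inferInstance, ?_⟩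
    rw [Metric.uniformity_eq_comap_nhds_zero, tendsto_comap_iff]
    exact hd'
  exact cauchy_map_iff_exists_tendsto.1 hc

/-- This form of the Cauchy criterion fits an isometry formula: only mixed second moments have to be
computed, never differences. -/
theorem exists_memLp_of_tendsto_integral_mul {ι : Type*} {l : Filter ι} [l.NeBot]
    {ζ : ι → Ω → ℝ} {C : ℝ} (hm : ∀ᶠ i in l, MemLp (ζ i) 2 P)
    (h : Tendsto (fun p : ι × ι => ∫ ω, ζ p.1 ω * ζ p.2 ω ∂P) (l ×ˢ l) (𝓝 C)) :
    ∃ Z, MemLp Z 2 P ∧ Tendsto (fun i => eLpNorm (fun ω => ζ i ω - Z ω) 2 P) l (𝓝 0) := by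
  classical
  -- Membership in `L²` holds only eventually along the filter, so a dummy value `0` is used
  -- elsewhere.
  let z : ι → Lp ℝ 2 P := fun i => if hi : MemLp (ζ i) 2 P then hi.toLp else 0
  have hz : ∀ᶠ i in l, z i =ᵐ[P] ζ i := by
    filter_upwards [hm] with i hi
    simp only [z, hi, dif_pos]; exact hi.coeFn_toLp
  have hin : Tendsto (fun p : ι × ι => inner ℝ (z p.1) (z p.2)) (l ×ˢ l) (𝓝 C) := by
    refine h.congr' ?_
    filter_upwards [hz.prod_mk hz] with p hp
    rw [L2.inner_def]
    refine integral_congr_ae ?_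
    filter_upwards [hp.1, hp.2] with ω h1 h2
    simp [h1, h2, mul_comm]
  obtain ⟨x, hx⟩ := exists_tendsto_of_tendsto_inner hin
  refine ⟨x, Lp.memLp x, ?_⟩
  refine ((Lp.tendsto_Lp_iff_tendsto_eLpNorm' _ _).1 hx).congr' ?_
  filter_upwards [hz] with i hi
  refine eLpNorm_congr_ae ?_
  filter_upwards [hi] with ω h1
  simp [h1]

theorem tendsto_integral_mul_of_tendsto_eLpNorm {ι : Type*} {l : Filter ι}
    {f g : ι → Ω → ℝ} {F G : Ω → ℝ} (hf : ∀ᶠ i in l, MemLp (f i) 2 P)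
    (hg : ∀ᶠ i in l, MemLp (g i) 2 P) (hF : MemLp F 2 P) (hG : MemLp G 2 P)
    (hfF : Tendsto (fun i => eLpNorm (fun ω => f i ω - F ω) 2 P) l (𝓝 0))
    (hgG : Tendsto (fun i => eLpNorm (fun ω => g i ω - G ω) 2 P) l (𝓝 0)) :
    Tendsto (fun i => ∫ ω, f i ω * g i ω ∂P) l (𝓝 (∫ ω, F ω * G ω ∂P)) := by
  classical
  have key : ∀ (f : ι → Ω → ℝ) (F : Ω → ℝ) (hf : ∀ᶠ i in l, MemLp (f i) 2 P) (hF : MemLp F 2 P),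
      Tendsto (fun i => eLpNorm (fun ω => f i ω - F ω) 2 P) l (𝓝 0) →
      ∃ z : ι → Lp ℝ 2 P, (∀ᶠ i in l, z i =ᵐ[P] f i) ∧ Tendsto z l (𝓝 hF.toLp) := by
    intro f F hf hF h
    have hz : ∀ᶠ i in l, ((if hi : MemLp (f i) 2 P then hi.toLp else 0 : Lp ℝ 2 P) : Ω → ℝ)
        =ᵐ[P] f i := by
      filter_upwards [hf] with i hi
      simp only [hi, dif_pos]; exact hi.coeFn_toLp
    refine ⟨_, hz, (Lp.tendsto_Lp_iff_tendsto_eLpNorm' _ _).2 (h.congr' ?_)⟩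
    filter_upwards [hz] with i hi
    refine eLpNorm_congr_ae ?_
    filter_upwards [hi, hF.coeFn_toLp] with ω h1 h2
    simp [h1, h2]
  obtain ⟨z, hz, hzt⟩ := key f F hf hF hfF
  obtain ⟨y, hy, hyt⟩ := key g G hg hG hgG
  have hin := hyt.inner (𝕜 := ℝ) hzt
  have hmul : ∀ (z y : Lp ℝ 2 P) (f g : Ω → ℝ), z =ᵐ[P] f → y =ᵐ[P] g →
      inner ℝ y z = ∫ ω, f ω * g ω ∂P := by
    intro z y f g hz hy
    rw [L2.inner_def]
    refine integral_congr_ae ?_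
    filter_upwards [hz, hy] with ω h1 h2
    simp [h1, h2]
  rw [← hmul _ _ _ _ hF.coeFn_toLp hG.coeFn_toLp]
  refine hin.congr' ?_
  filter_upwards [hz, hy] with i h1 h2 using hmul _ _ _ _ h1 h2

theorem MemLp.abs_integral_mul_le {f g : Ω → ℝ} (hf : MemLp f 2 P) (hg : MemLp g 2 P) :
    (∫ ω, f ω * g ω ∂P) ^ 2 ≤ (∫ ω, f ω * f ω ∂P) * ∫ ω, g ω * g ω ∂P := by
  have hmul : ∀ (f g : Ω → ℝ) (hf : MemLp f 2 P) (hg : MemLp g 2 P),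
      inner ℝ (hf.toLp) (hg.toLp) = ∫ ω, f ω * g ω ∂P := by
    intro f g hf hg
    rw [L2.inner_def]
    refine integral_congr_ae ?_
    filter_upwards [hf.coeFn_toLp, hg.coeFn_toLp] with ω h1 h2
    simp [h1, h2, mul_comm]
  rw [← hmul f g hf hg, ← hmul f f hf hf, ← hmul g g hg hg, sq]
  exact real_inner_mul_inner_self_le _ _

end LTwo

/-! ### Products of parameter integrals as iterated integrals. -/

section Fubini

variable {S Q : Type*} [MeasurableSpace S] [MeasurableSpace Q]
  {L : Measure S} {ν : Measure Q} [IsFiniteMeasure L] [SFinite ν]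

theorem memLp_comp_fst_fst {f : S × Q → ℝ} (hf : MemLp f 2 (L.prod ν)) :
    MemLp (fun x : (S × S) × Q => f (x.1.1, x.2)) 2 ((L.prod L).prod ν) := by
  have hmap : ((L.prod L).prod ν).map (Prod.map Prod.fst id) = L univ • L.prod ν := by
    rw [← Measure.map_prod_map _ _ measurable_fst measurable_id, Measure.map_fst_prod,
      Measure.map_id, Measure.prod_smul_left]
  refine MemLp.comp_of_map (f := Prod.map Prod.fst id) (g := f) ?_
    (measurable_fst.prodMap measurable_id).aemeasurable
  rw [hmap]
  exact hf.smul_measure (measure_ne_top _ _)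

theorem memLp_comp_fst_snd {f : S × Q → ℝ} (hf : MemLp f 2 (L.prod ν)) :
    MemLp (fun x : (S × S) × Q => f (x.1.2, x.2)) 2 ((L.prod L).prod ν) := by
  have hmap : ((L.prod L).prod ν).map (Prod.map Prod.snd id) = L univ • L.prod ν := by
    rw [← Measure.map_prod_map _ _ measurable_snd measurable_id, Measure.map_snd_prod,
      Measure.map_id, Measure.prod_smul_left]
  refine MemLp.comp_of_map (f := Prod.map Prod.snd id) (g := f) ?_
    (measurable_snd.prodMap measurable_id).aemeasurable
  rw [hmap]
  exact hf.smul_measure (measure_ne_top _ _)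

/-- A product of two integrals over the same variable is a double integral with separate variables;
square integrability on `L ⊗ ν` is what justifies the exchange with the integral over `ν`. -/
theorem integral_integral_integral_mul {f g : S × Q → ℝ} {κ : Q → ℝ}
    (hf : MemLp f 2 (L.prod ν)) (hg : MemLp g 2 (L.prod ν)) (hκ : Measurable κ)
    (hκ1 : ∀ q, |κ q| ≤ 1) :
    ∫ s, ∫ s', ∫ q, f (s, q) * g (s', q) * κ q ∂ν ∂L ∂L =
      ∫ q, (∫ s, f (s, q) ∂L) * (∫ s, g (s, q) ∂L) * κ q ∂ν := by
  have hint : Integrable (fun x : (S × S) × Q => f (x.1.1, x.2) * g (x.1.2, x.2) * κ x.2)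
      ((L.prod L).prod ν) := by
    refine Integrable.mul_bdd (c := 1) ?_ (hκ.comp measurable_snd).aestronglyMeasurable
      (Eventually.of_forall fun x => hκ1 _)
    exact (memLp_comp_fst_fst hf).integrable_mul (memLp_comp_fst_snd hg)
  have h1 := hint.integral_prod_left
  rw [← integral_prod (f := fun p : S × S => ∫ q, f (p.1, q) * g (p.2, q) * κ q ∂ν) h1,
    integral_integral_swap (f := fun (p : S × S) q => f (p.1, q) * g (p.2, q) * κ q) hint]
  congr with q
  rw [integral_mul_const, integral_prod_mul (fun s => f (s, q)) (fun s => g (s, q))]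

end Fubini

/-! ### Windows and Lebesgue differentiation -/

section Windows

/-- The projection of `x` on `[0,T]`. -/
def clamp (T x : ℝ) : ℝ := max 0 (min x T)

/-- The indicator function of the interval `]s - dε, s + (1-d)ε]`, cut at `0` and `T`. -/
def win (T d ε s r : ℝ) : ℝ :=
  (Ioc (clamp T (s - d * ε)) (clamp T (s + (1 - d) * ε))).indicator (fun _ => 1) r

/-- The mean of `g` over `[r - (1-d)ε, r + dε]`. -/
def slideMean (d : ℝ) (g : ℝ → ℝ) (r ε : ℝ) : ℝ :=
  ε⁻¹ * ∫ s in (r - (1 - d) * ε)..(r + d * ε), g s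

/-- The regularization `ε⁻¹ ∫₀ᵗ g(s) 1_{]s - dε, s + (1-d)ε]} ds` of `g 1_{[0,t]}`. -/
def smear (T d t : ℝ) (g : ℝ → ℝ) (r ε : ℝ) : ℝ := ε⁻¹ * ∫ s in Icc 0 t, g s * win T d ε s r

variable {T d t : ℝ}

theorem clamp_mem (hT : 0 ≤ T) (x : ℝ) : clamp T x ∈ Icc 0 T :=
  ⟨le_max_left _ _, max_le hT (min_le_right _ _)⟩

theorem clamp_le_clamp {x y : ℝ} (h : x ≤ y) : clamp T x ≤ clamp T y :=
  max_le_max le_rfl (min_le_min h le_rfl)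

theorem continuous_clamp : Continuous (clamp T) := by unfold clamp; fun_prop

/-- Read as a condition on `s` for fixed `r`, the window becomes `[r - (1-d)ε, r + dε[`, and the cut
at `0` and `T` concerns `r` only. The reflection explains why forward increments of `X` produce
means to the left of `r`. -/
theorem win_eq (ε s r : ℝ) : win T d ε s r =
    if 0 < r ∧ r ≤ T ∧ r - (1 - d) * ε ≤ s ∧ s < r + d * ε then 1 else 0 := by
  unfold win indicator clamp
  congr 1
  simp only [mem_Ioc, max_lt_iff, min_lt_iff, le_max_iff, le_min_iff, eq_iff_iff]
  constructor
  · rintro ⟨⟨h1, h2⟩, h3⟩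
    rcases h3 with h3 | h3
    · exact absurd h1 (not_lt.2 h3)
    · exact ⟨h1, h3.2, by linarith [h3.1], by rcases h2 with h2 | h2 <;> linarith [h3.2]⟩
  · rintro ⟨h1, h2, h3, h4⟩
    exact ⟨⟨h1, Or.inl (by linarith)⟩, Or.inr ⟨by linarith, h2⟩⟩

theorem measurable_win (ε : ℝ) : Measurable (fun p : ℝ × ℝ => win T d ε p.1 p.2) := by
  simp_rw [win_eq]
  refine Measurable.ite ?_ measurable_const measurable_const
  refine (measurableSet_lt (f := fun _ : ℝ × ℝ => (0 : ℝ)) (by fun_prop) measurable_snd).inter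
    ((measurableSet_le (g := fun _ : ℝ × ℝ => T) measurable_snd (by fun_prop)).inter
    ((measurableSet_le (f := fun p : ℝ × ℝ => p.2 - (1 - d) * ε) (g := Prod.fst) ?_ ?_).inter
    (measurableSet_lt (f := Prod.fst) (g := fun p : ℝ × ℝ => p.2 + d * ε) ?_ ?_))) <;> fun_prop

theorem win_nonneg (ε s r : ℝ) : 0 ≤ win T d ε s r := by
  rw [win_eq]; split_ifs <;> norm_num

theorem win_le_one (ε s r : ℝ) : win T d ε s r ≤ 1 := by
  rw [win_eq]; split_ifs <;> norm_num

theorem abs_win_le_one (ε s r : ℝ) : |win T d ε s r| ≤ 1 := by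
  rw [abs_of_nonneg (win_nonneg _ _ _)]; exact win_le_one _ _ _

theorem window_le (ε r : ℝ) (hε : 0 ≤ ε) : r - (1 - d) * ε ≤ r + d * ε := by nlinarith

theorem smear_eq {g : ℝ → ℝ} {r ε : ℝ} (hε : 0 ≤ ε) (hr : r ∈ Ioc 0 T) :
    smear T d t g r ε = slideMean d ((Icc 0 t).indicator g) r ε := by
  unfold smear slideMean
  congr 1
  rw [intervalIntegral.integral_of_le (window_le ε r hε), ← integral_Ico_eq_integral_Ioc,
    ← integral_indicator measurableSet_Icc, ← integral_indicator measurableSet_Ico]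
  congr with s
  simp only [win_eq]
  by_cases h1 : s ∈ Icc 0 t <;> by_cases h2 : s ∈ Ico (r - (1 - d) * ε) (r + d * ε) <;>
    simp [indicator, h1, h2, hr.1, hr.2] <;> grind

theorem abs_slideMean_le {g : ℝ → ℝ} {M : ℝ} (hg : ∀ s, |g s| ≤ M) {ε : ℝ} (hε : 0 < ε) (r : ℝ) :
    |slideMean d g r ε| ≤ M := by
  have h := intervalIntegral.norm_integral_le_of_norm_le_const
    (a := r - (1 - d) * ε) (b := r + d * ε) (f := g) (C := M) fun s _ => hg s
  rw [Real.norm_eq_abs, show r + d * ε - (r - (1 - d) * ε) = ε by ring, abs_of_pos hε] at h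
  rw [slideMean, abs_mul, abs_inv, abs_of_pos hε, inv_mul_le_iff₀ hε]
  linarith

theorem abs_smear_le {g : ℝ → ℝ} {M : ℝ} (hg : ∀ s, |g s| ≤ M) {ε : ℝ} (hε : 0 < ε) (r : ℝ) :
    |smear T d t g r ε| ≤ M := by
  have hM : 0 ≤ M := (abs_nonneg _).trans (hg 0)
  by_cases hr : r ∈ Ioc 0 T
  · rw [smear_eq hε.le hr]
    refine abs_slideMean_le (fun s => ?_) hε r
    by_cases hs : s ∈ Icc 0 t <;> simp [hs, hg s, hM]
  · have : ∀ s, win T d ε s r = 0 := fun s => by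
      rw [win_eq, if_neg]; rintro ⟨h1, h2, -⟩; exact hr ⟨h1, h2⟩
    simp [smear, this, hM]

/-- Where the primitive of `g` is differentiable, the integral over the sliding window has
derivative `d g(r) + (1-d) g(r) = g(r)` in `ε` at `0`. One computation thus covers all values of
`d`. -/
theorem tendsto_slideMean {g : ℝ → ℝ} (hg : LocallyIntegrable g) :
    ∀ᵐ r, Tendsto (slideMean d g r) (𝓝[>] 0) (𝓝 (g r)) := by
  have hgi (x y : ℝ) : IntervalIntegrable g volume x y :=
    intervalIntegrable_iff.mpr <|
      (hg.integrableOn_isCompact isCompact_uIcc).mono_set uIoc_subset_uIcc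
  filter_upwards [_root_.LocallyIntegrable.ae_hasDerivAt_integral hg] with r hr
  have h0 := hr 0
  have h1 : HasDerivAt (fun ε : ℝ => r + d * ε) d 0 := by
    simpa using ((hasDerivAt_id (0 : ℝ)).const_mul d).const_add r
  have h2 : HasDerivAt (fun ε : ℝ => r - (1 - d) * ε) (-(1 - d)) 0 := by
    simpa using ((hasDerivAt_id (0 : ℝ)).const_mul (1 - d)).const_sub r
  have h3 := (HasDerivAt.comp (0 : ℝ) (by simpa using h0) h1).sub
    (HasDerivAt.comp (0 : ℝ) (by simpa using h0) h2)
  have h4 := (hasDerivAt_iff_tendsto_slope_zero.1 h3).mono_left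
    (nhdsWithin_mono 0 (fun x (hx : 0 < x) => hx.ne'))
  have h5 : g r * d - g r * -(1 - d) = g r := by ring
  rw [h5] at h4
  refine h4.congr fun ε => ?_
  simp only [slideMean, zero_add, Pi.sub_apply, Function.comp_apply, mul_zero, add_zero, sub_zero,
    smul_eq_mul, sub_self]
  rw [intervalIntegral.integral_interval_sub_left (hgi _ _) (hgi _ _)]

theorem locallyIntegrable_of_abs_le {g : ℝ → ℝ} (hm : Measurable g) {M : ℝ} (hg : ∀ s, |g s| ≤ M) :
    LocallyIntegrable g := by
  refine (locallyIntegrable_const M).mono hm.aestronglyMeasurable (Eventually.of_forall fun s => ?_)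
  exact (hg s).trans (le_abs_self M)

theorem tendsto_smear {g : ℝ → ℝ} (hm : Measurable g) {M : ℝ} (hg : ∀ s, |g s| ≤ M) :
    ∀ᵐ r ∂leb T, Tendsto (smear T d t g r) (𝓝[>] 0) (𝓝 ((Icc 0 t).indicator g r)) := by
  have hM : 0 ≤ M := (abs_nonneg _).trans (hg 0)
  have h1 : ∀ s, |(Icc 0 t).indicator g s| ≤ M := fun s => by
    by_cases hs : s ∈ Icc 0 t <;> simp [hs, hg s, hM]
  have h2 := tendsto_slideMean (d := d)
    (locallyIntegrable_of_abs_le (hm.indicator (measurableSet_Icc (a := 0) (b := t))) h1)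
  have h3 : ∀ᵐ r : ℝ, r ≠ 0 := by simp [ae_iff, measure_singleton]
  rw [ae_restrict_iff' measurableSet_Icc]
  filter_upwards [h2, h3] with r hr h0 hmem
  refine hr.congr' ?_
  filter_upwards [self_mem_nhdsWithin] with ε hε
  exact (smear_eq (le_of_lt hε) ⟨lt_of_le_of_ne hmem.1 h0.symm, hmem.2⟩).symm

/-- For `r ≠ t` a short window lies on one side of `t`, so restriction to `[0,t]` commutes with
averaging. No limit is claimed: the lemma also serves at points of the diagonal, where only the
existence of a trace is known. -/
theorem smear_eventuallyEq (hd : d ∈ Icc (0 : ℝ) 1) (g : ℝ → ℝ) {r : ℝ} (hr : r ∈ Ioc 0 T)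
    (hrt : r ≠ t) :
    smear T d t g r =ᶠ[𝓝[>] 0] fun ε => (Icc 0 t).indicator (fun _ => slideMean d g r ε) r := by
  have hsm : ∀ δ > 0, ∀ᶠ ε : ℝ in 𝓝[>] 0, ε < δ := fun δ hδ =>
    mem_of_superset (Ioo_mem_nhdsGT hδ) fun x hx => hx.2
  filter_upwards [self_mem_nhdsWithin, hsm r hr.1, hsm |r - t| (by simpa [sub_eq_zero])]
    with ε (hε : 0 < ε) h1 h2
  rw [smear_eq hε.le hr, slideMean, slideMean]
  have hd1 : d * ε ≤ ε := by nlinarith [hd.2]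
  have hd2 : 0 ≤ d * ε := mul_nonneg hd.1 hε.le
  rcases lt_or_gt_of_ne hrt with hlt | hgt
  · rw [indicator_of_mem (show r ∈ Icc 0 t from ⟨hr.1.le, hlt.le⟩)]
    congr 1
    refine intervalIntegral.integral_congr fun s hs => ?_
    rw [uIcc_of_le (window_le ε r hε.le)] at hs
    rw [abs_of_neg (by linarith)] at h2
    exact indicator_of_mem (show s ∈ Icc 0 t from ⟨by nlinarith [hs.1], by linarith [hs.2]⟩) _
  · rw [indicator_of_notMem (show r ∉ Icc 0 t from fun h => by linarith [h.2]),
      intervalIntegral.integral_congr (g := fun _ => (0 : ℝ)), intervalIntegral.integral_zero,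
      mul_zero]
    intro s hs
    rw [uIcc_of_le (window_le ε r hε.le)] at hs
    rw [abs_of_pos (by linarith)] at h2
    exact indicator_of_notMem (fun h => by nlinarith [h.2, hs.1]) _

end Windows

end CovMeasure

end

noncomputable section

namespace CovMeasure

/-! ### Gaussian integration by parts. -/

section Stein

/-- Gaussian integration by parts on the line. -/
theorem integral_mul_gaussianReal {v : NNReal} (hv : v ≠ 0) {h h' : ℝ → ℝ}
    (hd : ∀ x, HasDerivAt h (h' x) x) (h1 : Integrable (fun x => h x * x) (gaussianReal 0 v))
    (h2 : Integrable h' (gaussianReal 0 v)) (h3 : Integrable h (gaussianReal 0 v)) :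
    ∫ x, h x * x ∂gaussianReal 0 v = v * ∫ x, h' x ∂gaussianReal 0 v := by
  have hv' : (v : ℝ) ≠ 0 := by simpa using hv
  have key : ∀ g : ℝ → ℝ, Integrable g (gaussianReal 0 v) →
      Integrable fun x => g x * gaussianPDFReal 0 v x := by
    intro g hg
    rw [gaussianReal_of_var_ne_zero _ hv, integrable_withDensity_iff_integrable_smul'
      (measurable_gaussianPDF _ _) (Eventually.of_forall fun _ => gaussianPDF_lt_top)] at hg
    simpa [toReal_gaussianPDF, mul_comm] using hg
  -- The identity `p' = -(x/v) p` for the centered Gaussian density is the whole content; the rest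
  -- is integration by parts on the line.
  have hp : ∀ x, HasDerivAt (gaussianPDFReal 0 v) (-(x / v) * gaussianPDFReal 0 v x) x := by
    intro x
    have e1 : HasDerivAt (fun x : ℝ => -(x - 0) ^ 2 / (2 * v)) (-(x / v)) x := by
      have := (((hasDerivAt_id x).sub_const 0).pow 2).neg.div_const (2 * (v : ℝ))
      refine this.congr_deriv ?_
      field_simp; simp
    have := (e1.exp).const_mul ((√(2 * Real.pi * v))⁻¹)
    simp only [gaussianPDFReal_def]
    refine this.congr_deriv ?_
    ring
  have ibp := integral_mul_deriv_eq_deriv_mul_of_integrable (fun x _ => hd x) (fun x _ => hp x)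
    (((key _ h1).neg.mul_const ((v : ℝ)⁻¹)).congr (Eventually.of_forall fun x => by
      simp only [Pi.neg_apply, Pi.mul_apply]; ring)) (key _ h2) (key _ h3)
  rw [integral_gaussianReal_eq_integral_smul hv, integral_gaussianReal_eq_integral_smul hv]
  have e2 : ∫ x, h x * (-(x / v) * gaussianPDFReal 0 v x)
      = -(v : ℝ)⁻¹ * ∫ x, gaussianPDFReal 0 v x • (h x * x) := by
    rw [← integral_const_mul]
    congr with x
    simp only [smul_eq_mul]; ring
  rw [e2] at ibp
  have e3 : ∫ x, gaussianPDFReal 0 v x • h' x = ∫ x, h' x * gaussianPDFReal 0 v x := by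
    congr with x; simp only [smul_eq_mul]; ring
  rw [e3]
  field_simp at ibp
  linarith

variable {Ω E : Type*} [MeasurableSpace Ω] {P : Measure Ω} [NormedAddCommGroup E] [NormedSpace ℝ E]
  [CompleteSpace E] [SecondCountableTopology E] [MeasurableSpace E] [BorelSpace E]

/-- Gaussian integration by parts for a centered Gaussian vector. -/
theorem integral_comp_mul_of_hasGaussianLaw {V : Ω → E} {G : Ω → ℝ}
    (hVG : HasGaussianLaw (fun ω => (V ω, G ω)) P)
    (hG0 : ∫ ω, G ω ∂P = 0)
    {c : E} (hc : ∀ L : StrongDual ℝ E, ∫ ω, L (V ω) * G ω ∂P = L c)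
    {f : E → ℝ} {f' : E → StrongDual ℝ E} (hf : ∀ x, HasFDerivAt f (f' x) x)
    (h1 : Integrable (fun ω => f (V ω) * G ω) P) (h2 : Integrable (fun ω => f' (V ω) c) P)
    (h3 : Integrable (fun ω => f (V ω)) P) :
    ∫ ω, f (V ω) * G ω ∂P = ∫ ω, f' (V ω) c ∂P := by
  have hP := hVG.isProbabilityMeasure
  have hGL := hVG.snd
  have hG2 : MemLp G 2 P := hGL.memLp_two
  have hlaw := hGL.map_eq_gaussianReal
  rw [hG0, variance_of_integral_eq_zero hGL.aemeasurable hG0] at hlaw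
  obtain ⟨v, hv⟩ : ∃ v : NNReal, v = (∫ ω, G ω ^ 2 ∂P).toNNReal := ⟨_, rfl⟩
  change _ = gaussianReal 0 (∫ ω, G ω ^ 2 ∂P).toNNReal at hlaw
  rw [← hv] at hlaw
  have hvv : (v : ℝ) = ∫ ω, G ω ^ 2 ∂P := by
    rw [hv]; exact Real.coe_toNNReal _ (integral_nonneg fun ω => sq_nonneg _)
  -- If `G` is degenerate it vanishes almost surely; every functional then vanishes at `c`, so `c =
  -- 0` and both sides are `0`.
  by_cases hv0 : v = 0
  · have hGz : G =ᵐ[P] 0 := by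
      rw [hv0] at hvv
      have h0 := (integral_eq_zero_iff_of_nonneg (fun ω => sq_nonneg (G ω)) hG2.integrable_sq).1
        (by simpa using hvv.symm)
      filter_upwards [h0] with ω hω
      simpa using hω
    have hcz : c = 0 := by
      refine SeparatingDual.eq_zero_of_forall_dual_eq_zero (R := ℝ) fun L => ?_
      rw [← hc L]
      refine integral_eq_zero_of_ae ?_
      filter_upwards [hGz] with ω hω
      simp [hω]
    rw [hcz]
    simp only [map_zero, integral_zero]
    refine integral_eq_zero_of_ae ?_
    filter_upwards [hGz] with ω hω
    simp [hω]
  have hv' : (v : ℝ) ≠ 0 := by simpa using hv0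
  -- With `b = c / v` the vector `V - G • b` is uncorrelated with `G`, hence independent of it by
  -- joint Gaussianity. For each fixed value of this vector the one-dimensional formula applies in
  -- the direction `b`.
  set b : E := (v : ℝ)⁻¹ • c with hb
  let A : E × ℝ →L[ℝ] E × ℝ :=
    ((ContinuousLinearMap.fst ℝ E ℝ) - (ContinuousLinearMap.snd ℝ E ℝ).smulRight b).prod
      (ContinuousLinearMap.snd ℝ E ℝ)
  have hV'G : HasGaussianLaw (fun ω => (V ω - G ω • b, G ω)) P := by
    simpa [A] using! hVG.map_fun A
  have hind : IndepFun (fun ω => V ω - G ω • b) G P := by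
    refine hV'G.indepFun_of_covariance_strongDual fun L₁ L₂ => ?_
    have e2 : ∀ g : ℝ, L₂ g = g * L₂ 1 := fun g => by
      rw [← smul_eq_mul, ← map_smul]; simp
    have hLV : MemLp (fun ω => L₁ (V ω)) 2 P := (hVG.fst.map_fun L₁).memLp_two
    have hm1 : MemLp (L₁ ∘ fun ω => V ω - G ω • b) 2 P := (hV'G.fst.map L₁).memLp_two
    have hm2 : MemLp (L₂ ∘ G) 2 P := (hGL.map L₂).memLp_two
    have hi : Integrable (fun ω => L₁ (V ω) * G ω) P := hLV.integrable_mul hG2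
    rw [covariance_eq_sub hm1 hm2]
    have z2 : ∫ ω, (L₂ ∘ G) ω ∂P = 0 := by
      have : ∀ ω, (L₂ ∘ G) ω = G ω * L₂ 1 := fun ω => e2 _
      simp_rw [this]
      rw [integral_mul_const, hG0, zero_mul]
    rw [z2, mul_zero, sub_zero]
    have e3 : ∀ ω, ((L₁ ∘ fun ω => V ω - G ω • b) * (L₂ ∘ G)) ω
        = (L₁ (V ω) * G ω - (v : ℝ)⁻¹ * L₁ c * G ω ^ 2) * L₂ 1 := by
      intro ω
      simp only [Pi.mul_apply, Function.comp_apply, map_sub, map_smul, smul_eq_mul, hb]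
      rw [e2 (G ω)]
      ring
    rw [integral_congr_ae (Eventually.of_forall e3), integral_mul_const,
      integral_sub hi (hG2.integrable_sq.const_mul _), integral_const_mul, hc, ← hvv]
    field_simp
    simp
  rw [indepFun_iff_map_prod_eq_prod_map_map hV'G.fst.aemeasurable hGL.aemeasurable, hlaw] at hind
  have hVe : ∀ ω, (V ω - G ω • b) + G ω • b = V ω := fun ω => by simp
  have hcont : Continuous f := continuous_iff_continuousAt.2 fun x => (hf x).continuousAt
  have hmf' : Measurable fun x => f' x c := by
    have : (fun x => f' x c) = fun x => fderiv ℝ f x c := by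
      ext x; rw [(hf x).fderiv]
    rw [this]
    exact measurable_fderiv_apply_const ℝ f c
  have hmadd : Measurable fun q : E × ℝ => q.1 + q.2 • b := by fun_prop
  have hae := hV'G.aemeasurable
  -- transfer to the product law
  have tr : ∀ g : E × ℝ → ℝ, Measurable g →
      (Integrable (fun ω => g (V ω - G ω • b, G ω)) P ↔
        Integrable g ((P.map fun ω => V ω - G ω • b).prod (gaussianReal 0 v))) ∧
      ∫ ω, g (V ω - G ω • b, G ω) ∂P =
        ∫ q, g q ∂((P.map fun ω => V ω - G ω • b).prod (gaussianReal 0 v)) := by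
    intro g hg
    rw [← hind]
    exact ⟨(integrable_map_measure hg.aestronglyMeasurable hae).symm,
      (integral_map hae hg.aestronglyMeasurable).symm⟩
  have m1 : Measurable fun q : E × ℝ => f (q.1 + q.2 • b) * q.2 :=
    (hcont.measurable.comp hmadd).mul measurable_snd
  have m2 : Measurable fun q : E × ℝ => f' (q.1 + q.2 • b) c := hmf'.comp hmadd
  have m3 : Measurable fun q : E × ℝ => f (q.1 + q.2 • b) := hcont.measurable.comp hmadd
  have t1 := tr _ m1
  have t2 := tr _ m2
  have t3 := tr _ m3
  simp only [hVe] at t1 t2 t3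
  have i1 := t1.1.1 h1
  have i2 := t2.1.1 h2
  have i3 := t3.1.1 h3
  have : IsProbabilityMeasure (P.map fun ω => V ω - G ω • b) :=
    Measure.isProbabilityMeasure_map hV'G.fst.aemeasurable
  rw [t1.2, t2.2, integral_prod _ i1, integral_prod _ i2]
  refine integral_congr_ae ?_
  filter_upwards [i1.prod_right_ae, i2.prod_right_ae, i3.prod_right_ae] with x j1 j2 j3
  have hder : ∀ g : ℝ, HasDerivAt (fun g => f (x + g • b)) (f' (x + g • b) b) g := by
    intro g
    have e : HasDerivAt (fun g : ℝ => x + g • b) b g := by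
      simpa using ((hasDerivAt_id g).smul_const b).const_add x
    exact (hf _).comp_hasDerivAt g e
  -- The factor `v⁻¹` in `b` cancels the variance produced by the one-dimensional formula.
  have hbc : ∀ y, f' y b = (v : ℝ)⁻¹ * f' y c := fun y => by rw [hb, map_smul, smul_eq_mul]
  have j2' : Integrable (fun g : ℝ => f' (x + g • b) b) (gaussianReal 0 v) := by
    simp only [hbc]; exact j2.const_mul _
  rw [integral_mul_gaussianReal hv0 hder j1 j2' j3]
  simp only [hbc]
  rw [integral_const_mul, mul_inv_cancel_left₀ hv']

end Stein

end CovMeasure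

end

/-! ### The Gaussian space of the integrator. -/

noncomputable section

namespace CovMeasure

/-- The standing assumptions on the integrator and its covariance measure. -/
structure Setting {Ω : Type*} [MeasurableSpace Ω] (X : ℝ → Ω → ℝ) (P : Measure Ω) (T : ℝ)
    (μ : SignedMeasure (ℝ × ℝ)) (E' : ℝ → ℝ) (r : ℝ × ℝ → ℝ) : Prop where
  pos : 0 < T
  meas : ∀ t ∈ Icc 0 T, Measurable (X t)
  cont : ∀ ω, ContinuousOn (fun t => X t ω) (Icc 0 T)
  gauss : IsGaussianProcess (fun t : Icc (0 : ℝ) T => X t) P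
  mean : ∀ t ∈ Icc 0 T, ∫ ω, X t ω ∂P = 0
  cov : IsCovarianceMeasure X P T μ
  add_mem : ∀ φ ψ : ℝ → ℝ, MemL μ φ → MemL μ ψ → MemL μ (φ + ψ)
  glue : HasGlueDensity T E' r μ

/-- The linear span of the variables `X_t`, `t ∈ [0,T]`. -/
def linSpan {Ω : Type*} (X : ℝ → Ω → ℝ) (T : ℝ) : Submodule ℝ (Ω → ℝ) :=
  Submodule.span ℝ (range fun t : Icc (0 : ℝ) T => X t)

/-- The square integrable variables which are `L²`-limits of linear combinations of the `X_t`. -/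
def gaussSpace {Ω : Type*} [MeasurableSpace Ω] (X : ℝ → Ω → ℝ) (P : Measure Ω) (T : ℝ) :
    Submodule ℝ (Ω → ℝ) where
  carrier := {U | MemLp U 2 P ∧ ∃ V : ℕ → Ω → ℝ, (∀ k, V k ∈ linSpan X T ∧ MemLp (V k) 2 P) ∧
    Tendsto (fun k => eLpNorm (fun ω => V k ω - U ω) 2 P) atTop (𝓝 0)}
  add_mem' := by
    rintro U U' ⟨hU, V, hV, h⟩ ⟨hU', V', hV', h'⟩
    refine ⟨hU.add hU', fun k => V k + V' k, fun k => ⟨add_mem (hV k).1 (hV' k).1,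
      (hV k).2.add (hV' k).2⟩, ?_⟩
    have h0 := h.add h'
    rw [add_zero] at h0
    refine tendsto_of_tendsto_of_tendsto_of_le_of_le tendsto_const_nhds h0 (fun _ => zero_le) fun k => ?_
    have e : (fun ω => (V k + V' k) ω - (U + U') ω)
        = (fun ω => V k ω - U ω) + fun ω => V' k ω - U' ω := by
      ext ω; simp only [Pi.add_apply]; ring
    simp only [e]
    exact eLpNorm_add_le ((hV k).2.sub hU).1 ((hV' k).2.sub hU').1 (by norm_num)
  zero_mem' := ⟨MemLp.zero, fun _ => 0, fun _ => ⟨zero_mem _, MemLp.zero⟩, by simp⟩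
  smul_mem' := by
    rintro c U ⟨hU, V, hV, h⟩
    refine ⟨hU.const_smul c, fun k => c • V k, fun k => ⟨Submodule.smul_mem _ _ (hV k).1,
      (hV k).2.const_smul c⟩, ?_⟩
    have h0 := ENNReal.Tendsto.const_mul (a := ‖c‖ₑ) h (Or.inr enorm_ne_top)
    rw [mul_zero] at h0
    refine h0.congr fun k => ?_
    rw [← eLpNorm_const_smul]
    congr 1
    ext ω; simp only [Pi.smul_apply, smul_eq_mul]; ring

/-- The indicator function of `]a,b]`. -/
abbrev ind (a b : ℝ) : ℝ → ℝ := (Ioc a b).indicator fun _ => 1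

namespace Setting

variable {Ω : Type*} [MeasurableSpace Ω] {X : ℝ → Ω → ℝ} {P : Measure Ω} {T : ℝ}
  {μ : SignedMeasure (ℝ × ℝ)} {E' : ℝ → ℝ} {r : ℝ × ℝ → ℝ}

theorem memLp_two (h : Setting X P T μ E' r) {t : ℝ} (ht : t ∈ Icc 0 T) : MemLp (X t) 2 P :=
  (h.gauss.hasGaussianLaw_eval ⟨t, ht⟩).memLp_two

theorem linSpan_spec (h : Setting X P T μ E' r) {U : Ω → ℝ} (hU : U ∈ linSpan X T) :
    HasGaussianLaw U P ∧ ∫ ω, U ω ∂P = 0 := by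
  rw [linSpan, Finsupp.mem_span_range_iff_exists_finsupp] at hU
  obtain ⟨c, rfl⟩ := hU
  have e : (c.sum fun t a => a • X t) = fun ω => ∑ t ∈ c.support, c t • X t ω := by
    ext ω; simp [Finsupp.sum]
  rw [e]
  refine ⟨(h.gauss.smul c).hasGaussianLaw_fun_sum, ?_⟩
  rw [integral_finsetSum]
  · refine Finset.sum_eq_zero fun t _ => ?_
    rw [integral_smul, h.mean t t.2, smul_zero]
  · intro t _
    exact (h.gauss.hasGaussianLaw_eval t).integrable.const_mul (c t)

theorem mem_gaussSpace (h : Setting X P T μ E' r) {t : ℝ} (ht : t ∈ Icc 0 T) :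
    X t ∈ gaussSpace X P T :=
  ⟨h.memLp_two ht, fun _ => X t, fun _ => ⟨Submodule.subset_span ⟨⟨t, ht⟩, rfl⟩, h.memLp_two ht⟩,
    by simp⟩

/-- Means and second moments pass to the `L²` limit. Along an almost surely convergent subsequence
the characteristic functions converge too, so the limit law has the characteristic function of a
centered Gaussian variable. -/
theorem gaussSpace_spec [IsProbabilityMeasure P] (h : Setting X P T μ E' r) {U : Ω → ℝ}
    (hU : U ∈ gaussSpace X P T) : HasGaussianLaw U P ∧ ∫ ω, U ω ∂P = 0 := by
  obtain ⟨hU, V, hV, hlim⟩ := hU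
  have hV2 := fun k => (hV k).2
  have hmean : Tendsto (fun k => ∫ ω, V k ω * 1 ∂P) atTop (𝓝 (∫ ω, U ω * 1 ∂P)) :=
    tendsto_integral_mul_of_tendsto_eLpNorm (Eventually.of_forall hV2)
      (Eventually.of_forall fun _ => memLp_const 1) hU (memLp_const 1) hlim (by simp)
  have hvar := tendsto_integral_mul_of_tendsto_eLpNorm (Eventually.of_forall hV2)
    (Eventually.of_forall hV2) hU hU hlim hlim
  simp only [mul_one, (h.linSpan_spec (hV _).1).2] at hmean
  have hU0 : ∫ ω, U ω ∂P = 0 := (tendsto_nhds_unique hmean tendsto_const_nhds)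
  refine ⟨⟨?_⟩, hU0⟩
  obtain ⟨ns, hns, hae⟩ := (tendstoInMeasure_of_tendsto_eLpNorm (by norm_num)
    (fun k => (hV2 k).1) hU.1 hlim).exists_seq_tendsto_ae'
  set v : NNReal := (∫ ω, U ω * U ω ∂P).toNNReal with hv
  have hcf : ∀ t : ℝ, ∀ W : Ω → ℝ, AEStronglyMeasurable W P →
      charFun (P.map W) t = ∫ ω, Complex.exp (t * W ω * Complex.I) ∂P := by
    intro t W hW
    rw [charFun_apply_real, integral_map hW.aemeasurable]
    exact Continuous.aestronglyMeasurable (by fun_prop)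
  have : P.map U = gaussianReal 0 v := by
    have := Measure.isProbabilityMeasure_map hU.1.aemeasurable
    refine Measure.ext_of_charFun ?_
    ext t
    rw [charFun_gaussianReal]
    have l1 : Tendsto (fun k => charFun (P.map (V (ns k))) t) atTop (𝓝 (charFun (P.map U) t)) := by
      simp only [hcf t _ (hV2 _).1, hcf t _ hU.1]
      refine tendsto_integral_of_dominated_convergence (fun _ => 1) (fun k => ?_)
        (integrable_const 1) (fun k => Eventually.of_forall fun ω => ?_) ?_
      · have := (hV2 (ns k)).1
        fun_prop
      · rw [show (t : ℂ) * V (ns k) ω * Complex.I = ((t * V (ns k) ω : ℝ) : ℂ) * Complex.I by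
          push_cast; ring, Complex.norm_exp_ofReal_mul_I]
      · filter_upwards [hae] with ω hω
        have hc : Continuous fun x : ℝ => Complex.exp (t * x * Complex.I) := by fun_prop
        exact (hc.tendsto _).comp hω
    refine tendsto_nhds_unique l1 ?_
    have l2 : ∀ k, charFun (P.map (V k)) t
        = Complex.exp (t * (0 : ℝ) * Complex.I
          - ((∫ ω, V k ω * V k ω ∂P : ℝ) : ℂ) * t ^ 2 / 2) := by
      intro k
      obtain ⟨g1, g2⟩ := h.linSpan_spec (hV k).1
      have e : Var[V k; P] = ∫ ω, V k ω * V k ω ∂P := by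
        rw [variance_of_integral_eq_zero g1.aemeasurable g2]
        exact integral_congr_ae (Eventually.of_forall fun ω => by simp [sq])
      rw [g1.map_eq_gaussianReal, charFun_gaussianReal, g2, e,
        Real.coe_toNNReal _ (integral_nonneg fun ω => mul_self_nonneg _)]
    simp only [l2]
    have hvv : (v : ℝ) = ∫ ω, U ω * U ω ∂P :=
      Real.coe_toNNReal _ (integral_nonneg fun ω => mul_self_nonneg _)
    rw [hvv]
    have hc : Continuous fun x : ℝ => Complex.exp (t * (0 : ℝ) * Complex.I - (x : ℂ) * t ^ 2 / 2) := by
      fun_prop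
    exact (hc.tendsto _).comp (hvar.comp hns)
  rw [this]; infer_instance

/-- The rectangle formula for `μ` is read as an isometry between increments of `X` and indicator
functions of intervals. This is the link between the process and the form `⟨·,·⟩_H`. -/
theorem integral_mul_incr [IsProbabilityMeasure P] (h : Setting X P T μ E' r) {a b c d : ℝ}
    (ha : 0 ≤ a) (hab : a ≤ b) (hb : b ≤ T) (hc : 0 ≤ c) (hcd : c ≤ d) (hd : d ≤ T) :
    ∫ ω, (X b ω - X a ω) * (X d ω - X c ω) ∂P = hInner μ (ind a b) (ind c d) := by
  have ma : a ∈ Icc 0 T := ⟨ha, hab.trans hb⟩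
  have mb : b ∈ Icc 0 T := ⟨ha.trans hab, hb⟩
  have mc : c ∈ Icc 0 T := ⟨hc, hcd.trans hd⟩
  have md : d ∈ Icc 0 T := ⟨hc.trans hcd, hd⟩
  have e : (fun p : ℝ × ℝ => ind a b p.1 * ind c d p.2)
      = (Ioc a b ×ˢ Ioc c d).indicator fun _ => (1 : ℝ) := by
    ext p
    by_cases h1 : p.1 ∈ Ioc a b <;> by_cases h2 : p.2 ∈ Ioc c d <;> simp [ind, indicator, h1, h2]
  have cv : ∀ s t, s ∈ Icc 0 T → t ∈ Icc 0 T → cov[X s, X t; P] = ∫ ω, X s ω * X t ω ∂P := by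
    intro s t hs ht
    rw [covariance_eq_sub (h.memLp_two hs) (h.memLp_two ht), h.mean s hs]
    simp
  have it : ∀ s t, s ∈ Icc 0 T → t ∈ Icc 0 T → Integrable (fun ω => X s ω * X t ω) P :=
    fun s t hs ht => (h.memLp_two hs).integrable_mul (h.memLp_two ht)
  rw [hInner, e, VectorMeasure.integral_indicator_const _
    (measurableSet_Ioc.prod measurableSet_Ioc), h.cov.rect a b c d ha hab hb hc hcd hd,
    cv _ _ mb md, cv _ _ ma mc, cv _ _ ma md, cv _ _ mb mc]
  simp only [ContinuousLinearMap.lsmul_apply, smul_eq_mul, one_mul]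
  rw [← integral_add (it _ _ mb md) (it _ _ ma mc), ← integral_sub _ (it _ _ ma md),
    ← integral_sub _ (it _ _ mb mc)]
  · congr with ω; ring
  · exact ((it _ _ mb md).add (it _ _ ma mc)).sub (it _ _ ma md)
  · exact (it _ _ mb md).add (it _ _ ma mc)

end Setting

end CovMeasure

end

/-! ### Second moments of parameter integrals, and Cauchy-Schwarz for the bilinear form. -/

noncomputable section

namespace CovMeasure

theorem memLp_two_prod_of_integral_sq_le {S Q : Type*} [MeasurableSpace S] [MeasurableSpace Q]
    {L : Measure S} {ν : Measure Q} [IsFiniteMeasure L] [SFinite ν] {f : S × Q → ℝ}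
    (hf : AEStronglyMeasurable f (L.prod ν)) {C : ℝ}
    (h : ∀ᵐ s ∂L, MemLp (fun q => f (s, q)) 2 ν ∧ ∫ q, f (s, q) * f (s, q) ∂ν ≤ C) :
    MemLp f 2 (L.prod ν) := by
  have hf2 : AEStronglyMeasurable (fun x => f x ^ 2) (L.prod ν) := hf.pow 2
  rw [memLp_two_iff_integrable_sq hf, integrable_prod_iff hf2]
  refine ⟨h.mono fun s hs => hs.1.integrable_sq, ?_⟩
  refine (integrable_const C).mono' hf2.norm.integral_prod_right' ?_
  filter_upwards [h] with s hs
  rw [Real.norm_of_nonneg (integral_nonneg fun _ => norm_nonneg _)]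
  refine le_trans (le_of_eq ?_) hs.2
  congr with q
  simp [sq]

theorem memLp_integral_fst {S Q : Type*} [MeasurableSpace S] [MeasurableSpace Q]
    {L : Measure S} {ν : Measure Q} [IsFiniteMeasure L] [SFinite ν] {f : S × Q → ℝ}
    (hf : MemLp f 2 (L.prod ν)) : MemLp (fun q => ∫ s, f (s, q) ∂L) 2 ν := by
  have hm : AEStronglyMeasurable (fun q => ∫ s, f (s, q) ∂L) ν :=
    hf.1.prod_swap.integral_prod_right'
  have hi : Integrable (fun q => L.real univ * ∫ s, f (s, q) * f (s, q) ∂L) ν :=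
    (hf.integrable_mul hf).integral_prod_right.const_mul _
  refine (memLp_two_iff_integrable_sq hm).2 (hi.mono' (hm.pow 2) ?_)
  have h1 : ∀ᵐ q ∂ν, AEStronglyMeasurable (fun s => f (s, q)) L := hf.1.prod_swap.prodMk_left
  filter_upwards [h1, (integrable_prod_iff' (hf.integrable_sq.1)).1 hf.integrable_sq |>.1]
    with q h2 h3
  have := MemLp.abs_integral_mul_le ((memLp_two_iff_integrable_sq h2).2 h3)
    (memLp_const (1 : ℝ) (μ := L) (p := 2))
  rw [Real.norm_of_nonneg (sq_nonneg _), mul_comm]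
  simpa using this

variable {Ω : Type*} [MeasurableSpace Ω] {X : ℝ → Ω → ℝ} {P : Measure Ω} {T : ℝ}
  {μ : SignedMeasure (ℝ × ℝ)} {E' : ℝ → ℝ} {r : ℝ × ℝ → ℝ}

/-! ### The space `L_μ` and its bilinear form -/

theorem memL_of_abs_le {φ : ℝ → ℝ} (hm : Measurable φ) {M : ℝ} (hφ : ∀ s, |φ s| ≤ M) :
    MemL μ φ := by
  refine ⟨hm, lt_of_le_of_lt (lintegral_mono (g := fun _ => ENNReal.ofReal M * ENNReal.ofReal M)
    fun p => ?_) ?_⟩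
  · have : ∀ s, ‖φ s‖ₑ ≤ ENNReal.ofReal M := fun s => by
      rw [← ofReal_norm]; exact ENNReal.ofReal_le_ofReal (hφ s)
    exact mul_le_mul' (this _) (this _)
  · rw [lintegral_const]
    exact ENNReal.mul_lt_top (ENNReal.mul_lt_top ENNReal.ofReal_lt_top ENNReal.ofReal_lt_top)
      (measure_lt_top _ _)

theorem memL_ind (a b : ℝ) : MemL μ (ind a b) :=
  memL_of_abs_le (M := 1) (measurable_const.indicator measurableSet_Ioc) fun s => by
    by_cases h : s ∈ Ioc a b <;> simp [ind, h]

theorem MemL.congr_abs {φ ψ : ℝ → ℝ} (h : MemL μ φ) (hm : Measurable ψ)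
    (hle : ∀ s, |ψ s| = |φ s|) : MemL μ ψ := by
  refine ⟨hm, lt_of_le_of_lt (le_of_eq ?_) h.2⟩
  have : ∀ s, ‖ψ s‖ₑ = ‖φ s‖ₑ := fun s => by rw [← ofReal_norm, ← ofReal_norm]; exact congrArg _ (hle s)
  simp only [absNormSq, this]

theorem MemL.abs {φ : ℝ → ℝ} (h : MemL μ φ) : MemL μ fun s => |φ s| :=
  h.congr_abs h.1.abs fun _ => abs_abs _

theorem MemL.const_mul {φ : ℝ → ℝ} (h : MemL μ φ) (c : ℝ) : MemL μ fun s => c * φ s := by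
  refine ⟨h.1.const_mul c, ?_⟩
  have : absNormSq μ (fun s => c * φ s) = ‖c‖ₑ * ‖c‖ₑ * absNormSq μ φ := by
    rw [absNormSq, absNormSq, ← lintegral_const_mul' _ _ (ENNReal.mul_ne_top enorm_ne_top enorm_ne_top)]
    congr with p
    rw [enorm_mul, enorm_mul]; ring
  rw [this]
  exact ENNReal.mul_lt_top (ENNReal.mul_lt_top enorm_lt_top enorm_lt_top) h.2

theorem MemL.neg {φ : ℝ → ℝ} (h : MemL μ φ) : MemL μ fun s => -φ s :=
  h.congr_abs h.1.neg fun _ => abs_neg _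

namespace Setting

theorem memL_add (h : Setting X P T μ E' r) {φ ψ : ℝ → ℝ} (hφ : MemL μ φ) (hψ : MemL μ ψ) :
    MemL μ fun s => φ s + ψ s := h.add_mem φ ψ hφ hψ

theorem memL_sub (h : Setting X P T μ E' r) {φ ψ : ℝ → ℝ} (hφ : MemL μ φ) (hψ : MemL μ ψ) :
    MemL μ fun s => φ s - ψ s := by
  simpa only [sub_eq_add_neg] using h.memL_add hφ hψ.neg

theorem memL_sum (h : Setting X P T μ E' r) {ι : Type*} (S : Finset ι) {φ : ι → ℝ → ℝ}
    (hφ : ∀ i ∈ S, MemL μ (φ i)) : MemL μ fun s => ∑ i ∈ S, φ i s := by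
  classical
  induction S using Finset.induction_on with
  | empty => simpa using memL_of_abs_le (μ := μ) (φ := fun _ => 0) measurable_const (M := 0) (by simp)
  | insert a S ha ih =>
    simp only [Finset.sum_insert ha]
    exact h.memL_add (hφ _ (Finset.mem_insert_self _ _))
      (ih fun i hi => hφ i (Finset.mem_insert_of_mem hi))

/-- Mixed products are controlled by the vector space assumption: `|φ(u)||ψ(v)|` is at most the
product of the values of `|φ| + |ψ|` at `u` and at `v`, and this sum lies in `L_μ`. -/
theorem integrable_mul (h : Setting X P T μ E' r) {φ ψ : ℝ → ℝ} (hφ : MemL μ φ) (hψ : MemL μ ψ) :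
    Integrable (fun p : ℝ × ℝ => φ p.1 * ψ p.2) μ.variation := by
  refine ⟨((hφ.1.comp measurable_fst).mul (hψ.1.comp measurable_snd)).aestronglyMeasurable, ?_⟩
  refine lt_of_le_of_lt (lintegral_mono fun p => ?_) (h.memL_add hφ.abs hψ.abs).2
  rw [enorm_mul]
  refine mul_le_mul' ?_ ?_
  · rw [← ofReal_norm, ← ofReal_norm]
    refine ENNReal.ofReal_le_ofReal ?_
    rw [Real.norm_eq_abs, Real.norm_of_nonneg (by positivity)]
    linarith [abs_nonneg (ψ p.1)]
  · rw [← ofReal_norm, ← ofReal_norm]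
    refine ENNReal.ofReal_le_ofReal ?_
    rw [Real.norm_eq_abs, Real.norm_of_nonneg (by positivity)]
    linarith [abs_nonneg (φ p.2)]

theorem hInner_sub_left (h : Setting X P T μ E' r) {φ φ' ψ : ℝ → ℝ} (hφ : MemL μ φ)
    (hφ' : MemL μ φ') (hψ : MemL μ ψ) :
    hInner μ (fun s => φ s - φ' s) ψ = hInner μ φ ψ - hInner μ φ' ψ := by
  rw [hInner, hInner, hInner, ← VectorMeasure.integral_fun_sub (h.integrable_mul hφ hψ)
    (h.integrable_mul hφ' hψ)]
  simp only [sub_mul]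

theorem hInner_sum_left (h : Setting X P T μ E' r) {ι : Type*} (S : Finset ι) (c : ι → ℝ)
    {φ : ι → ℝ → ℝ} {ψ : ℝ → ℝ} (hφ : ∀ i ∈ S, MemL μ (φ i)) (hψ : MemL μ ψ) :
    hInner μ (fun s => ∑ i ∈ S, c i * φ i s) ψ = ∑ i ∈ S, c i * hInner μ (φ i) ψ := by
  obtain ⟨θ, hθm, hθ1, hθ⟩ := h.glue.exists_sign
  simp only [hInner, hθ]
  simp only [← integral_const_mul]
  rw [← integral_finsetSum]
  · simp only [Finset.sum_mul, mul_assoc]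
  · exact fun i hi => ((h.integrable_mul (hφ i hi) hψ).mul_bdd (c := 1) hθm.aestronglyMeasurable
      (Eventually.of_forall fun p => (hθ1 p).le)).const_mul _

/-! ### Increments -/

end Setting

/-- The increment `X_{s + (1-d)ε} - X_{s - dε}` of the prolonged process. -/
def incr (X : ℝ → Ω → ℝ) (T d ε s : ℝ) (ω : Ω) : ℝ :=
  X (clamp T (s + (1 - d) * ε)) ω - X (clamp T (s - d * ε)) ω

namespace Setting

theorem measurable_clamp (h : Setting X P T μ E' r) :
    Measurable fun q : ℝ × Ω => X (clamp T q.1) q.2 :=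
  measurable_uncurry_of_continuous_of_measurable (u := fun s ω => X (clamp T s) ω)
    (fun ω => (h.cont ω).comp_continuous continuous_clamp fun s => clamp_mem h.pos.le s)
    (fun s => h.meas _ (clamp_mem h.pos.le s))

theorem measurable_incr (h : Setting X P T μ E' r) (d ε : ℝ) :
    Measurable fun q : ℝ × Ω => incr X T d ε q.1 q.2 := by
  have h1 := h.measurable_clamp
  exact (h1.comp (f := fun q : ℝ × Ω => (q.1 + (1 - d) * ε, q.2)) (by fun_prop)).sub
    (h1.comp (f := fun q : ℝ × Ω => (q.1 - d * ε, q.2)) (by fun_prop))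

theorem memLp_incr (h : Setting X P T μ E' r) (d ε s : ℝ) : MemLp (incr X T d ε s) 2 P :=
  (h.memLp_two (clamp_mem h.pos.le _)).sub (h.memLp_two (clamp_mem h.pos.le _))

theorem integral_incr_mul [IsProbabilityMeasure P] (h : Setting X P T μ E' r) {d ε ε' : ℝ}
    (hε : 0 ≤ ε) (hε' : 0 ≤ ε') (s s' : ℝ) :
    ∫ ω, incr X T d ε s ω * incr X T d ε' s' ω ∂P = hInner μ (win T d ε s) (win T d ε' s') :=
  h.integral_mul_incr (clamp_mem h.pos.le _).1 (clamp_le_clamp (by nlinarith))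
    (clamp_mem h.pos.le _).2 (clamp_mem h.pos.le _).1 (clamp_le_clamp (by nlinarith))
    (clamp_mem h.pos.le _).2

theorem measurable_win_right (d ε s : ℝ) : Measurable (win T d ε s) :=
  (measurable_win ε).comp (measurable_const.prodMk measurable_id)

theorem memL_win (d ε s : ℝ) : MemL μ (win T d ε s) :=
  memL_of_abs_le (measurable_win_right d ε s) (abs_win_le_one ε s)

theorem abs_hInner_le {φ ψ : ℝ → ℝ} {A B : ℝ} (hφ : ∀ s, |φ s| ≤ A) (hψ : ∀ s, |ψ s| ≤ B) :
    |hInner μ φ ψ| ≤ A * B * μ.variation.real univ := by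
  have hA : 0 ≤ A := (abs_nonneg _).trans (hφ 0)
  have := VectorMeasure.norm_integral_le_of_norm_le_const (μ := μ)
    (f := fun p : ℝ × ℝ => φ p.1 * ψ p.2) (B := ContinuousLinearMap.lsmul ℝ ℝ) (C := A * B)
    (Eventually.of_forall fun p => by
      rw [norm_mul]; exact mul_le_mul (hφ _) (hψ _) (abs_nonneg _) hA)
  refine this.trans ?_
  have hB : 0 ≤ B := (abs_nonneg _).trans (hψ 0)
  have h1 : ‖ContinuousLinearMap.lsmul ℝ ℝ (E := ℝ)‖ ≤ 1 := ContinuousLinearMap.opNorm_lsmul_le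
  have : A * B * ‖ContinuousLinearMap.lsmul ℝ ℝ (E := ℝ)‖ ≤ A * B * 1 := by gcongr
  nlinarith [measureReal_nonneg (μ := μ.variation) (s := univ)]

theorem memLp_mul_incr [IsProbabilityMeasure P] (h : Setting X P T μ E' r) {d ε : ℝ} (hε : 0 ≤ ε)
    {t : ℝ} {φ : ℝ → ℝ} (hm : Measurable φ) {M : ℝ} (hφ : ∀ s, |φ s| ≤ M) :
    MemLp (fun q : ℝ × Ω => φ q.1 * incr X T d ε q.1 q.2) 2 ((leb t).prod P) := by
  refine memLp_two_prod_of_integral_sq_le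
    ((hm.comp measurable_fst).mul (h.measurable_incr d ε)).aestronglyMeasurable
    (C := M ^ 2 * (1 * 1 * μ.variation.real univ)) (Eventually.of_forall fun s =>
      ⟨(h.memLp_incr d ε s).const_mul (φ s), ?_⟩)
  have e : ∀ ω, φ s * incr X T d ε s ω * (φ s * incr X T d ε s ω)
      = φ s ^ 2 * (incr X T d ε s ω * incr X T d ε s ω) := fun ω => by ring
  simp only [e]
  rw [integral_const_mul]
  have h1 : φ s ^ 2 ≤ M ^ 2 := sq_le_sq' (abs_le.1 (hφ s)).1 (abs_le.1 (hφ s)).2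
  refine mul_le_mul h1 ?_ (integral_nonneg fun ω => mul_self_nonneg _) (sq_nonneg _)
  rw [h.integral_incr_mul hε hε]
  exact (le_abs_self _).trans (abs_hInner_le (abs_win_le_one ε s) (abs_win_le_one ε s))

/-- The integral `ε⁻¹ ∫₀ᵗ φ(s) (X_{s + (1-d)ε} - X_{s - dε}) ds`. -/
def regInt (X : ℝ → Ω → ℝ) (T d t : ℝ) (φ : ℝ → ℝ) (ε : ℝ) (ω : Ω) : ℝ :=
  ε⁻¹ * ∫ s, φ s * incr X T d ε s ω ∂leb t

/-- Fubini on both sides moves the averaging from the increments to the integrands. The form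
`⟨·,·⟩_H` on regularized bounded functions is therefore a covariance, from which its positivity and
the Cauchy-Schwarz inequality are deduced. -/
theorem integral_regInt_mul [IsProbabilityMeasure P] (h : Setting X P T μ E' r) {d ε ε' : ℝ}
    (hε : 0 ≤ ε) (hε' : 0 ≤ ε') {t : ℝ} {φ ψ : ℝ → ℝ} (hm : Measurable φ) {M : ℝ}
    (hφ : ∀ s, |φ s| ≤ M) (hm' : Measurable ψ) {M' : ℝ} (hψ : ∀ s, |ψ s| ≤ M') :
    ∫ ω, regInt X T d t φ ε ω * regInt X T d t ψ ε' ω ∂P =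
      hInner μ (fun s => smear T d t φ s ε) (fun s => smear T d t ψ s ε') := by
  obtain ⟨θ, hθm, hθ1, hθ⟩ := h.glue.exists_sign
  have e1 := integral_integral_integral_mul (h.memLp_mul_incr (d := d) hε (t := t) hm hφ)
    (h.memLp_mul_incr (d := d) hε' (t := t) hm' hψ) (κ := fun _ => 1) measurable_const (by simp)
  have bd : ∀ {φ : ℝ → ℝ} {M : ℝ} (ε : ℝ) (π : ℝ × ℝ → ℝ), Measurable π → Measurable φ →
      (∀ s, |φ s| ≤ M) → MemLp (fun q : ℝ × (ℝ × ℝ) => φ q.1 * win T d ε q.1 (π q.2)) 2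
      ((leb t).prod μ.variation) := by
    intro φ M ε π hπ hm hφ
    have hM : 0 ≤ M := (abs_nonneg _).trans (hφ 0)
    refine MemLp.of_bound ((hm.comp measurable_fst).mul ((measurable_win ε).comp
      (measurable_fst.prodMk (hπ.comp measurable_snd)))).aestronglyMeasurable M
      (Eventually.of_forall fun q => ?_)
    rw [norm_mul]
    calc _ ≤ M * 1 := mul_le_mul (hφ _) (abs_win_le_one _ _ _) (abs_nonneg _) hM
      _ = M := mul_one M
  have e2 := integral_integral_integral_mul (bd (M := M) ε Prod.fst measurable_fst hm hφ)
    (bd (M := M') ε' Prod.snd measurable_snd hm' hψ) hθm (fun p => (hθ1 p).le)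
  have e3 : ∀ s s', ∫ ω, φ s * incr X T d ε s ω * (ψ s' * incr X T d ε' s' ω) * 1 ∂P =
      ∫ p, φ s * win T d ε s p.1 * (ψ s' * win T d ε' s' p.2) * θ p ∂μ.variation := by
    intro s s'
    have a1 : ∀ ω, φ s * incr X T d ε s ω * (ψ s' * incr X T d ε' s' ω) * 1
      = φ s * ψ s' * (incr X T d ε s ω * incr X T d ε' s' ω) := fun ω => by ring
    have a2 : ∀ p : ℝ × ℝ, φ s * win T d ε s p.1 * (ψ s' * win T d ε' s' p.2) * θ p
      = φ s * ψ s' * (win T d ε s p.1 * win T d ε' s' p.2 * θ p) := fun p => by ring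
    simp only [a1, a2]
    rw [integral_const_mul, integral_const_mul, h.integral_incr_mul hε hε', hInner, hθ]
  simp only [e3, e2] at e1
  rw [hInner, hθ]
  have a3 : ∀ p : ℝ × ℝ, smear T d t φ p.1 ε * smear T d t ψ p.2 ε' * θ p
      = ε⁻¹ * ε'⁻¹ * ((∫ s, φ s * win T d ε s p.1 ∂leb t) * (∫ s, ψ s * win T d ε' s p.2 ∂leb t)
        * θ p) := fun p => by simp only [smear]; ring
  have a4 : ∀ ω, regInt X T d t φ ε ω * regInt X T d t ψ ε' ω
      = ε⁻¹ * ε'⁻¹ * ((∫ s, φ s * incr X T d ε s ω ∂leb t) *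
        (∫ s, ψ s * incr X T d ε' s ω ∂leb t) * 1) := fun ω => by simp only [regInt]; ring
  simp only [a3, a4]
  rw [integral_const_mul, integral_const_mul, e1]

theorem memLp_regInt [IsProbabilityMeasure P] (h : Setting X P T μ E' r) {d ε : ℝ} (hε : 0 ≤ ε)
    {t : ℝ} {φ : ℝ → ℝ} (hm : Measurable φ) {M : ℝ} (hφ : ∀ s, |φ s| ≤ M) :
    MemLp (regInt X T d t φ ε) 2 P :=
  (memLp_integral_fst (h.memLp_mul_incr (d := d) hε hm hφ)).const_mul _

theorem measurable_smear {d t : ℝ} {φ : ℝ → ℝ} (hm : Measurable φ) (ε : ℝ) :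
    Measurable fun s => smear T d t φ s ε := by
  refine Measurable.const_mul (StronglyMeasurable.measurable ?_) _
  exact StronglyMeasurable.integral_prod_left' (f := fun q : ℝ × ℝ => φ q.1 * win T d ε q.1 q.2)
    ((hm.comp measurable_fst).mul (measurable_win ε)).stronglyMeasurable

/-- The form `⟨·,·⟩_H` is continuous along the regularizations of bounded functions. -/
theorem tendsto_hInner_smear (h : Setting X P T μ E' r) (d : ℝ) {φ ψ : ℝ → ℝ}
    (hm : Measurable φ) {M : ℝ} (hφ : ∀ s, |φ s| ≤ M) (hm' : Measurable ψ) {M' : ℝ}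
    (hψ : ∀ s, |ψ s| ≤ M') :
    Tendsto (fun ε => hInner μ (fun s => smear T d T φ s ε) (fun s => smear T d T ψ s ε))
      (𝓝[>] 0) (𝓝 (hInner μ φ ψ)) := by
  obtain ⟨θ, hθm, hθ1, hθ⟩ := h.glue.exists_sign
  simp only [hInner, hθ]
  have hM : 0 ≤ M := (abs_nonneg _).trans (hφ 0)
  refine tendsto_integral_filter_of_dominated_convergence (fun _ => M * M')
    (Eventually.of_forall fun ε => ?_) ?_ (integrable_const _) ?_
  · exact (((measurable_smear hm ε).comp measurable_fst).mul
      ((measurable_smear hm' ε).comp measurable_snd)).mul hθm |>.aestronglyMeasurable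
  · filter_upwards [self_mem_nhdsWithin] with ε hε
    refine Eventually.of_forall fun p => ?_
    rw [norm_mul, norm_mul, Real.norm_eq_abs (θ p), hθ1, mul_one]
    exact mul_le_mul (abs_smear_le hφ hε _) (abs_smear_le hψ hε _) (abs_nonneg _) hM
  -- The regularizations converge Lebesgue-almost everywhere in one variable; absolute continuity of
  -- the marginals makes them converge `|μ|`-almost everywhere in the pair.
  · have key : ∀ {φ : ℝ → ℝ}, Measurable φ → ∀ {M : ℝ}, (∀ s, |φ s| ≤ M) →
        ∀ᵐ s ∂leb T, Tendsto (smear T d T φ s) (𝓝[>] 0) (𝓝 (φ s)) := by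
      intro φ hm M hφ
      filter_upwards [tendsto_smear (d := d) (t := T) hm hφ, ae_restrict_mem measurableSet_Icc]
        with s hs h1
      rwa [indicator_of_mem h1] at hs
    filter_upwards [h.glue.qmp_fst.ae (key hm hφ), h.glue.qmp_snd.ae (key hm' hψ)] with p h1 h2
    exact (h1.mul h2).mul_const _

/-- Bounded functions approximating `φ`. -/
def truncate (N : ℕ) (φ : ℝ → ℝ) (s : ℝ) : ℝ := max (-N) (min (φ s) N)

theorem abs_truncate_le (N : ℕ) (φ : ℝ → ℝ) (s : ℝ) : |truncate N φ s| ≤ N := by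
  have : (0 : ℝ) ≤ N := N.cast_nonneg
  exact abs_le.2 ⟨le_max_left _ _, max_le (by linarith) (min_le_right _ _)⟩

theorem abs_truncate_le_abs (N : ℕ) (φ : ℝ → ℝ) (s : ℝ) : |truncate N φ s| ≤ |φ s| := by
  have : (0 : ℝ) ≤ N := N.cast_nonneg
  refine abs_le.2 ⟨le_max_of_le_right (le_min (neg_abs_le _) ?_), max_le ?_ ?_⟩
  · linarith [abs_nonneg (φ s)]
  · linarith [abs_nonneg (φ s)]
  · exact (min_le_left _ _).trans (le_abs_self _)

theorem tendsto_truncate (φ : ℝ → ℝ) (s : ℝ) :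
    Tendsto (fun N => truncate N φ s) atTop (𝓝 (φ s)) := by
  refine tendsto_const_nhds.congr' ?_
  filter_upwards [tendsto_natCast_atTop_atTop.eventually_ge_atTop (|φ s|)] with N hN
  rw [truncate, min_eq_left ((le_abs_self _).trans hN), max_eq_right]
  linarith [neg_abs_le (φ s)]

theorem measurable_truncate {φ : ℝ → ℝ} (hm : Measurable φ) (N : ℕ) : Measurable (truncate N φ) :=
  measurable_const.max (hm.min measurable_const)

theorem tendsto_hInner_truncate (h : Setting X P T μ E' r) {φ ψ : ℝ → ℝ} (hφ : MemL μ φ)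
    (hψ : MemL μ ψ) :
    Tendsto (fun N => hInner μ (truncate N φ) (truncate N ψ)) atTop (𝓝 (hInner μ φ ψ)) := by
  obtain ⟨θ, hθm, hθ1, hθ⟩ := h.glue.exists_sign
  simp only [hInner, hθ]
  have hi := h.integrable_mul hφ.abs hψ.abs
  have hb : ∀ (N : ℕ) (p : ℝ × ℝ),
      ‖truncate N φ p.1 * truncate N ψ p.2 * θ p‖ ≤ |φ p.1| * |ψ p.2| := fun N p => by
    rw [norm_mul, norm_mul, Real.norm_eq_abs (θ p), hθ1, mul_one]
    exact mul_le_mul (abs_truncate_le_abs N φ _) (abs_truncate_le_abs N ψ _) (abs_nonneg _)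
      (abs_nonneg _)
  have hl : ∀ p : ℝ × ℝ, Tendsto (fun N => truncate N φ p.1 * truncate N ψ p.2 * θ p) atTop
      (𝓝 (φ p.1 * ψ p.2 * θ p)) := fun p =>
    ((tendsto_truncate φ p.1).mul (tendsto_truncate ψ p.2)).mul_const _
  refine tendsto_integral_of_dominated_convergence _ (fun N => ?_) hi
    (fun N => Eventually.of_forall (hb N)) (Eventually.of_forall hl)
  have m1 : Measurable fun p : ℝ × ℝ => truncate N φ p.1 :=
    (measurable_truncate hφ.1 N).comp measurable_fst
  have m2 : Measurable fun p : ℝ × ℝ => truncate N ψ p.2 :=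
    (measurable_truncate hψ.1 N).comp measurable_snd
  exact ((m1.mul m2).mul hθm).aestronglyMeasurable

/-- Two approximations reduce the claim to the second moment of a random variable: truncation to
bounded functions, then regularization. Density of step functions in `L_μ` is not needed. -/
theorem hInner_self_nonneg [IsProbabilityMeasure P] (h : Setting X P T μ E' r) {φ : ℝ → ℝ}
    (hφ : MemL μ φ) : 0 ≤ hInner μ φ φ := by
  refine ge_of_tendsto' (h.tendsto_hInner_truncate hφ hφ) fun N => ?_
  refine ge_of_tendsto (h.tendsto_hInner_smear 0 (measurable_truncate hφ.1 N)
    (abs_truncate_le N φ) (measurable_truncate hφ.1 N) (abs_truncate_le N φ)) ?_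
  filter_upwards [self_mem_nhdsWithin] with ε (hε : 0 < ε)
  rw [← h.integral_regInt_mul hε.le hε.le (measurable_truncate hφ.1 N)
    (abs_truncate_le N φ) (measurable_truncate hφ.1 N) (abs_truncate_le N φ)]
  exact integral_nonneg fun ω => mul_self_nonneg _

/-- The Cauchy-Schwarz inequality for `⟨·,·⟩_H`. -/
theorem hInner_sq_le [IsProbabilityMeasure P] (h : Setting X P T μ E' r) {φ ψ : ℝ → ℝ}
    (hφ : MemL μ φ) (hψ : MemL μ ψ) :
    hInner μ φ ψ ^ 2 ≤ hInner μ φ φ * hInner μ ψ ψ := by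
  refine le_of_tendsto_of_tendsto' ((h.tendsto_hInner_truncate hφ hψ).pow 2)
    ((h.tendsto_hInner_truncate hφ hφ).mul (h.tendsto_hInner_truncate hψ hψ)) fun N => ?_
  have mφ := measurable_truncate hφ.1 N
  have mψ := measurable_truncate hψ.1 N
  have bφ := abs_truncate_le N φ
  have bψ := abs_truncate_le N ψ
  refine le_of_tendsto_of_tendsto ((h.tendsto_hInner_smear 0 mφ bφ mψ bψ).pow 2)
    ((h.tendsto_hInner_smear 0 mφ bφ mφ bφ).mul (h.tendsto_hInner_smear 0 mψ bψ mψ bψ)) ?_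
  filter_upwards [self_mem_nhdsWithin] with ε (hε : 0 < ε)
  rw [← h.integral_regInt_mul hε.le hε.le mφ bφ mψ bψ, ← h.integral_regInt_mul hε.le hε.le mφ bφ mφ bφ,
    ← h.integral_regInt_mul hε.le hε.le mψ bψ mψ bψ]
  exact MemLp.abs_integral_mul_le (h.memLp_regInt hε.le mφ bφ) (h.memLp_regInt hε.le mψ bψ)

end Setting

end CovMeasure

end

noncomputable section

namespace CovMeasure

variable {Ω : Type*} [MeasurableSpace Ω] {X : ℝ → Ω → ℝ} {P : Measure Ω} {T : ℝ}
  {μ : SignedMeasure (ℝ × ℝ)} {E' : ℝ → ℝ} {r : ℝ × ℝ → ℝ}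

/-! ### Wiener integrals -/

namespace Setting

theorem memL_fn (h : Setting X P T μ E' r) (φ : Step T) : MemL μ φ.fn :=
  h.memL_sum Finset.univ fun i _ => (memL_ind (φ.a i) (φ.b i)).const_mul (φ.c i)

omit [MeasurableSpace Ω] in
theorem stepIntegral_mem (φ : Step T) : φ.integral X ∈ linSpan X T := by
  have e : φ.integral X = ∑ i, φ.c i • (X (φ.b i) - X (φ.a i)) := by
    ext ω; simp [Step.integral]
  rw [e]
  exact Submodule.sum_mem _ fun i _ => Submodule.smul_mem _ _ (Submodule.sub_mem _
    (Submodule.subset_span ⟨⟨φ.b i, (φ.a_nonneg i).trans (φ.a_le_b i), φ.b_le i⟩, rfl⟩)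
    (Submodule.subset_span ⟨⟨φ.a i, φ.a_nonneg i, (φ.a_le_b i).trans (φ.b_le i)⟩, rfl⟩))

theorem memLp_stepIntegral (h : Setting X P T μ E' r) (φ : Step T) :
    MemLp (φ.integral X) 2 P :=
  (h.linSpan_spec (stepIntegral_mem φ)).1.memLp_two

theorem wiener_mem (h : Setting X P T μ E' r) {φ : ℝ → ℝ} {W : Ω → ℝ}
    (hW : IsWienerIntegral X P T μ φ W) : W ∈ gaussSpace X P T := by
  obtain ⟨h2, φₙ, -, hlim⟩ := hW
  exact ⟨h2, fun k => (φₙ k).integral X,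
    fun k => ⟨stepIntegral_mem _, h.memLp_stepIntegral _⟩, hlim⟩

theorem integral_stepIntegral_mul [IsProbabilityMeasure P] (h : Setting X P T μ E' r)
    (φ : Step T) {a b : ℝ} (ha : 0 ≤ a) (hab : a ≤ b) (hb : b ≤ T) :
    ∫ ω, φ.integral X ω * (X b ω - X a ω) ∂P = hInner μ φ.fn (ind a b) := by
  have ma : a ∈ Icc 0 T := ⟨ha, hab.trans hb⟩
  have mb : b ∈ Icc 0 T := ⟨ha.trans hab, hb⟩
  change _ = hInner μ (fun s => ∑ i, φ.c i * ind (φ.a i) (φ.b i) s) (ind a b)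
  rw [h.hInner_sum_left _ _ (fun i _ => memL_ind _ _) (memL_ind _ _)]
  simp only [Step.integral, Finset.sum_mul]
  rw [integral_finsetSum]
  · refine Finset.sum_congr rfl fun i _ => ?_
    rw [← h.integral_mul_incr (φ.a_nonneg i) (φ.a_le_b i) (φ.b_le i) ha hab hb,
      ← integral_const_mul]
    simp only [mul_assoc]
  · intro i _
    have := ((h.memLp_two (t := φ.b i) ⟨(φ.a_nonneg i).trans (φ.a_le_b i), φ.b_le i⟩).sub
      (h.memLp_two (t := φ.a i) ⟨φ.a_nonneg i, (φ.a_le_b i).trans (φ.b_le i)⟩)).const_mul (φ.c i)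
    exact this.integrable_mul ((h.memLp_two mb).sub (h.memLp_two ma))

/-- The formula is bilinear on step functions. Approximation holds only in the seminorm of
`⟨·,·⟩_H`, so the right-hand side passes to the limit by Cauchy-Schwarz rather than by dominated
convergence. -/
theorem integral_wiener_mul [IsProbabilityMeasure P] (h : Setting X P T μ E' r) {φ : ℝ → ℝ}
    (hφ : MemL μ φ) {W : Ω → ℝ} (hW : IsWienerIntegral X P T μ φ W) {a b : ℝ} (ha : 0 ≤ a)
    (hab : a ≤ b) (hb : b ≤ T) :
    ∫ ω, W ω * (X b ω - X a ω) ∂P = hInner μ φ (ind a b) := by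
  obtain ⟨h2, φₙ, hn, hlim⟩ := hW
  have ma : a ∈ Icc 0 T := ⟨ha, hab.trans hb⟩
  have mb : b ∈ Icc 0 T := ⟨ha.trans hab, hb⟩
  have hΔ : MemLp (fun ω => X b ω - X a ω) 2 P := (h.memLp_two mb).sub (h.memLp_two ma)
  have l1 := tendsto_integral_mul_of_tendsto_eLpNorm
    (Eventually.of_forall fun k => h.memLp_stepIntegral (φₙ k)) (Eventually.of_forall fun _ => hΔ)
    h2 hΔ hlim (by simp)
  simp only [h.integral_stepIntegral_mul _ ha hab hb] at l1
  refine tendsto_nhds_unique l1 ?_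
  rw [tendsto_iff_norm_sub_tendsto_zero]
  have l2 := (hn.mul_const (hInner μ (ind a b) (ind a b))).sqrt
  rw [zero_mul, Real.sqrt_zero] at l2
  refine squeeze_zero (fun _ => norm_nonneg _) (fun k => ?_) l2
  rw [← h.hInner_sub_left (h.memL_fn _) hφ (memL_ind a b)]
  exact Real.abs_le_sqrt (h.hInner_sq_le (h.memL_sub (h.memL_fn _) hφ) (memL_ind a b))

/-! ### Gaussian integration by parts -/

theorem hasGaussianLaw_of_mem [IsProbabilityMeasure P] (h : Setting X P T μ E' r) {E : Type*}
    [NormedAddCommGroup E] [NormedSpace ℝ E] [MeasurableSpace E] [BorelSpace E] {V : Ω → E}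
    (hm : AEMeasurable V P)
    (hV : ∀ L : StrongDual ℝ E, (fun ω => L (V ω)) ∈ gaussSpace X P T) : HasGaussianLaw V P := by
  refine ⟨isGaussian_of_isGaussian_map fun L => ?_⟩
  rw [AEMeasurable.map_map_of_aemeasurable L.continuous.measurable.aemeasurable hm]
  exact (h.gaussSpace_spec (hV L)).1.isGaussian_map

end Setting

/-- Bounded `C¹` functions with bounded derivative. -/
def BddC1 {E : Type*} [NormedAddCommGroup E] [NormedSpace ℝ E] (f : E → ℝ) : Prop :=
  ContDiff ℝ 1 f ∧ ∃ C, ∀ x, |f x| ≤ C ∧ ‖fderiv ℝ f x‖ ≤ C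

namespace BddC1

variable {E F : Type*} [NormedAddCommGroup E] [NormedSpace ℝ E] [NormedAddCommGroup F]
  [NormedSpace ℝ F] {f g : E → ℝ}

theorem mul (hf : BddC1 f) (hg : BddC1 g) : BddC1 fun x => f x * g x := by
  obtain ⟨sf, C, hC⟩ := hf
  obtain ⟨sg, D, hD⟩ := hg
  have hC0 : 0 ≤ C := (norm_nonneg _).trans (hC 0).2
  have hD0 : 0 ≤ D := (norm_nonneg _).trans (hD 0).2
  refine ⟨sf.mul sg, C * D + D * C, fun x => ⟨?_, ?_⟩⟩
  · rw [abs_mul]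
    calc |f x| * |g x| ≤ C * D := mul_le_mul (hC x).1 (hD x).1 (abs_nonneg _) hC0
      _ ≤ _ := le_add_of_nonneg_right (by positivity)
  · rw [fderiv_fun_mul (sf.differentiable one_ne_zero x) (sg.differentiable one_ne_zero x)]
    refine (norm_add_le _ _).trans (add_le_add ?_ ?_)
    · rw [norm_smul]; exact mul_le_mul (hC x).1 (hD x).2 (norm_nonneg _) hC0
    · rw [norm_smul]; exact mul_le_mul (hD x).1 (hC x).2 (norm_nonneg _) hD0

theorem fderiv_mul_apply (hf : BddC1 f) (hg : BddC1 g) (x v : E) :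
    fderiv ℝ (fun x => f x * g x) x v = f x * fderiv ℝ g x v + g x * fderiv ℝ f x v := by
  rw [fderiv_fun_mul (hf.1.differentiable one_ne_zero x) (hg.1.differentiable one_ne_zero x)]
  simp

theorem fderiv_comp_clm (hf : BddC1 f) (A : F →L[ℝ] E) (x : F) :
    fderiv ℝ (fun x => f (A x)) x = (fderiv ℝ f (A x)).comp A := by
  have := fderiv_comp (g := f) (f := A) x (hf.1.differentiable one_ne_zero _) A.differentiableAt
  rwa [A.fderiv] at this

theorem comp_clm (hf : BddC1 f) (A : F →L[ℝ] E) : BddC1 fun x => f (A x) := by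
  obtain ⟨C, hC⟩ := hf.2
  refine ⟨hf.1.comp A.contDiff, max C (C * ‖A‖), fun x => ⟨(hC _).1.trans (le_max_left _ _), ?_⟩⟩
  rw [hf.fderiv_comp_clm]
  exact ((ContinuousLinearMap.opNorm_comp_le _ _).trans
    (mul_le_mul_of_nonneg_right (hC _).2 (norm_nonneg _))).trans (le_max_right _ _)

theorem prod_mul {g : F → ℝ} (hf : BddC1 f) (hg : BddC1 g) :
    BddC1 fun x : E × F => f x.1 * g x.2 :=
  (hf.comp_clm (ContinuousLinearMap.fst ℝ E F)).mul (hg.comp_clm (ContinuousLinearMap.snd ℝ E F))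

theorem fderiv_prod_mul {g : F → ℝ} (hf : BddC1 f) (hg : BddC1 g) (x v : E × F) :
    fderiv ℝ (fun x : E × F => f x.1 * g x.2) x v
      = f x.1 * fderiv ℝ g x.2 v.2 + g x.2 * fderiv ℝ f x.1 v.1 := by
  have := (hf.comp_clm (ContinuousLinearMap.fst ℝ E F)).fderiv_mul_apply
    (hg.comp_clm (ContinuousLinearMap.snd ℝ E F)) x v
  rw [hf.fderiv_comp_clm, hg.fderiv_comp_clm] at this
  exact this

theorem exists_bound (hf : BddC1 f) : ∃ C, ∀ x, ‖f x‖ ≤ C := hf.2.imp fun _ h x => (h x).1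

theorem exists_bound_fderiv (hf : BddC1 f) (v : E) : ∃ C, ∀ x, ‖fderiv ℝ f x v‖ ≤ C := by
  obtain ⟨C, hC⟩ := hf.2
  exact ⟨C * ‖v‖, fun x => ((fderiv ℝ f x).le_opNorm v).trans
    (mul_le_mul_of_nonneg_right (hC x).2 (norm_nonneg _))⟩

theorem continuous_fderiv_apply (hf : BddC1 f) (v : E) : Continuous fun x => fderiv ℝ f x v :=
  (hf.1.continuous_fderiv one_ne_zero).clm_apply continuous_const

end BddC1

namespace Setting

variable {E : Type*} [NormedAddCommGroup E] [NormedSpace ℝ E] [CompleteSpace E]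
  [SecondCountableTopology E] [MeasurableSpace E] [BorelSpace E] {V : Ω → E} {f : E → ℝ} {G H : Ω → ℝ}

omit [NormedSpace ℝ E] [CompleteSpace E] [SecondCountableTopology E] in
theorem memLp_comp_mul (hV : AEMeasurable V P) (hf : Continuous f) (hb : ∃ C, ∀ x, ‖f x‖ ≤ C)
    (hG : MemLp G 2 P) : MemLp (fun ω => f (V ω) * G ω) 2 P := by
  obtain ⟨C, hC⟩ := hb
  have hm : AEStronglyMeasurable (fun ω => f (V ω)) P :=
    (hf.measurable.comp_aemeasurable hV).aestronglyMeasurable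
  exact hG.of_le_mul (c := C) (hm.mul hG.1) (Eventually.of_forall fun ω => by
    rw [norm_mul]; exact mul_le_mul_of_nonneg_right (hC _) (norm_nonneg _))

omit [NormedSpace ℝ E] [CompleteSpace E] [SecondCountableTopology E] in
theorem memLp_comp [IsProbabilityMeasure P] (hV : AEMeasurable V P) (hf : Continuous f)
    (hb : ∃ C, ∀ x, ‖f x‖ ≤ C) : MemLp (fun ω => f (V ω)) 2 P := by
  simpa using memLp_comp_mul hV hf hb (memLp_const (1 : ℝ))

omit [CompleteSpace E] [SecondCountableTopology E] [MeasurableSpace E] [BorelSpace E] in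
theorem clm_prodMk_mem (hV : ∀ L : StrongDual ℝ E, (fun ω => L (V ω)) ∈ gaussSpace X P T)
    (hG : G ∈ gaussSpace X P T) (L : StrongDual ℝ (E × ℝ)) :
    (fun ω => L (V ω, G ω)) ∈ gaussSpace X P T := by
  have e : (fun ω => L (V ω, G ω)) = (fun ω => (L.comp (ContinuousLinearMap.inl ℝ E ℝ)) (V ω))
      + L (0, 1) • G := by
    ext ω
    have : (V ω, G ω) = (V ω, 0) + G ω • ((0, 1) : E × ℝ) := by simp
    rw [this, map_add, map_smul]
    simp [mul_comm]
  rw [e]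
  exact Submodule.add_mem _ (hV _) (Submodule.smul_mem _ _ hG)

theorem integral_comp_mul [IsProbabilityMeasure P] (h : Setting X P T μ E' r)
    (hVm : AEMeasurable V P) (hV : ∀ L : StrongDual ℝ E, (fun ω => L (V ω)) ∈ gaussSpace X P T)
    (hG : G ∈ gaussSpace X P T) {c : E} (hc : ∀ L : StrongDual ℝ E, ∫ ω, L (V ω) * G ω ∂P = L c)
    (hf : BddC1 f) : ∫ ω, f (V ω) * G ω ∂P = ∫ ω, fderiv ℝ f (V ω) c ∂P :=
  integral_comp_mul_of_hasGaussianLaw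
    (h.hasGaussianLaw_of_mem (hVm.prodMk hG.1.1.aemeasurable)
      (clm_prodMk_mem hV hG)) (h.gaussSpace_spec hG).2 hc
    (fun x => (hf.1.differentiable one_ne_zero x).hasFDerivAt)
    ((memLp_comp_mul hVm hf.1.continuous hf.exists_bound hG.1).integrable (by norm_num))
    ((memLp_comp hVm (hf.continuous_fderiv_apply c) (hf.exists_bound_fderiv c)).integrable
      (by norm_num))
    ((memLp_comp hVm hf.1.continuous hf.exists_bound).integrable (by norm_num))

/-- Integration by parts against `H` is applied to the function `(v, g) ↦ f(v) g` of the Gaussian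
vector `(V, G)`. This function is unbounded, which is why the general formula asks for integrability
only. -/
theorem integral_comp_mul_mul [IsProbabilityMeasure P] (h : Setting X P T μ E' r)
    (hVm : AEMeasurable V P) (hV : ∀ L : StrongDual ℝ E, (fun ω => L (V ω)) ∈ gaussSpace X P T)
    (hG : G ∈ gaussSpace X P T) (hH : H ∈ gaussSpace X P T) {c : E}
    (hc : ∀ L : StrongDual ℝ E, ∫ ω, L (V ω) * H ω ∂P = L c) (hf : BddC1 f) :
    ∫ ω, f (V ω) * G ω * H ω ∂P =
      (∫ ω, f (V ω) ∂P) * (∫ ω, G ω * H ω ∂P) + ∫ ω, fderiv ℝ f (V ω) c * G ω ∂P := by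
  have hVG := clm_prodMk_mem hV hG
  have m1 : MemLp (fun ω => fderiv ℝ f (V ω) c * G ω) 2 P :=
    memLp_comp_mul hVm (hf.continuous_fderiv_apply c) (hf.exists_bound_fderiv c) hG.1
  have m2 : MemLp (fun ω => f (V ω) * G ω) 2 P :=
    memLp_comp_mul hVm hf.1.continuous hf.exists_bound hG.1
  have m3 : MemLp (fun ω => f (V ω)) 2 P := memLp_comp hVm hf.1.continuous hf.exists_bound
  have i1 : Integrable (fun ω => f (V ω) * ∫ ω, G ω * H ω ∂P) P :=
    (m3.integrable (by norm_num)).mul_const _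
  have i2 : Integrable (fun ω => G ω * fderiv ℝ f (V ω) c) P := by
    simpa only [mul_comm] using m1.integrable (by norm_num)
  have key := integral_comp_mul_of_hasGaussianLaw (V := fun ω => (V ω, G ω)) (G := H)
    (c := (c, ∫ ω, G ω * H ω ∂P)) (f := fun p => f p.1 * p.2)
    (f' := fun p => f p.1 • ContinuousLinearMap.snd ℝ E ℝ
      + p.2 • (fderiv ℝ f p.1).comp (ContinuousLinearMap.fst ℝ E ℝ)) (P := P)
    (h.hasGaussianLaw_of_mem ((hVm.prodMk hG.1.1.aemeasurable).prodMk hH.1.1.aemeasurable)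
      (clm_prodMk_mem hVG hH)) (h.gaussSpace_spec hH).2
    ?_ ?_ (m2.integrable_mul hH.1) (i1.add i2) (m2.integrable (by norm_num))
  · rw [key]
    simp only [add_apply, smul_apply, smul_eq_mul,
      ContinuousLinearMap.comp_apply, ContinuousLinearMap.coe_fst', ContinuousLinearMap.coe_snd']
    rw [integral_add i1 i2, integral_mul_const]
    simp only [mul_comm]
  · intro L
    have e : ∀ ω, L (V ω, G ω) * H ω = (L.comp (ContinuousLinearMap.inl ℝ E ℝ)) (V ω) * H ω
        + L (0, 1) * (G ω * H ω) := by
      intro ω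
      have : (V ω, G ω) = (V ω, 0) + G ω • ((0, 1) : E × ℝ) := by simp
      rw [this, map_add, map_smul]
      simp only [ContinuousLinearMap.comp_apply, ContinuousLinearMap.inl_apply, smul_eq_mul]
      ring
    rw [integral_congr_ae (Eventually.of_forall e)]
    rw [integral_add, integral_const_mul, hc]
    · have : L (c, ∫ ω, G ω * H ω ∂P) = L (c, 0) + (∫ ω, G ω * H ω ∂P) * L (0, 1) := by
        rw [← smul_eq_mul, ← map_smul, ← map_add]; simp
      rw [this]
      simp [mul_comm]
    · exact (hV _).1.integrable_mul hH.1
    · exact (hG.1.integrable_mul hH.1).const_mul _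
  · intro p
    exact ((hf.1.differentiable one_ne_zero p.1).hasFDerivAt.comp p hasFDerivAt_fst).mul
      hasFDerivAt_snd

end Setting

end CovMeasure

end

noncomputable section

namespace CovMeasure

variable {Ω : Type*} [MeasurableSpace Ω] {X : ℝ → Ω → ℝ} {P : Measure Ω} {T : ℝ}
  {μ : SignedMeasure (ℝ × ℝ)} {E' : ℝ → ℝ} {r : ℝ × ℝ → ℝ}

/-! ### Cylindrical variables -/

namespace Cyl

theorem norm_fderiv_eq {E F : Type*} [NormedAddCommGroup E] [NormedSpace ℝ E]
    [NormedAddCommGroup F] [NormedSpace ℝ F] (f : E → F) (x : E) :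
    ‖fderiv ℝ f x‖ = ‖iteratedFDeriv ℝ 1 f x‖ := by
  rw [← norm_iteratedFDeriv_fderiv, norm_iteratedFDeriv_zero]

theorem bddC1 (F : Cyl X P T μ) : BddC1 F.f := by
  obtain ⟨C, hC⟩ := F.f_bdd 0
  obtain ⟨D, hD⟩ := F.f_bdd 1
  refine ⟨F.f_smooth.of_le (WithTop.coe_le_coe.2 le_top), max C D, fun x => ⟨?_, ?_⟩⟩
  · have := hC x
    rw [norm_iteratedFDeriv_zero] at this
    exact this.trans (le_max_left _ _)
  · rw [norm_fderiv_eq]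
    exact (hD x).trans (le_max_right _ _)

theorem differentiable_fderiv (F : Cyl X P T μ) : Differentiable ℝ (fderiv ℝ F.f) :=
  (F.f_smooth.fderiv_right (m := 1) (WithTop.coe_le_coe.2 le_top)).differentiable one_ne_zero

theorem fderiv_fderiv_apply (F : Cyl X P T μ) (c x v : Fin F.n → ℝ) :
    fderiv ℝ (fun x => fderiv ℝ F.f x c) x v = fderiv ℝ (fderiv ℝ F.f) x v c := by
  have := ((F.differentiable_fderiv x).hasFDerivAt.clm_apply (hasFDerivAt_const c x)).fderiv
  rw [this]; simp

theorem fderiv_fderiv_comm (F : Cyl X P T μ) (x v w : Fin F.n → ℝ) :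
    fderiv ℝ (fderiv ℝ F.f) x v w = fderiv ℝ (fderiv ℝ F.f) x w v :=
  (F.f_smooth.contDiffAt.isSymmSndFDerivAt (by
    rw [minSmoothness_of_isRCLikeNormedField]
    exact WithTop.coe_le_coe.2 (le_top (a := (2 : ℕ∞))))) v w

theorem bddC1_fderiv (F : Cyl X P T μ) (c : Fin F.n → ℝ) : BddC1 fun x => fderiv ℝ F.f x c := by
  obtain ⟨C, hC⟩ := F.bddC1.exists_bound_fderiv c
  obtain ⟨D, hD⟩ := F.f_bdd 2
  refine ⟨(F.f_smooth.fderiv_right (m := 1) (WithTop.coe_le_coe.2 le_top)).clm_apply contDiff_const,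
    max C (D * ‖c‖), fun x => ⟨(hC x).trans (le_max_left _ _), ?_⟩⟩
  have hD0 : 0 ≤ D := (norm_nonneg _).trans (hD 0)
  refine (ContinuousLinearMap.opNorm_le_bound _ (by positivity) fun v => ?_).trans
    (le_max_right C (D * ‖c‖))
  rw [F.fderiv_fderiv_apply]
  have h1 : ‖fderiv ℝ (fderiv ℝ F.f) x‖ ≤ D := by
    rw [norm_fderiv_eq, norm_iteratedFDeriv_fderiv]; exact hD x
  calc _ ≤ ‖fderiv ℝ (fderiv ℝ F.f) x v‖ * ‖c‖ := ContinuousLinearMap.le_opNorm _ _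
    _ ≤ ‖fderiv ℝ (fderiv ℝ F.f) x‖ * ‖v‖ * ‖c‖ := by gcongr; exact ContinuousLinearMap.le_opNorm _ _
    _ ≤ D * ‖v‖ * ‖c‖ := by gcongr
    _ = D * ‖c‖ * ‖v‖ := by ring

/-- The vector of Wiener integrals on which `F` depends. -/
def vec (F : Cyl X P T μ) (ω : Ω) : Fin F.n → ℝ := fun i => F.W i ω

/-- The vector of the `⟨φᵢ, g⟩_H`. -/
def coef (F : Cyl X P T μ) (g : ℝ → ℝ) : Fin F.n → ℝ := fun i => hInner μ (F.φ i) g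

/-- The derivative `⟨DF, g⟩_H` in the direction `g`. -/
def dir (F : Cyl X P T μ) (g : ℝ → ℝ) (ω : Ω) : ℝ := hInner μ (fun t => F.deriv t ω) g

theorem clm_apply_eq_sum {n : ℕ} (L : StrongDual ℝ (Fin n → ℝ)) (x : Fin n → ℝ) :
    L x = ∑ i, L (Pi.single i 1) * x i := by
  have := L.toLinearMap.pi_apply_eq_sum_univ x
  simp only [ContinuousLinearMap.coe_coe, smul_eq_mul] at this
  rw [this]
  exact Finset.sum_congr rfl fun i _ => by rw [mul_comm]; congr 2; ext j; simp [Pi.single_apply, eq_comm]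

/-- The pairing `⟨DF, g⟩_H` becomes a derivative of `F.f` in the deterministic direction `F.coef g`,
the form in which the Gaussian formulas apply. -/
theorem dir_eq (h : Setting X P T μ E' r) (F : Cyl X P T μ) {g : ℝ → ℝ} (hg : MemL μ g) (ω : Ω) :
    F.dir g ω = fderiv ℝ F.f (F.vec ω) (F.coef g) := by
  rw [clm_apply_eq_sum]
  exact h.hInner_sum_left _ (fun i => fderiv ℝ F.f (fun j => F.W j ω) (Pi.single i 1))
    (fun i _ => F.φ_mem i) hg

theorem memL_deriv (h : Setting X P T μ E' r) (F : Cyl X P T μ) (ω : Ω) :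
    MemL μ fun t => F.deriv t ω :=
  h.memL_sum _ fun i _ => (F.φ_mem i).const_mul _

theorem aemeasurable_vec (F : Cyl X P T μ) : AEMeasurable F.vec P :=
  aemeasurable_pi_lambda _ fun i => (F.isWiener i).1.1.aemeasurable

theorem clm_vec_mem (h : Setting X P T μ E' r) (F : Cyl X P T μ)
    (L : StrongDual ℝ (Fin F.n → ℝ)) : (fun ω => L (F.vec ω)) ∈ gaussSpace X P T := by
  have e : (fun ω => L (F.vec ω)) = ∑ i, L (Pi.single i 1) • F.W i := by
    ext ω
    rw [clm_apply_eq_sum]; simp [vec]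
  rw [e]
  exact Submodule.sum_mem _ fun i _ => Submodule.smul_mem _ _ (h.wiener_mem (F.isWiener i))

end Cyl

namespace Setting

theorem incr_mem (h : Setting X P T μ E' r) {a b : ℝ} (ha : 0 ≤ a) (hab : a ≤ b) (hb : b ≤ T) :
    (fun ω => X b ω - X a ω) ∈ gaussSpace X P T :=
  Submodule.sub_mem _ (h.mem_gaussSpace ⟨ha.trans hab, hb⟩) (h.mem_gaussSpace ⟨ha, hab.trans hb⟩)

theorem memLp_val [IsProbabilityMeasure P] (F : Cyl X P T μ) : MemLp F.val 2 P :=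
  memLp_comp (f := F.f) F.aemeasurable_vec F.bddC1.1.continuous F.bddC1.exists_bound

theorem memLp_dir [IsProbabilityMeasure P] (h : Setting X P T μ E' r) (F : Cyl X P T μ)
    {g : ℝ → ℝ} (hg : MemL μ g) : MemLp (F.dir g) 2 P := by
  rw [funext (F.dir_eq h hg)]
  exact memLp_comp F.aemeasurable_vec (F.bddC1_fderiv (F.coef g)).1.continuous
    (F.bddC1_fderiv (F.coef g)).exists_bound

theorem memLp_val_mul (F : Cyl X P T μ) {G : Ω → ℝ} (hG : MemLp G 2 P) :
    MemLp (fun ω => F.val ω * G ω) 2 P :=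
  memLp_comp_mul (f := F.f) F.aemeasurable_vec F.bddC1.1.continuous F.bddC1.exists_bound hG

theorem memLp_dir_mul (h : Setting X P T μ E' r) (F : Cyl X P T μ)
    {g : ℝ → ℝ} (hg : MemL μ g) {G : Ω → ℝ} (hG : MemLp G 2 P) :
    MemLp (fun ω => F.dir g ω * G ω) 2 P := by
  simp only [F.dir_eq h hg]
  exact memLp_comp_mul F.aemeasurable_vec (F.bddC1_fderiv (F.coef g)).1.continuous
    (F.bddC1_fderiv (F.coef g)).exists_bound hG

theorem clm_pair_mem (h : Setting X P T μ E' r) (F G : Cyl X P T μ)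
    (L : StrongDual ℝ ((Fin F.n → ℝ) × (Fin G.n → ℝ))) :
    (fun ω => L (F.vec ω, G.vec ω)) ∈ gaussSpace X P T := by
  have e : (fun ω => L (F.vec ω, G.vec ω))
      = (fun ω => (L.comp (ContinuousLinearMap.inl ℝ _ _)) (F.vec ω))
      + (fun ω => (L.comp (ContinuousLinearMap.inr ℝ _ _)) (G.vec ω)) := by
    ext ω
    simp [← map_add]
  rw [e]
  exact Submodule.add_mem _ (F.clm_vec_mem h _) (G.clm_vec_mem h _)

section Pair

variable [IsProbabilityMeasure P] (h : Setting X P T μ E' r) (F G : Cyl X P T μ)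
include h

variable {a b : ℝ} (ha : 0 ≤ a) (hab : a ≤ b) (hb : b ≤ T)
include ha hab hb

theorem integral_clm_vec_mul (L : StrongDual ℝ (Fin F.n → ℝ)) :
    ∫ ω, L (F.vec ω) * (X b ω - X a ω) ∂P = L (F.coef (ind a b)) := by
  have e : ∀ ω, L (F.vec ω) = ∑ i, L (Pi.single i 1) * F.vec ω i :=
    fun ω => Cyl.clm_apply_eq_sum L _
  rw [Cyl.clm_apply_eq_sum L (F.coef _)]
  simp only [e, Finset.sum_mul]
  rw [integral_finsetSum]
  · refine Finset.sum_congr rfl fun i _ => ?_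
    simp only [mul_assoc]
    rw [integral_const_mul]
    congr 1
    exact h.integral_wiener_mul (F.φ_mem i) (F.isWiener i) ha hab hb
  · intro i _
    exact ((F.isWiener i).1.const_mul (L (Pi.single i 1))).integrable_mul (h.incr_mem ha hab hb).1

theorem integral_clm_pair_mul (L : StrongDual ℝ ((Fin F.n → ℝ) × (Fin G.n → ℝ))) :
    ∫ ω, L (F.vec ω, G.vec ω) * (X b ω - X a ω) ∂P = L (F.coef (ind a b), G.coef (ind a b)) := by
  obtain ⟨L₁, L₂, e⟩ : ∃ (L₁ : StrongDual ℝ (Fin F.n → ℝ)) (L₂ : StrongDual ℝ (Fin G.n → ℝ)),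
      ∀ x y, L (x, y) = L₁ x + L₂ y :=
    ⟨L.comp (ContinuousLinearMap.inl ℝ _ _), L.comp (ContinuousLinearMap.inr ℝ _ _), fun x y => by
      simp [← map_add]⟩
  have hΔ := (h.incr_mem ha hab hb).1
  simp only [e, add_mul]
  rw [← h.integral_clm_vec_mul F ha hab hb, ← h.integral_clm_vec_mul G ha hab hb]
  exact integral_add ((F.clm_vec_mem h _).1.integrable_mul hΔ)
      ((G.clm_vec_mem h _).1.integrable_mul hΔ)

/-- The duality formula for cylindrical variables. -/
theorem integral_val_mul_val_mul :
    ∫ ω, F.val ω * (G.val ω * (X b ω - X a ω) - G.dir (ind a b) ω) ∂P =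
      ∫ ω, G.val ω * F.dir (ind a b) ω ∂P := by
  have hΔ := h.incr_mem ha hab hb
  have mg : MemL μ (ind a b) := memL_ind a b
  have key := h.integral_comp_mul (F.aemeasurable_vec.prodMk G.aemeasurable_vec)
    (h.clm_pair_mem F G) hΔ (h.integral_clm_pair_mul F G ha hab hb) (F.bddC1.prod_mul G.bddC1)
  simp only [F.bddC1.fderiv_prod_mul G.bddC1, ← F.dir_eq h mg, ← G.dir_eq h mg] at key
  change ∫ ω, F.val ω * G.val ω * (X b ω - X a ω) ∂P =
    ∫ ω, F.val ω * G.dir (ind a b) ω + G.val ω * F.dir (ind a b) ω ∂P at key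
  have i1 : Integrable (fun ω => F.val ω * G.val ω * (X b ω - X a ω)) P := by
    simpa only [mul_assoc] using
      (memLp_val_mul F (memLp_val_mul G hΔ.1)).integrable (by norm_num)
  have i2 := (memLp_val_mul F (h.memLp_dir G mg)).integrable (by norm_num)
  have i3 := (memLp_val_mul G (h.memLp_dir F mg)).integrable (by norm_num)
  rw [integral_add i2 i3] at key
  have e : ∀ ω, F.val ω * (G.val ω * (X b ω - X a ω) - G.dir (ind a b) ω)
      = F.val ω * G.val ω * (X b ω - X a ω) - F.val ω * G.dir (ind a b) ω := fun ω => by ring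
  simp only [e]
  rw [integral_sub i1 i2, key]
  ring

/-- The isometry formula for cylindrical variables. -/
theorem integral_corr_mul_corr_cyl {c d : ℝ} (hc : 0 ≤ c) (hcd : c ≤ d) (hd : d ≤ T) :
    ∫ ω, (F.val ω * (X b ω - X a ω) - F.dir (ind a b) ω)
        * (G.val ω * (X d ω - X c ω) - G.dir (ind c d) ω) ∂P =
      (∫ ω, F.val ω * G.val ω ∂P) * hInner μ (ind a b) (ind c d)
        + ∫ ω, F.dir (ind c d) ω * G.dir (ind a b) ω ∂P := by
  have hΔ := h.incr_mem ha hab hb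
  have hΔ' := h.incr_mem hc hcd hd
  have mg : MemL μ (ind a b) := memL_ind a b
  have mh : MemL μ (ind c d) := memL_ind c d
  have hV := F.aemeasurable_vec.prodMk G.aemeasurable_vec
  have hVm := h.clm_pair_mem F G
  have hcg := h.integral_clm_pair_mul F G ha hab hb
  have hch := h.integral_clm_pair_mul F G hc hcd hd
  -- Expanding the product leaves `E[FGΔΔ']` and two terms linear in an increment. The first is
  -- integrated by parts against `Δ'`, which leaves `E[(F D'G + G D'F)Δ]`. Then `k2` treats `E[D'F G
  -- Δ]` and `k3` treats `E[DF G Δ']`; here `D`, `D'` are the derivatives along the first and second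
  -- interval.
  have k1 := h.integral_comp_mul_mul hV hVm hΔ hΔ' hch (F.bddC1.prod_mul G.bddC1)
  have k2 := h.integral_comp_mul hV hVm hΔ hcg
    ((F.bddC1_fderiv (F.coef (ind c d))).prod_mul G.bddC1)
  have k3 := h.integral_comp_mul hV hVm hΔ' hch
    ((F.bddC1_fderiv (F.coef (ind a b))).prod_mul G.bddC1)
  simp only [F.bddC1.fderiv_prod_mul G.bddC1, (F.bddC1_fderiv _).fderiv_prod_mul G.bddC1,
    ← F.dir_eq h mg, ← G.dir_eq h mg, ← F.dir_eq h mh, ← G.dir_eq h mh,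
    F.fderiv_fderiv_apply, h.integral_mul_incr ha hab hb hc hcd hd] at k1 k2 k3
  change ∫ ω, F.val ω * G.val ω * (X b ω - X a ω) * (X d ω - X c ω) ∂P =
    (∫ ω, F.val ω * G.val ω ∂P) * hInner μ (ind a b) (ind c d) +
      ∫ ω, (F.val ω * G.dir (ind c d) ω + G.val ω * F.dir (ind c d) ω) * (X b ω - X a ω) ∂P at k1
  change ∫ ω, F.dir (ind c d) ω * G.val ω * (X b ω - X a ω) ∂P = ∫ ω, F.dir (ind c d) ω *
    G.dir (ind a b) ω + G.val ω * fderiv ℝ (fderiv ℝ F.f) (F.vec ω) (F.coef (ind a b)) (F.coef (ind c d)) ∂P at k2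
  change ∫ ω, F.dir (ind a b) ω * G.val ω * (X d ω - X c ω) ∂P = ∫ ω, F.dir (ind a b) ω *
    G.dir (ind c d) ω + G.val ω * fderiv ℝ (fderiv ℝ F.f) (F.vec ω) (F.coef (ind c d)) (F.coef (ind a b)) ∂P at k3
  have j1 : Integrable (fun ω => F.val ω * (G.val ω * (X b ω - X a ω)) * (X d ω - X c ω)) P :=
    (memLp_val_mul F (memLp_val_mul G hΔ.1)).integrable_mul hΔ'.1
  have j2 : Integrable (fun ω => F.val ω * (G.dir (ind c d) ω * (X b ω - X a ω))) P :=
    (memLp_val_mul F (h.memLp_dir_mul G mh hΔ.1)).integrable (by norm_num)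
  have j3 : Integrable (fun ω => F.dir (ind c d) ω * (G.val ω * (X b ω - X a ω))) P :=
    (h.memLp_dir_mul F mh (memLp_val_mul G hΔ.1)).integrable (by norm_num)
  have j4 : Integrable (fun ω => F.dir (ind a b) ω * (G.val ω * (X d ω - X c ω))) P :=
    (h.memLp_dir_mul F mg (memLp_val_mul G hΔ'.1)).integrable (by norm_num)
  have j5 : Integrable (fun ω => F.dir (ind a b) ω * G.dir (ind c d) ω) P :=
    (h.memLp_dir F mg).integrable_mul (h.memLp_dir G mh)
  have j6 : Integrable (fun ω => F.dir (ind c d) ω * G.dir (ind a b) ω) P :=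
    (h.memLp_dir F mh).integrable_mul (h.memLp_dir G mg)
  have j7 : Integrable (fun ω => G.val ω * fderiv ℝ (fderiv ℝ F.f) (F.vec ω)
      (F.coef (ind a b)) (F.coef (ind c d))) P := by
    simp only [← F.fderiv_fderiv_apply]
    have b1 := F.bddC1_fderiv (F.coef (ind c d))
    exact (memLp_val_mul G (memLp_comp F.aemeasurable_vec
      (b1.continuous_fderiv_apply (F.coef (ind a b)))
      (b1.exists_bound_fderiv _))).integrable (by norm_num)
  -- Symmetry of the second derivative makes the second order terms of `k2` and `k3` equal; they
  -- cancel at the end, leaving only first derivatives.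
  simp only [F.fderiv_fderiv_comm _ (F.coef (ind c d))] at k3
  have e1 : ∀ ω, (F.val ω * G.dir (ind c d) ω + G.val ω * F.dir (ind c d) ω) * (X b ω - X a ω)
      = F.val ω * (G.dir (ind c d) ω * (X b ω - X a ω))
        + F.dir (ind c d) ω * (G.val ω * (X b ω - X a ω)) := fun ω => by ring
  simp only [e1] at k1
  simp only [mul_assoc (F.dir _ _)] at k2 k3
  rw [integral_add j2 j3] at k1
  rw [integral_add j6 j7] at k2
  rw [integral_add j5 j7] at k3
  have e2 : ∀ ω, (F.val ω * (X b ω - X a ω) - F.dir (ind a b) ω)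
        * (G.val ω * (X d ω - X c ω) - G.dir (ind c d) ω)
      = F.val ω * (G.val ω * (X b ω - X a ω)) * (X d ω - X c ω)
        - F.val ω * (G.dir (ind c d) ω * (X b ω - X a ω))
        - F.dir (ind a b) ω * (G.val ω * (X d ω - X c ω))
        + F.dir (ind a b) ω * G.dir (ind c d) ω := fun ω => by ring
  rw [integral_congr_ae (Eventually.of_forall e2), integral_add _ j5, integral_sub _ j4,
    integral_sub j1 j2]
  rotate_left
  · exact j1.sub j2
  · exact (j1.sub j2).sub j4
  simp only [mul_assoc (F.val _)] at k1
  simp only [mul_assoc (F.val _)]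
  rw [k1, k2, k3]
  ring

end Pair

end Setting

end CovMeasure

end

noncomputable section

namespace CovMeasure

variable {Ω : Type*} [MeasurableSpace Ω] {X : ℝ → Ω → ℝ} {P : Measure Ω} {T : ℝ}
  {μ : SignedMeasure (ℝ × ℝ)} {E' : ℝ → ℝ} {r : ℝ × ℝ → ℝ}

/-! ### Malliavin differentiable variables -/

theorem tendsto_eLpNorm_two_of_lintegral {f : ℕ → Ω → ℝ} {B : ℕ → Ω → ℝ≥0∞}
    (h : ∀ k, ∀ᵐ ω ∂P, ‖f k ω‖ₑ ^ 2 ≤ B k ω)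
    (hB : Tendsto (fun k => ∫⁻ ω, B k ω ∂P) atTop (𝓝 0)) :
    Tendsto (fun k => eLpNorm (f k) 2 P) atTop (𝓝 0) := by
  have h1 : Tendsto (fun k => ∫⁻ ω, ‖f k ω‖ₑ ^ 2 ∂P) atTop (𝓝 0) :=
    tendsto_of_tendsto_of_tendsto_of_le_of_le tendsto_const_nhds hB (fun _ => zero_le)
      fun k => lintegral_mono_ae (h k)
  have h2 : ∀ k, eLpNorm (f k) 2 P = (∫⁻ ω, ‖f k ω‖ₑ ^ 2 ∂P) ^ (1 / 2 : ℝ) := fun k => by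
    rw [eLpNorm_eq_lintegral_rpow_enorm_toReal (by norm_num) (by norm_num)]
    simp
  simp only [h2]
  have := (ENNReal.continuous_rpow_const (y := (1 / 2 : ℝ))).tendsto 0 |>.comp h1
  rwa [ENNReal.zero_rpow_of_pos (by norm_num)] at this

/-- The random variable `F (X_b - X_a) - ⟨DF, 1_{]a,b]}⟩_H`. -/
def corr (X : ℝ → Ω → ℝ) (μ : SignedMeasure (ℝ × ℝ)) (F : Ω → ℝ) (DF : ℝ → Ω → ℝ) (a b : ℝ)
    (ω : Ω) : ℝ :=
  F ω * (X b ω - X a ω) - hInner μ (fun t => DF t ω) (ind a b)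

/-- The cylindrical variables `Fₙ` approximate `F` together with its directional derivatives and
the variables `corr`. -/
structure Approximates (X : ℝ → Ω → ℝ) (P : Measure Ω) (T : ℝ) (μ : SignedMeasure (ℝ × ℝ))
    (Fₙ : ℕ → Cyl X P T μ) (F : Ω → ℝ) (DF : ℝ → Ω → ℝ) (a b : ℝ) : Prop where
  memLp_dir : MemLp (fun ω => hInner μ (fun t => DF t ω) (ind a b)) 2 P
  tendsto_dir : Tendsto (fun k => eLpNorm (fun ω =>
    (Fₙ k).dir (ind a b) ω - hInner μ (fun t => DF t ω) (ind a b)) 2 P) atTop (𝓝 0)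
  memLp_corr : MemLp (corr X μ F DF a b) 2 P
  tendsto_corr : Tendsto (fun k => eLpNorm (fun ω =>
    corr X μ (Fₙ k).val (Fₙ k).deriv a b ω - corr X μ F DF a b ω) 2 P) atTop (𝓝 0)

namespace Setting

theorem measurable_hInner (h : Setting X P T μ E' r) {u : ℝ → Ω → ℝ}
    (hu : Measurable fun q : ℝ × Ω => u q.1 q.2) {g : ℝ → ℝ} (hg : Measurable g) :
    Measurable fun ω => hInner μ (fun t => u t ω) g := by
  obtain ⟨θ, hθm, -, hθ⟩ := h.glue.exists_sign
  simp only [hInner, hθ]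
  refine StronglyMeasurable.measurable (StronglyMeasurable.integral_prod_right'
    (f := fun q : Ω × (ℝ × ℝ) => u q.2.1 q.1 * g q.2.2 * θ q.2) (Measurable.stronglyMeasurable ?_))
  have h1 : Measurable fun q : Ω × (ℝ × ℝ) => u q.2.1 q.1 :=
    hu.comp (f := fun q : Ω × (ℝ × ℝ) => (q.2.1, q.1)) (by fun_prop)
  exact (h1.mul (hg.comp (measurable_snd.comp measurable_snd))).mul (hθm.comp measurable_snd)

/-- The directional derivatives converge in `L²` by Cauchy-Schwarz for `⟨·,·⟩_H`. The products
`Fₙ(X_b - X_a)` are only seen to converge in `L¹`, since the increment is unbounded. The cylindrical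
isometry compensates: it involves `Fₙ` and its directional derivatives only, so the corrected
products are Cauchy in `L²`. -/
theorem exists_approximates [IsProbabilityMeasure P] (h : Setting X P T μ E' r) {F : Ω → ℝ}
    {DF : ℝ → Ω → ℝ} (hD : HasMalliavinDeriv X P T μ F DF)
    (hm : Measurable fun q : ℝ × Ω => DF q.1 q.2) :
    ∃ Fₙ : ℕ → Cyl X P T μ,
      Tendsto (fun k => eLpNorm (fun ω => (Fₙ k).val ω - F ω) 2 P) atTop (𝓝 0) ∧
      ∀ a b, 0 ≤ a → a ≤ b → b ≤ T → Approximates X P T μ Fₙ F DF a b := by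
  obtain ⟨hF, hmem, Fₙ, hn, hDn⟩ := hD
  refine ⟨Fₙ, hn, fun a b ha hab hb => ?_⟩
  have mg : MemL μ (ind a b) := memL_ind a b
  have hΔ := (h.incr_mem ha hab hb).1
  have hdir : Tendsto (fun k => eLpNorm (fun ω =>
      (Fₙ k).dir (ind a b) ω - hInner μ (fun t => DF t ω) (ind a b)) 2 P) atTop (𝓝 0) := by
    refine tendsto_eLpNorm_two_of_lintegral (B := fun k ω => ENNReal.ofReal
      (hInner μ (fun t => (Fₙ k).deriv t ω - DF t ω) (fun t => (Fₙ k).deriv t ω - DF t ω))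
      * ENNReal.ofReal (hInner μ (ind a b) (ind a b))) (fun k => ?_) ?_
    · filter_upwards [hmem] with ω hω
      have m1 := (Fₙ k).memL_deriv h ω
      rw [Cyl.dir, ← h.hInner_sub_left m1 hω mg,
        ← ENNReal.ofReal_mul (h.hInner_self_nonneg (h.memL_sub m1 hω)), ← ofReal_norm,
        ← ENNReal.ofReal_pow (norm_nonneg _), Real.norm_eq_abs, sq_abs]
      exact ENNReal.ofReal_le_ofReal (h.hInner_sq_le (h.memL_sub m1 hω) mg)
    · simp only [lintegral_mul_const' _ _ ENNReal.ofReal_ne_top]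
      have := ENNReal.Tendsto.mul_const (b := ENNReal.ofReal (hInner μ (ind a b) (ind a b)))
        hDn (Or.inr ENNReal.ofReal_ne_top)
      rwa [zero_mul] at this
  have hDm := (h.measurable_hInner hm mg.1).aestronglyMeasurable (μ := P)
  -- Some approximating derivative is at finite `L²` distance from the limit, so the limit is square
  -- integrable.
  have hDF : MemLp (fun ω => hInner μ (fun t => DF t ω) (ind a b)) 2 P := by
    obtain ⟨k, hk⟩ := (hdir.eventually (gt_mem_nhds (zero_lt_one (α := ℝ≥0∞)))).exists
    have h1 : MemLp (fun ω => (Fₙ k).dir (ind a b) ω - hInner μ (fun t => DF t ω) (ind a b)) 2 P :=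
      ⟨(h.memLp_dir (Fₙ k) mg).1.sub hDm, hk.trans ENNReal.one_lt_top⟩
    refine (h.memLp_dir (Fₙ k) mg).sub h1 |>.ae_eq (Eventually.of_forall fun ω => ?_)
    simp
  have hc2 : ∀ k, MemLp (corr X μ (Fₙ k).val (Fₙ k).deriv a b) 2 P := fun k =>
    (memLp_val_mul (Fₙ k) hΔ).sub (h.memLp_dir (Fₙ k) mg)
  have l1 : Tendsto (fun p : ℕ × ℕ => ∫ ω, (Fₙ p.1).val ω * (Fₙ p.2).val ω ∂P)
      (atTop ×ˢ atTop) (𝓝 (∫ ω, F ω * F ω ∂P)) :=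
    tendsto_integral_mul_of_tendsto_eLpNorm (Eventually.of_forall fun _ => memLp_val _)
      (Eventually.of_forall fun _ => memLp_val _) hF hF (hn.comp tendsto_fst) (hn.comp tendsto_snd)
  have l2 : Tendsto (fun p : ℕ × ℕ => ∫ ω, (Fₙ p.1).dir (ind a b) ω * (Fₙ p.2).dir (ind a b) ω ∂P)
      (atTop ×ˢ atTop) (𝓝 (∫ ω, hInner μ (fun t => DF t ω) (ind a b) *
        hInner μ (fun t => DF t ω) (ind a b) ∂P)) :=
    tendsto_integral_mul_of_tendsto_eLpNorm (Eventually.of_forall fun _ => h.memLp_dir _ mg)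
      (Eventually.of_forall fun _ => h.memLp_dir _ mg) hDF hDF (hdir.comp tendsto_fst)
      (hdir.comp tendsto_snd)
  obtain ⟨Z, hZ, hZlim⟩ := exists_memLp_of_tendsto_integral_mul (Eventually.of_forall hc2)
    (((l1.mul_const (hInner μ (ind a b) (ind a b))).add l2).congr fun p =>
      (h.integral_corr_mul_corr_cyl (Fₙ p.1) (Fₙ p.2) ha hab hb ha hab hb).symm)
  have hcm : AEStronglyMeasurable (corr X μ F DF a b) P := (hF.1.mul hΔ.1).sub hDm
  -- The `L²` limit and the `L¹` limit are both limits in probability, hence equal.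
  have hZeq : Z =ᵐ[P] corr X μ F DF a b := by
    refine tendstoInMeasure_ae_unique (u := atTop)
      (tendstoInMeasure_of_tendsto_eLpNorm (p := 2) (by norm_num) (fun k => (hc2 k).1) hZ.1 hZlim)
      (tendstoInMeasure_of_tendsto_eLpNorm (p := 1) (by norm_num) (fun k => (hc2 k).1) hcm ?_)
    have l3 := ENNReal.Tendsto.const_mul (a := eLpNorm (fun ω => X b ω - X a ω) 2 P) hn
      (Or.inr hΔ.2.ne)
    have l4 := l3.add hdir
    rw [mul_zero, zero_add] at l4
    refine tendsto_of_tendsto_of_tendsto_of_le_of_le tendsto_const_nhds l4 (fun _ => zero_le)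
      fun k => ?_
    have e : corr X μ (Fₙ k).val (Fₙ k).deriv a b - corr X μ F DF a b
        = (fun ω => X b ω - X a ω) • (fun ω => (Fₙ k).val ω - F ω)
          - fun ω => (Fₙ k).dir (ind a b) ω - hInner μ (fun t => DF t ω) (ind a b) := by
      ext ω
      change (Fₙ k).val ω * (X b ω - X a ω) - (Fₙ k).dir (ind a b) ω - corr X μ F DF a b ω
        = (X b ω - X a ω) * ((Fₙ k).val ω - F ω) - ((Fₙ k).dir (ind a b) ω - _)
      rw [corr]; ring
    have m1 : AEStronglyMeasurable (fun ω => (Fₙ k).val ω - F ω) P := (memLp_val _).1.sub hF.1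
    have m2 := (h.memLp_dir (Fₙ k) mg).1.sub hDm
    rw [e]
    refine (eLpNorm_sub_le (hΔ.1.smul m1) m2 le_rfl).trans (add_le_add ?_ ?_)
    · exact eLpNorm_smul_le_mul_eLpNorm m1 hΔ.1
    · exact eLpNorm_le_eLpNorm_of_exponent_le (by norm_num) m2
  refine ⟨hDF, hdir, hZ.ae_eq hZeq, hZlim.congr fun k => eLpNorm_congr_ae ?_⟩
  filter_upwards [hZeq] with ω hω
  rw [hω]

/-- The duality formula. -/
theorem integral_val_mul_corr [IsProbabilityMeasure P] (h : Setting X P T μ E' r) {F : Ω → ℝ}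
    {DF : ℝ → Ω → ℝ} (hD : HasMalliavinDeriv X P T μ F DF)
    (hm : Measurable fun q : ℝ × Ω => DF q.1 q.2) (G : Cyl X P T μ) {a b : ℝ} (ha : 0 ≤ a)
    (hab : a ≤ b) (hb : b ≤ T) :
    ∫ ω, G.val ω * corr X μ F DF a b ω ∂P = ∫ ω, F ω * G.dir (ind a b) ω ∂P := by
  obtain ⟨Fₙ, hn, happ⟩ := h.exists_approximates hD hm
  have hA := happ a b ha hab hb
  have hc2 : ∀ k, MemLp (corr X μ (Fₙ k).val (Fₙ k).deriv a b) 2 P := fun k =>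
    (memLp_val_mul (Fₙ k) (h.incr_mem ha hab hb).1).sub (h.memLp_dir (Fₙ k) (memL_ind a b))
  have l1 := tendsto_integral_mul_of_tendsto_eLpNorm (l := atTop) (f := fun _ : ℕ => G.val)
    (Eventually.of_forall fun _ => memLp_val G) (Eventually.of_forall hc2) (memLp_val G)
    hA.memLp_corr (by simp) hA.tendsto_corr
  have l2 := tendsto_integral_mul_of_tendsto_eLpNorm (l := atTop)
    (g := fun _ : ℕ => G.dir (ind a b))
    (Eventually.of_forall fun k => memLp_val (Fₙ k))
    (Eventually.of_forall fun _ => h.memLp_dir G (memL_ind a b)) hD.1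
    (h.memLp_dir G (memL_ind a b)) hn (by simp)
  exact tendsto_nhds_unique (l1.congr fun k => h.integral_val_mul_val_mul G (Fₙ k) ha hab hb) l2

/-- The isometry formula. -/
theorem integral_corr_mul_corr [IsProbabilityMeasure P] (h : Setting X P T μ E' r) {F G : Ω → ℝ}
    {DF DG : ℝ → Ω → ℝ} (hF : HasMalliavinDeriv X P T μ F DF)
    (hmF : Measurable fun q : ℝ × Ω => DF q.1 q.2) (hG : HasMalliavinDeriv X P T μ G DG)
    (hmG : Measurable fun q : ℝ × Ω => DG q.1 q.2) {a b c d : ℝ} (ha : 0 ≤ a)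
    (hab : a ≤ b) (hb : b ≤ T) (hc : 0 ≤ c) (hcd : c ≤ d) (hd : d ≤ T) :
    ∫ ω, corr X μ F DF a b ω * corr X μ G DG c d ω ∂P =
      (∫ ω, F ω * G ω ∂P) * hInner μ (ind a b) (ind c d)
        + ∫ ω, hInner μ (fun t => DF t ω) (ind c d) * hInner μ (fun t => DG t ω) (ind a b) ∂P := by
  obtain ⟨Fₙ, hFn, happF⟩ := h.exists_approximates hF hmF
  obtain ⟨Gₙ, hGn, happG⟩ := h.exists_approximates hG hmG
  have hc2 : ∀ (F : Cyl X P T μ) {a b : ℝ}, 0 ≤ a → a ≤ b → b ≤ T →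
      MemLp (corr X μ F.val F.deriv a b) 2 P := fun F {a b} ha hab hb =>
    (memLp_val_mul F (h.incr_mem ha hab hb).1).sub (h.memLp_dir F (memL_ind a b))
  have l1 := tendsto_integral_mul_of_tendsto_eLpNorm
    (Eventually.of_forall fun k => hc2 (Fₙ k) ha hab hb)
    (Eventually.of_forall fun k => hc2 (Gₙ k) hc hcd hd)
    (happF a b ha hab hb).memLp_corr (happG c d hc hcd hd).memLp_corr
    (happF a b ha hab hb).tendsto_corr (happG c d hc hcd hd).tendsto_corr
  have l2 := tendsto_integral_mul_of_tendsto_eLpNorm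
    (Eventually.of_forall fun k => memLp_val (Fₙ k))
    (Eventually.of_forall fun k => memLp_val (Gₙ k)) hF.1 hG.1 hFn hGn
  have l3 := tendsto_integral_mul_of_tendsto_eLpNorm
    (Eventually.of_forall fun k => h.memLp_dir (Fₙ k) (memL_ind c d))
    (Eventually.of_forall fun k => h.memLp_dir (Gₙ k) (memL_ind a b))
    (happF c d hc hcd hd).memLp_dir (happG a b ha hab hb).memLp_dir
    (happF c d hc hcd hd).tendsto_dir (happG a b ha hab hb).tendsto_dir
  exact tendsto_nhds_unique (l1.congr fun k =>
    h.integral_corr_mul_corr_cyl (Fₙ k) (Gₙ k) ha hab hb hc hcd hd)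
    ((l2.mul_const _).add l3)

end Setting

/-- The cylindrical variable `1`. -/
def Cyl.one (X : ℝ → Ω → ℝ) (P : Measure Ω) (T : ℝ) (μ : SignedMeasure (ℝ × ℝ)) : Cyl X P T μ where
  n := 0
  f := fun _ => 1
  f_smooth := contDiff_const
  f_bdd := fun k => ⟨1, fun x => by
    rcases k with _ | k
    · simp [norm_iteratedFDeriv_zero]
    · rw [iteratedFDeriv_succ_const]; simp⟩
  φ := fun i => i.elim0
  φ_mem := fun i => i.elim0
  W := fun i => i.elim0
  isWiener := fun i => i.elim0

theorem Cyl.one_val (ω : Ω) : (Cyl.one X P T μ).val ω = 1 := rfl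

theorem Cyl.one_deriv (t : ℝ) (ω : Ω) : (Cyl.one X P T μ).deriv t ω = 0 := by
  exact Finset.sum_eq_zero fun i _ => i.elim0

end CovMeasure

end

noncomputable section

namespace CovMeasure

/-! ### Integrals of regularized functions depending on a parameter -/

section Smear

variable {S Q : Type*} [MeasurableSpace S] [MeasurableSpace Q] {T d t : ℝ}

theorem integrable_integral_mul {L : Measure S} {ν : Measure Q} [IsFiniteMeasure L] [SFinite ν]
    {f g : S × Q → ℝ} {κ : Q → ℝ}
    (hf : MemLp f 2 (L.prod ν)) (hg : MemLp g 2 (L.prod ν)) (hκ : Measurable κ)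
    (hκ1 : ∀ q, |κ q| ≤ 1) :
    Integrable (fun x : S × S => ∫ q, f (x.1, q) * g (x.2, q) * κ q ∂ν) (L.prod L) ∧
    ∫ x, ∫ q, f (x.1, q) * g (x.2, q) * κ q ∂ν ∂L.prod L =
      ∫ q, (∫ s, f (s, q) ∂L) * (∫ s, g (s, q) ∂L) * κ q ∂ν := by
  have hint : Integrable (fun x : (S × S) × Q => f (x.1.1, x.2) * g (x.1.2, x.2) * κ x.2)
      ((L.prod L).prod ν) := by
    refine Integrable.mul_bdd (c := 1) ?_ (hκ.comp measurable_snd).aestronglyMeasurable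
      (Eventually.of_forall fun x => hκ1 _)
    exact (memLp_comp_fst_fst hf).integrable_mul (memLp_comp_fst_snd hg)
  have h1 := hint.integral_prod_left
  refine ⟨h1, ?_⟩
  rw [integral_integral_swap (f := fun (p : S × S) q => f (p.1, q) * g (p.2, q) * κ q) hint]
  congr with q
  rw [integral_mul_const, integral_prod_mul (fun s => f (s, q)) (fun s => g (s, q))]

theorem measurable_smear_param {g : Q → ℝ → ℝ} (hg : Measurable fun x : Q × ℝ => g x.1 x.2)
    {ρ : Q → ℝ} (hρ : Measurable ρ) (ε : ℝ) : Measurable fun q => smear T d t (g q) (ρ q) ε := by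
  refine Measurable.const_mul (StronglyMeasurable.measurable ?_) _
  refine StronglyMeasurable.integral_prod_right'
    (f := fun q : Q × ℝ => g q.1 q.2 * win T d ε q.2 (ρ q.1)) (Measurable.stronglyMeasurable ?_)
  exact hg.mul ((measurable_win ε).comp (measurable_snd.prodMk (hρ.comp measurable_fst)))

theorem measurable_indicator_param {g : Q → ℝ → ℝ} (hg : Measurable fun x : Q × ℝ => g x.1 x.2)
    {ρ : Q → ℝ} (hρ : Measurable ρ) : Measurable fun q => (Icc 0 t).indicator (g q) (ρ q) :=
  (hg.comp (measurable_id.prodMk hρ)).indicator (hρ measurableSet_Icc)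

/-- Along a fixed sequence the convergence set is measurable, so almost everywhere statements on a
product space can be checked section by section. This is why the differentiation property of
`Smearable` is stated along sequences. -/
theorem measurableSet_tendsto_smear {g : Q → ℝ → ℝ} (hg : Measurable fun x : Q × ℝ => g x.1 x.2)
    {ρ : Q → ℝ} (hρ : Measurable ρ) (e : ℕ → ℝ) :
    MeasurableSet {q | Tendsto (fun k => smear T d t (g q) (ρ q) (e k)) atTop
      (𝓝 ((Icc 0 t).indicator (g q) (ρ q)))} :=
  measurableSet_tendsto_fun (fun k => measurable_smear_param hg hρ (e k))
    (measurable_indicator_param hg hρ)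

/-- A square integrable family of functions on `[0,T]`, evaluated at random points, for which
Lebesgue's differentiation theorem holds. -/
structure Smearable (ν : Measure Q) (T d t : ℝ) (g : Q → ℝ → ℝ) (ρ : Q → ℝ) : Prop where
  meas : Measurable fun x : Q × ℝ => g x.1 x.2
  meas_pt : Measurable ρ
  dom : ∃ M : Q → ℝ, MemLp M 2 ν ∧ ∀ q s, |g q s| ≤ M q
  conv : ∀ e : ℕ → ℝ, Tendsto e atTop (𝓝[>] 0) →
    ∀ᵐ q ∂ν, Tendsto (fun k => smear T d t (g q) (ρ q) (e k)) atTop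
      (𝓝 ((Icc 0 t).indicator (g q) (ρ q)))

namespace Smearable

variable {ν : Measure Q} {g g' : Q → ℝ → ℝ} {ρ ρ' : Q → ℝ} {κ : Q → ℝ}

theorem measurable_mul_win (h : Smearable ν T d t g ρ) (ε : ℝ) :
    Measurable fun x : ℝ × Q => g x.2 x.1 * win T d ε x.1 (ρ x.2) :=
  (h.meas.comp measurable_swap).mul
    ((measurable_win ε).comp (measurable_fst.prodMk (h.meas_pt.comp measurable_snd)))

theorem memLp [SFinite ν] (h : Smearable ν T d t g ρ) (ε : ℝ) :
    MemLp (fun x : ℝ × Q => g x.2 x.1 * win T d ε x.1 (ρ x.2)) 2 ((leb t).prod ν) := by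
  obtain ⟨M, hM, hle⟩ := h.dom
  refine (hM.comp_snd (leb t)).mono (h.measurable_mul_win ε).aestronglyMeasurable
    (Eventually.of_forall fun x => ?_)
  rw [norm_mul, Real.norm_eq_abs, Real.norm_eq_abs]
  calc _ ≤ M x.2 * 1 := mul_le_mul (hle _ _) (abs_win_le_one _ _ _) (abs_nonneg _)
        ((abs_nonneg _).trans (hle x.2 0))
    _ ≤ _ := by rw [mul_one]; exact le_abs_self _

theorem memLp_section (h : Smearable ν T d t g ρ) (ε s : ℝ) (ρ₀ : Q → ℝ) (hρ₀ : Measurable ρ₀) :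
    MemLp (fun q => g q s * win T d ε s (ρ₀ q)) 2 ν := by
  obtain ⟨M, hM, hle⟩ := h.dom
  refine hM.mono ?_ (Eventually.of_forall fun x => ?_)
  · exact ((h.meas.comp (measurable_id.prodMk measurable_const)).mul
      ((measurable_win ε).comp (measurable_const.prodMk hρ₀))).aestronglyMeasurable
  rw [norm_mul, Real.norm_eq_abs, Real.norm_eq_abs]
  calc _ ≤ M x * 1 := mul_le_mul (hle _ _) (abs_win_le_one _ _ _) (abs_nonneg _)
        ((abs_nonneg _).trans (hle x 0))
    _ ≤ _ := by rw [mul_one]; exact le_abs_self _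

theorem integral_mul [SFinite ν] (h : Smearable ν T d t g ρ) (h' : Smearable ν T d t g' ρ')
    (hκ : Measurable κ) (hκ1 : ∀ q, |κ q| ≤ 1) (ε ε' : ℝ) :
    Integrable (fun x : ℝ × ℝ => ∫ q, g q x.1 * win T d ε x.1 (ρ q) *
      (g' q x.2 * win T d ε' x.2 (ρ' q)) * κ q ∂ν) ((leb t).prod (leb t)) ∧
    ε⁻¹ * ε'⁻¹ * ∫ x, ∫ q, g q x.1 * win T d ε x.1 (ρ q) *
      (g' q x.2 * win T d ε' x.2 (ρ' q)) * κ q ∂ν ∂(leb t).prod (leb t) =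
      ∫ q, smear T d t (g q) (ρ q) ε * smear T d t (g' q) (ρ' q) ε' * κ q ∂ν := by
  obtain ⟨h1, h2⟩ := integrable_integral_mul (h.memLp ε) (h'.memLp ε') hκ hκ1
  refine ⟨h1, ?_⟩
  rw [h2, ← integral_const_mul]
  congr with q
  simp only [smear]
  ring

/-- The two widths tend to `0` independently, as the Cauchy criterion requires. A regularization is
bounded by any bound of the function, so the product `M M'` of the square integrable bounds
dominates. -/
theorem tendsto_integral_mul (h : Smearable ν T d t g ρ) (h' : Smearable ν T d t g' ρ')
    (hκ : Measurable κ) (hκ1 : ∀ q, |κ q| ≤ 1) :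
    Tendsto (fun p : ℝ × ℝ => ∫ q, smear T d t (g q) (ρ q) p.1 *
      smear T d t (g' q) (ρ' q) p.2 * κ q ∂ν) (𝓝[>] 0 ×ˢ 𝓝[>] 0)
      (𝓝 (∫ q, (Icc 0 t).indicator (g q) (ρ q) * (Icc 0 t).indicator (g' q) (ρ' q) * κ q ∂ν)) := by
  obtain ⟨M, hM, hle⟩ := h.dom
  obtain ⟨M', hM', hle'⟩ := h'.dom
  refine tendsto_of_seq_tendsto fun e he => ?_
  have he1 : Tendsto (fun k => (e k).1) atTop (𝓝[>] 0) := tendsto_fst.comp he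
  have he2 : Tendsto (fun k => (e k).2) atTop (𝓝[>] 0) := tendsto_snd.comp he
  refine tendsto_integral_filter_of_dominated_convergence (fun q => M q * M' q)
    (Eventually.of_forall fun k => ?_) ?_ (hM.integrable_mul hM') ?_
  · exact (((measurable_smear_param h.meas h.meas_pt _).mul
      (measurable_smear_param h'.meas h'.meas_pt _)).mul hκ).aestronglyMeasurable
  · filter_upwards [he1 self_mem_nhdsWithin, he2 self_mem_nhdsWithin] with k h1 h2
    refine Eventually.of_forall fun q => ?_
    rw [norm_mul, norm_mul, Real.norm_eq_abs, Real.norm_eq_abs, Real.norm_eq_abs]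
    have hM0 : 0 ≤ M q := (abs_nonneg _).trans (hle q 0)
    have hM0' : 0 ≤ M' q := (abs_nonneg _).trans (hle' q 0)
    calc _ ≤ M q * M' q * 1 := mul_le_mul (mul_le_mul (abs_smear_le (hle q) h1 _)
          (abs_smear_le (hle' q) h2 _) (abs_nonneg _) hM0) (hκ1 q) (abs_nonneg _) (by positivity)
      _ = _ := mul_one _
  · filter_upwards [h.conv _ he1, h'.conv _ he2] with q h1 h2
    exact (h1.mul h2).mul_const _

end Smearable

/-- Fubini turns an average over the windows of pairings with their indicators into a single pairing
with the regularized function. -/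
theorem integral_smear_mul {ν : Measure Q} [SFinite ν] {g : Q → ℝ → ℝ}
    (hg : Measurable fun x : Q × ℝ => g x.1 x.2) {ρ : Q → ℝ} (hρ : Measurable ρ) {K : Q → ℝ}
    (hK : AEStronglyMeasurable K ν) {B : Q → ℝ} (hB : Integrable B ν)
    (hle : ∀ᵐ q ∂ν, ∀ s, |g q s| * |K q| ≤ B q) (ε : ℝ) :
    ε⁻¹ * ∫ s, ∫ q, g q s * win T d ε s (ρ q) * K q ∂ν ∂leb t =
      ∫ q, smear T d t (g q) (ρ q) ε * K q ∂ν := by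
  have hm : AEStronglyMeasurable (fun x : ℝ × Q => g x.2 x.1 * win T d ε x.1 (ρ x.2) * K x.2)
      ((leb t).prod ν) :=
    (((hg.comp measurable_swap).mul ((measurable_win ε).comp
      (measurable_fst.prodMk (hρ.comp measurable_snd)))).aestronglyMeasurable).mul hK.comp_snd
  have hint : Integrable (fun x : ℝ × Q => g x.2 x.1 * win T d ε x.1 (ρ x.2) * K x.2)
      ((leb t).prod ν) := by
    refine (hB.comp_snd (leb t)).mono' hm ?_
    filter_upwards [Measure.quasiMeasurePreserving_snd.ae hle] with x hx
    rw [norm_mul, norm_mul, Real.norm_eq_abs, Real.norm_eq_abs, Real.norm_eq_abs, mul_right_comm]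
    refine le_trans (mul_le_of_le_one_right (by positivity) (abs_win_le_one _ _ _)) (hx x.1)
  rw [integral_integral_swap (f := fun s q => g q s * win T d ε s (ρ q) * K q) hint,
    ← integral_const_mul]
  congr with q
  rw [integral_mul_const, smear, mul_assoc]

end Smear

/-! ### Measurability of the set of convergence -/

section Convergence

/-- By continuity, a closed condition on the rationals of a small interval extends to the whole
interval. Existence of a limit as a real `ε ↓ 0` thereby becomes a countable condition, hence a
measurable one. -/
theorem tendsto_nhdsGT_of_tendsto_rat {f : ℝ → ℝ} (hf : ContinuousOn f (Ioi 0)) {c : ℝ}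
    (h : Tendsto (fun q : ℚ => f q) (comap (fun q : ℚ => (q : ℝ)) (𝓝[>] 0)) (𝓝 c)) :
    Tendsto f (𝓝[>] 0) (𝓝 c) := by
  rw [(Metric.nhds_basis_closedBall).tendsto_right_iff] at h ⊢
  intro η hη
  have h1 := h η hη
  rw [eventually_comap] at h1
  obtain ⟨δ, hδ, hs⟩ := mem_nhdsGT_iff_exists_Ioo_subset.1 h1
  refine mem_of_superset (Ioo_mem_nhdsGT hδ) fun x hx => ?_
  have hd : x ∈ closure (Ioo 0 δ ∩ range ((↑) : ℚ → ℝ)) :=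
    Rat.denseRange_cast.open_subset_closure_inter isOpen_Ioo hx
  have hcl : IsClosed (Metric.closedBall c η) := Metric.isClosed_closedBall
  have hcx : ContinuousWithinAt f (Ioo 0 δ ∩ range ((↑) : ℚ → ℝ)) x :=
    (hf x hx.1).mono fun y hy => hy.1.1
  refine hcl.closure_subset (hcx.mem_closure hd ?_)
  rintro y ⟨hy, q, rfl⟩
  exact hs hy q rfl

theorem exists_tendsto_nhdsGT_iff {f : ℝ → ℝ} (hf : ContinuousOn f (Ioi 0)) :
    (∃ c, Tendsto f (𝓝[>] 0) (𝓝 c)) ↔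
      ∃ c, Tendsto (fun q : ℚ => f q) (comap (fun q : ℚ => (q : ℝ)) (𝓝[>] 0)) (𝓝 c) :=
  ⟨fun ⟨c, hc⟩ => ⟨c, hc.comp tendsto_comap⟩, fun ⟨c, hc⟩ => ⟨c, tendsto_nhdsGT_of_tendsto_rat hf hc⟩⟩

variable {Q : Type*} [MeasurableSpace Q] {d : ℝ}

theorem continuousOn_slideMean {g : ℝ → ℝ} (hg : LocallyIntegrable g) (r : ℝ) :
    ContinuousOn (slideMean d g r) (Ioi 0) := by
  have hgi (x y : ℝ) : IntervalIntegrable g volume x y :=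
    intervalIntegrable_iff.mpr <|
      (hg.integrableOn_isCompact isCompact_uIcc).mono_set uIoc_subset_uIcc
  have hc : Continuous fun x => ∫ s in (0 : ℝ)..x, g s :=
    intervalIntegral.continuous_primitive hgi 0
  have e : slideMean d g r = fun ε => ε⁻¹ * ((∫ s in (0 : ℝ)..(r + d * ε), g s)
      - ∫ s in (0 : ℝ)..(r - (1 - d) * ε), g s) := by
    ext ε
    rw [slideMean, intervalIntegral.integral_interval_sub_left (hgi _ _) (hgi _ _)]
  rw [e]
  refine (continuousOn_id.inv₀ fun x hx => (mem_Ioi.1 hx).ne').mul (Continuous.continuousOn ?_)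
  exact (hc.comp (by fun_prop)).sub (hc.comp (by fun_prop))

theorem measurable_slideMean_param {g : Q → ℝ → ℝ} (hg : Measurable fun x : Q × ℝ => g x.1 x.2)
    {ρ : Q → ℝ} (hρ : Measurable ρ) (ε : ℝ) : Measurable fun q => slideMean d (g q) (ρ q) ε := by
  have key : ∀ a b : Q → ℝ, Measurable a → Measurable b →
      Measurable fun q => ∫ s in Ioc (a q) (b q), g q s := by
    intro a b ha hb
    simp only [← integral_indicator measurableSet_Ioc]
    have hs : MeasurableSet {x : Q × ℝ | x.2 ∈ Ioc (a x.1) (b x.1)} :=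
      (measurableSet_lt (ha.comp measurable_fst) measurable_snd).inter
        (measurableSet_le measurable_snd (hb.comp measurable_fst))
    exact (StronglyMeasurable.integral_prod_right' (ν := (volume : Measure ℝ))
      (hg.indicator hs).stronglyMeasurable).measurable
  have ha : Measurable fun q => ρ q - (1 - d) * ε := by fun_prop
  have hb : Measurable fun q => ρ q + d * ε := by fun_prop
  exact ((key _ _ ha hb).sub (key _ _ hb ha)).const_mul _

theorem measurableSet_exists_tendsto_slideMean {g : Q → ℝ → ℝ}
    (hg : Measurable fun x : Q × ℝ => g x.1 x.2) {ρ : Q → ℝ} (hρ : Measurable ρ)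
    (hgl : ∀ q, LocallyIntegrable (g q)) :
    MeasurableSet {q | ∃ c, Tendsto (slideMean d (g q) (ρ q)) (𝓝[>] 0) (𝓝 c)} := by
  simp only [exists_tendsto_nhdsGT_iff (continuousOn_slideMean (hgl _) _)]
  exact measurableSet_exists_tendsto fun e : ℚ => measurable_slideMean_param hg hρ (e : ℝ)

end Convergence

end CovMeasure

end

noncomputable section

namespace CovMeasure

variable {Ω : Type*} [MeasurableSpace Ω] {X : ℝ → Ω → ℝ} {P : Measure Ω} {T : ℝ}
  {μ : SignedMeasure (ℝ × ℝ)} {E' : ℝ → ℝ} {r : ℝ × ℝ → ℝ} {Y : ℝ → Ω → ℝ} {D : ℝ → ℝ → Ω → ℝ}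

/-! ### Dominated Malliavin differentiable processes -/

/-- `Y s` is Malliavin differentiable with derivative `D · s`, up to null sets. -/
def DifferentiableAt (X : ℝ → Ω → ℝ) (P : Measure Ω) (T : ℝ) (μ : SignedMeasure (ℝ × ℝ))
    (Y : ℝ → Ω → ℝ) (D : ℝ → ℝ → Ω → ℝ) (s : ℝ) : Prop :=
  ∃ (F : Ω → ℝ) (DF : ℝ → Ω → ℝ), HasMalliavinDeriv X P T μ F DF ∧
    (Measurable fun q : ℝ × Ω => DF q.1 q.2) ∧ F =ᵐ[P] Y s ∧
    ∀ᵐ ω ∂P, ∀ᵐ u ∂leb T, DF u ω = D u s ω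

/-- A process with values and derivative dominated by square integrable variables. -/
structure DominatedProcess (X : ℝ → Ω → ℝ) (P : Measure Ω) (T : ℝ) (μ : SignedMeasure (ℝ × ℝ))
    (Y : ℝ → Ω → ℝ) (D : ℝ → ℝ → Ω → ℝ) : Prop where
  meas : Measurable fun q : ℝ × Ω => Y q.1 q.2
  meas_deriv : Measurable fun q : ℝ × ℝ × Ω => D q.1 q.2.1 q.2.2
  dom : ∃ S : Ω → ℝ, MemLp S 2 P ∧ ∀ s ω, |Y s ω| ≤ S ω
  dom_deriv : ∃ Z : Ω → ℝ, MemLp Z 2 P ∧ ∀ u s ω, |D u s ω| ≤ Z ω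
  differentiableAt : ∀ᵐ s ∂leb T, DifferentiableAt X P T μ Y D s

/-- The variable `corr` on the window of width `ε` at `s`. -/
def wcorr (X : ℝ → Ω → ℝ) (T : ℝ) (μ : SignedMeasure (ℝ × ℝ)) (d : ℝ) (Y : ℝ → Ω → ℝ)
    (D : ℝ → ℝ → Ω → ℝ) (ε s : ℝ) (ω : Ω) : ℝ :=
  corr X μ (Y s) (fun u ω => D u s ω) (clamp T (s - d * ε)) (clamp T (s + (1 - d) * ε)) ω

omit [MeasurableSpace Ω] in
theorem wcorr_eq (d ε s : ℝ) (ω : Ω) : wcorr X T μ d Y D ε s ω =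
    Y s ω * incr X T d ε s ω - hInner μ (fun u => D u s ω) (win T d ε s) := rfl

namespace Setting

/-- A change of `φ` on a Lebesgue null set is invisible because the first marginal of `|μ|` is
absolutely continuous. Versions of the Malliavin derivative may therefore be exchanged freely. -/
theorem hInner_congr (h : Setting X P T μ E' r) {φ φ' : ℝ → ℝ} (hφ : ∀ᵐ u ∂leb T, φ u = φ' u)
    (g : ℝ → ℝ) : hInner μ φ g = hInner μ φ' g := by
  obtain ⟨θ, -, -, hθ⟩ := h.glue.exists_sign
  rw [hInner, hInner, hθ, hθ]
  refine integral_congr_ae ?_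
  filter_upwards [h.glue.qmp_fst.ae hφ] with p hp
  rw [hp]

theorem corr_ae_eq (h : Setting X P T μ E' r) {F : Ω → ℝ} {DF : ℝ → Ω → ℝ} {s : ℝ}
    (h1 : F =ᵐ[P] Y s) (h2 : ∀ᵐ ω ∂P, ∀ᵐ u ∂leb T, DF u ω = D u s ω) (a b : ℝ) :
    corr X μ F DF a b =ᵐ[P] corr X μ (Y s) (fun u ω => D u s ω) a b := by
  filter_upwards [h1, h2] with ω k1 k2
  rw [corr, corr, k1, h.hInner_congr k2]

variable {d : ℝ}

theorem window_spec (h : Setting X P T μ E' r) {ε : ℝ} (hε : 0 ≤ ε) (s : ℝ) :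
    0 ≤ clamp T (s - d * ε) ∧ clamp T (s - d * ε) ≤ clamp T (s + (1 - d) * ε) ∧
      clamp T (s + (1 - d) * ε) ≤ T :=
  ⟨(clamp_mem h.pos.le _).1, clamp_le_clamp (by nlinarith), (clamp_mem h.pos.le _).2⟩

variable [IsProbabilityMeasure P]

theorem memLp_wcorr_section (h : Setting X P T μ E' r) {s : ℝ}
    (hs : DifferentiableAt X P T μ Y D s) {ε : ℝ} (hε : 0 ≤ ε) :
    MemLp (wcorr X T μ d Y D ε s) 2 P := by
  obtain ⟨F, DF, hF, hm, h1, h2⟩ := hs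
  obtain ⟨w1, w2, w3⟩ := h.window_spec (d := d) hε s
  obtain ⟨_, _, happ⟩ := h.exists_approximates hF hm
  exact (happ _ _ w1 w2 w3).memLp_corr.ae_eq (h.corr_ae_eq h1 h2 _ _)

theorem integral_val_mul_wcorr (h : Setting X P T μ E' r) {s : ℝ}
    (hs : DifferentiableAt X P T μ Y D s) {ε : ℝ} (hε : 0 ≤ ε) (G : Cyl X P T μ) :
    ∫ ω, G.val ω * wcorr X T μ d Y D ε s ω ∂P = ∫ ω, Y s ω * G.dir (win T d ε s) ω ∂P := by
  obtain ⟨F, DF, hF, hm, h1, h2⟩ := hs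
  obtain ⟨w1, w2, w3⟩ := h.window_spec (d := d) hε s
  have e1 : ∫ ω, Y s ω * G.dir (win T d ε s) ω ∂P = ∫ ω, F ω * G.dir (win T d ε s) ω ∂P :=
    integral_congr_ae (by filter_upwards [h1] with ω k; rw [k])
  rw [e1]
  refine Eq.trans (integral_congr_ae ?_) (h.integral_val_mul_corr hF hm G w1 w2 w3)
  filter_upwards [h.corr_ae_eq h1 h2 (clamp T (s - d * ε)) (clamp T (s + (1 - d) * ε))] with ω k
  rw [k, wcorr]

theorem integral_wcorr_mul (h : Setting X P T μ E' r) {s s' : ℝ}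
    (hs : DifferentiableAt X P T μ Y D s) (hs' : DifferentiableAt X P T μ Y D s') {ε ε' : ℝ}
    (hε : 0 ≤ ε) (hε' : 0 ≤ ε') :
    ∫ ω, wcorr X T μ d Y D ε s ω * wcorr X T μ d Y D ε' s' ω ∂P =
      (∫ ω, Y s ω * Y s' ω ∂P) * hInner μ (win T d ε s) (win T d ε' s')
        + ∫ ω, hInner μ (fun u => D u s ω) (win T d ε' s')
          * hInner μ (fun u => D u s' ω) (win T d ε s) ∂P := by
  obtain ⟨F, DF, hF, hm, h1, h2⟩ := hs
  obtain ⟨F', DF', hF', hm', h1', h2'⟩ := hs'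
  obtain ⟨w1, w2, w3⟩ := h.window_spec (d := d) hε s
  obtain ⟨w1', w2', w3'⟩ := h.window_spec (d := d) hε' s'
  have key := h.integral_corr_mul_corr hF hm hF' hm' w1 w2 w3 w1' w2' w3'
  refine Eq.trans (integral_congr_ae ?_) (key.trans (congrArg₂ (· + ·) (congrArg₂ (· * ·)
    (integral_congr_ae ?_) rfl) (integral_congr_ae ?_)))
  · filter_upwards [h.corr_ae_eq h1 h2 (clamp T (s - d * ε)) (clamp T (s + (1 - d) * ε)),
      h.corr_ae_eq h1' h2' (clamp T (s' - d * ε')) (clamp T (s' + (1 - d) * ε'))] with ω k k'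
    rw [k, k', wcorr, wcorr]
  · filter_upwards [h1, h1'] with ω k k'
    rw [k, k']
  · filter_upwards [h2, h2'] with ω k k'
    rw [h.hInner_congr k, h.hInner_congr k']
    rfl

end Setting

namespace DominatedProcess

variable {d t : ℝ}

theorem measurable_hInner_win (h : Setting X P T μ E' r) (hY : DominatedProcess X P T μ Y D)
    (ε : ℝ) : Measurable fun q : ℝ × Ω => hInner μ (fun u => D u q.1 q.2) (win T d ε q.1) := by
  obtain ⟨θ, hθm, -, hθ⟩ := h.glue.exists_sign
  simp only [hInner, hθ]
  refine StronglyMeasurable.measurable (StronglyMeasurable.integral_prod_right'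
    (f := fun q : (ℝ × Ω) × (ℝ × ℝ) => D q.2.1 q.1.1 q.1.2 * win T d ε q.1.1 q.2.2 * θ q.2)
    (Measurable.stronglyMeasurable ?_))
  have h1 : Measurable fun q : (ℝ × Ω) × (ℝ × ℝ) => D q.2.1 q.1.1 q.1.2 :=
    hY.meas_deriv.comp (f := fun q : (ℝ × Ω) × (ℝ × ℝ) => (q.2.1, q.1.1, q.1.2)) (by fun_prop)
  exact (h1.mul ((measurable_win ε).comp
    (f := fun q : (ℝ × Ω) × (ℝ × ℝ) => (q.1.1, q.2.2)) (by fun_prop))).mul (hθm.comp measurable_snd)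

theorem measurable_wcorr (h : Setting X P T μ E' r) (hY : DominatedProcess X P T μ Y D)
    (ε : ℝ) : Measurable fun q : ℝ × Ω => wcorr X T μ d Y D ε q.1 q.2 := by
  simp only [wcorr_eq]
  exact (hY.meas.mul (h.measurable_incr d ε)).sub (hY.measurable_hInner_win h ε)

theorem ae_differentiableAt (hY : DominatedProcess X P T μ Y D) (ht : t ≤ T) :
    ∀ᵐ s ∂leb t, DifferentiableAt X P T μ Y D s :=
  ae_restrict_of_ae_restrict_of_subset (Icc_subset_Icc_right ht) hY.differentiableAt

theorem memLp_section (hY : DominatedProcess X P T μ Y D) (s : ℝ) : MemLp (Y s) 2 P := by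
  obtain ⟨S, hS, hle⟩ := hY.dom
  refine hS.mono (hY.meas.comp measurable_prodMk_left).aestronglyMeasurable
    (Eventually.of_forall fun ω => (hle s ω).trans (le_abs_self _))

theorem measurable_deriv_section (hY : DominatedProcess X P T μ Y D) (u : ℝ) (ω : Ω) :
    Measurable fun s => D u s ω :=
  hY.meas_deriv.comp (f := fun s : ℝ => (u, s, ω)) (by fun_prop)

/-- The isometry formula with equal windows bounds the second moment uniformly in `s`, in terms of
the square integrable dominating variables and the mass of `|μ|`. -/
theorem memLp_wcorr [IsProbabilityMeasure P] (h : Setting X P T μ E' r) (hY : DominatedProcess X P T μ Y D) (ht : t ≤ T)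
    {ε : ℝ} (hε : 0 ≤ ε) :
    MemLp (fun q : ℝ × Ω => wcorr X T μ d Y D ε q.1 q.2) 2 ((leb t).prod P) := by
  obtain ⟨S, hS, hleS⟩ := hY.dom
  obtain ⟨Z, hZ, hleZ⟩ := hY.dom_deriv
  set m := μ.variation.real univ
  refine memLp_two_prod_of_integral_sq_le (hY.measurable_wcorr h ε).aestronglyMeasurable
    (C := (∫ ω, S ω * S ω ∂P) * (1 * 1 * m) + ∫ ω, (Z ω * Z ω) * (m * m) ∂P) ?_
  filter_upwards [hY.ae_differentiableAt ht] with s hs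
  refine ⟨h.memLp_wcorr_section hs hε, ?_⟩
  rw [h.integral_wcorr_mul hs hs hε hε]
  have hm : 0 ≤ m := measureReal_nonneg
  refine add_le_add (mul_le_mul ?_ ((le_abs_self _).trans
    (Setting.abs_hInner_le (abs_win_le_one ε s) (abs_win_le_one ε s))) ?_ ?_) ?_
  · refine integral_mono ((hY.memLp_section s).integrable_mul (hY.memLp_section s))
      (hS.integrable_mul hS) fun ω => ?_
    rw [← abs_mul_abs_self]
    exact mul_self_le_mul_self (abs_nonneg _) (hleS s ω)
  · exact h.hInner_self_nonneg (Setting.memL_win d ε s)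
  · exact integral_nonneg fun ω => mul_self_nonneg _
  · refine integral_mono_of_nonneg (Eventually.of_forall fun ω => mul_self_nonneg _)
      ((hZ.integrable_mul hZ).mul_const _) (Eventually.of_forall fun ω => ?_)
    have hb := Setting.abs_hInner_le (μ := μ) (fun u => hleZ u s ω) (abs_win_le_one (T := T) (d := d) ε s)
    have hZ0 : 0 ≤ Z ω := (abs_nonneg _).trans (hleZ 0 0 ω)
    calc _ = |hInner μ (fun u => D u s ω) (win T d ε s)| *
          |hInner μ (fun u => D u s ω) (win T d ε s)| := (abs_mul_abs_self _).symm
      _ ≤ (Z ω * 1 * m) * (Z ω * 1 * m) := mul_self_le_mul_self (abs_nonneg _) hb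
      _ = _ := by ring

/-- The integral `ε⁻¹ ∫₀ᵗ wcorr ds`. -/
def regCorr (X : ℝ → Ω → ℝ) (T : ℝ) (μ : SignedMeasure (ℝ × ℝ)) (d t : ℝ) (Y : ℝ → Ω → ℝ)
    (D : ℝ → ℝ → Ω → ℝ) (ε : ℝ) (ω : Ω) : ℝ :=
  ε⁻¹ * ∫ s, wcorr X T μ d Y D ε s ω ∂leb t

theorem memLp_regCorr [IsProbabilityMeasure P] (h : Setting X P T μ E' r) (hY : DominatedProcess X P T μ Y D) (ht : t ≤ T)
    {ε : ℝ} (hε : 0 ≤ ε) : MemLp (regCorr X T μ d t Y D ε) 2 P :=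
  (memLp_integral_fst (hY.memLp_wcorr h ht hε)).const_mul _

/-! ### Lebesgue differentiation for the integrands of the isometry formula. -/

section Instances

theorem smearable_fst (h : Setting X P T μ E' r) (hY : DominatedProcess X P T μ Y D) :
    Smearable (P.prod μ.variation) T d t (fun q s => Y s q.1) (fun q => q.2.1) := by
  obtain ⟨S, hS, hle⟩ := hY.dom
  have hm : Measurable fun x : (Ω × (ℝ × ℝ)) × ℝ => Y x.2 x.1.1 :=
    hY.meas.comp (f := fun x : (Ω × (ℝ × ℝ)) × ℝ => (x.2, x.1.1)) (by fun_prop)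
  have hρ : Measurable fun q : Ω × (ℝ × ℝ) => q.2.1 := by fun_prop
  refine ⟨hm, hρ, ⟨fun q => S q.1, hS.comp_fst _, fun q s => hle s q.1⟩, fun e he => ?_⟩
  refine (Measure.ae_prod_iff_ae_ae (measurableSet_tendsto_smear hm hρ e)).2
    (Eventually.of_forall fun ω => ?_)
  filter_upwards [h.glue.qmp_fst.ae (tendsto_smear (d := d) (t := t)
    (hY.meas.comp measurable_prodMk_right : Measurable fun s => Y s ω) fun s => hle s ω)] with p hp
  exact hp.comp he

theorem smearable_snd (h : Setting X P T μ E' r) (hY : DominatedProcess X P T μ Y D) :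
    Smearable (P.prod μ.variation) T d t (fun q s => Y s q.1) (fun q => q.2.2) := by
  obtain ⟨S, hS, hle⟩ := hY.dom
  have hm : Measurable fun x : (Ω × (ℝ × ℝ)) × ℝ => Y x.2 x.1.1 :=
    hY.meas.comp (f := fun x : (Ω × (ℝ × ℝ)) × ℝ => (x.2, x.1.1)) (by fun_prop)
  have hρ : Measurable fun q : Ω × (ℝ × ℝ) => q.2.2 := by fun_prop
  refine ⟨hm, hρ, ⟨fun q => S q.1, hS.comp_fst _, fun q s => hle s q.1⟩, fun e he => ?_⟩
  refine (Measure.ae_prod_iff_ae_ae (measurableSet_tendsto_smear hm hρ e)).2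
    (Eventually.of_forall fun ω => ?_)
  filter_upwards [h.glue.qmp_snd.ae (tendsto_smear (d := d) (t := t)
    (hY.meas.comp measurable_prodMk_right : Measurable fun s => Y s ω) fun s => hle s ω)] with p hp
  exact hp.comp he

/-- The windows cross over in `⟨DY_s, 1_{s'}⟩⟨DY_{s'}, 1_s⟩`: with one copy of `μ` for each factor,
`s ↦ D_{p.1}Y_s` is averaged around the second coordinate of the other copy. Each derivative slice
is thus evaluated at a point independent of its first index, and the diagonal plays no role. -/
theorem smearable_deriv (h : Setting X P T μ E' r) (hY : DominatedProcess X P T μ Y D) :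
    Smearable (P.prod (μ.variation.prod μ.variation)) T d t (fun q s => D q.2.1.1 s q.1)
      (fun q => q.2.2.2) := by
  obtain ⟨Z, hZ, hle⟩ := hY.dom_deriv
  have hm : Measurable fun x : (Ω × ((ℝ × ℝ) × (ℝ × ℝ))) × ℝ => D x.1.2.1.1 x.2 x.1.1 :=
    hY.meas_deriv.comp (f := fun x : (Ω × ((ℝ × ℝ) × (ℝ × ℝ))) × ℝ => (x.1.2.1.1, x.2, x.1.1))
      (by fun_prop)
  have hρ : Measurable fun q : Ω × ((ℝ × ℝ) × (ℝ × ℝ)) => q.2.2.2 := by fun_prop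
  refine ⟨hm, hρ, ⟨fun q => Z q.1, hZ.comp_fst _, fun q s => hle _ s q.1⟩, fun e he => ?_⟩
  have hs := measurableSet_tendsto_smear (T := T) (d := d) (t := t)
    (g := fun (q : Ω × ((ℝ × ℝ) × (ℝ × ℝ))) s => D q.2.1.1 s q.1) hm hρ e
  refine (Measure.ae_prod_iff_ae_ae hs).2 (Eventually.of_forall fun ω => ?_)
  refine (Measure.ae_prod_iff_ae_ae (measurable_prodMk_left hs)).2
    (Eventually.of_forall fun p => ?_)
  filter_upwards [h.glue.qmp_snd.ae (tendsto_smear (d := d) (t := t)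
    (hY.measurable_deriv_section p.1 ω) fun s => hle p.1 s ω)] with q hq
  exact hq.comp he

theorem smearable_deriv_swap (h : Setting X P T μ E' r) (hY : DominatedProcess X P T μ Y D) :
    Smearable (P.prod (μ.variation.prod μ.variation)) T d t (fun q s => D q.2.2.1 s q.1)
      (fun q => q.2.1.2) := by
  obtain ⟨Z, hZ, hle⟩ := hY.dom_deriv
  have hm : Measurable fun x : (Ω × ((ℝ × ℝ) × (ℝ × ℝ))) × ℝ => D x.1.2.2.1 x.2 x.1.1 :=
    hY.meas_deriv.comp (f := fun x : (Ω × ((ℝ × ℝ) × (ℝ × ℝ))) × ℝ => (x.1.2.2.1, x.2, x.1.1))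
      (by fun_prop)
  have hρ : Measurable fun q : Ω × ((ℝ × ℝ) × (ℝ × ℝ)) => q.2.1.2 := by fun_prop
  refine ⟨hm, hρ, ⟨fun q => Z q.1, hZ.comp_fst _, fun q s => hle _ s q.1⟩, fun e he => ?_⟩
  have hs := measurableSet_tendsto_smear (T := T) (d := d) (t := t)
    (g := fun (q : Ω × ((ℝ × ℝ) × (ℝ × ℝ))) s => D q.2.2.1 s q.1) hm hρ e
  refine (Measure.ae_prod_iff_ae_ae hs).2 (Eventually.of_forall fun ω => ?_)
  have hs' := measurable_prodMk_left (x := ω) hs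
  -- The two copies of `μ` are exchanged so that the index of the derivative is fixed first and the
  -- evaluation point varies last.
  refine (Measure.ae_prod_iff_ae_ae hs').2 ((Measure.ae_ae_comm
    (p := fun p q : ℝ × ℝ => Tendsto (fun k => smear T d t (fun s => D q.1 s ω) p.2 (e k)) atTop
      (𝓝 ((Icc 0 t).indicator (fun s => D q.1 s ω) p.2))) hs').2
    (Eventually.of_forall fun p => ?_))
  filter_upwards [h.glue.qmp_snd.ae (tendsto_smear (d := d) (t := t)
    (hY.measurable_deriv_section p.1 ω) fun s => hle p.1 s ω)] with q hq
  exact hq.comp he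

end Instances

/-- The isometry formula with each `μ`-integral written against `|μ|` and a sign, so that all terms
are integrals over products with `Ω` and averaging in `s`, `s'` becomes a Fubini exchange. -/
theorem integral_wcorr_mul_eq [IsProbabilityMeasure P] (h : Setting X P T μ E' r) (hY : DominatedProcess X P T μ Y D)
    {θ : ℝ × ℝ → ℝ} (hθm : Measurable θ) (hθ1 : ∀ x, |θ x| = 1)
    (hθ : ∀ f : ℝ × ℝ → ℝ, ∫ᵛ x, f x ∂•μ = ∫ x, f x * θ x ∂μ.variation)
    {s s' : ℝ} (hs : DifferentiableAt X P T μ Y D s) (hs' : DifferentiableAt X P T μ Y D s')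
    {ε ε' : ℝ} (hε : 0 ≤ ε) (hε' : 0 ≤ ε') :
    ∫ ω, wcorr X T μ d Y D ε s ω * wcorr X T μ d Y D ε' s' ω ∂P =
      (∫ q, Y s q.1 * win T d ε s q.2.1 * (Y s' q.1 * win T d ε' s' q.2.2) * θ q.2
        ∂P.prod μ.variation) +
      ∫ q, D q.2.1.1 s q.1 * win T d ε s q.2.2.2 * (D q.2.2.1 s' q.1 * win T d ε' s' q.2.1.2)
        * (θ q.2.1 * θ q.2.2) ∂P.prod (μ.variation.prod μ.variation) := by
  rw [h.integral_wcorr_mul hs hs' hε hε', hInner, hθ]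
  congr 1
  · rw [← integral_prod_mul (fun ω => Y s ω * Y s' ω)]
    congr with q
    ring
  · have m2 : Measurable fun q : Ω × ((ℝ × ℝ) × (ℝ × ℝ)) => θ q.2.1 * θ q.2.2 :=
      (hθm.comp (measurable_fst.comp measurable_snd)).mul
        (hθm.comp (measurable_snd.comp measurable_snd))
    have i0 := ((hY.smearable_deriv (d := d) (t := T) h).memLp_section ε s
        (fun q => q.2.2.2) (by fun_prop)).integrable_mul
      ((hY.smearable_deriv_swap (d := d) (t := T) h).memLp_section ε' s'
        (fun q => q.2.1.2) (by fun_prop))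
    have hi := i0.mul_bdd (c := 1) m2.aestronglyMeasurable (Eventually.of_forall fun q => by
      rw [norm_mul, Real.norm_eq_abs, Real.norm_eq_abs, hθ1, hθ1, one_mul])
    refine Eq.trans ?_ (integral_prod _ hi).symm
    congr with ω
    rw [hInner, hInner, hθ, hθ, ← integral_prod_mul (fun p : ℝ × ℝ => D p.1 s ω * win T d ε' s' p.2 * θ p)]
    congr with q
    simp only [Pi.mul_apply]
    ring

/-- The regularized Skorohod integrals converge in `L²`. -/
theorem exists_tendsto_regCorr [IsProbabilityMeasure P] (h : Setting X P T μ E' r) (hY : DominatedProcess X P T μ Y D)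
    (ht : t ≤ T) : ∃ Z, MemLp Z 2 P ∧
      Tendsto (fun ε => eLpNorm (fun ω => regCorr X T μ d t Y D ε ω - Z ω) 2 P) (𝓝[>] 0) (𝓝 0) := by
  obtain ⟨θ, hθm, hθ1, hθ⟩ := h.glue.exists_sign
  have m1 : Measurable fun q : Ω × (ℝ × ℝ) => θ q.2 := hθm.comp measurable_snd
  have m2 : Measurable fun q : Ω × ((ℝ × ℝ) × (ℝ × ℝ)) => θ q.2.1 * θ q.2.2 :=
    (hθm.comp (measurable_fst.comp measurable_snd)).mul
      (hθm.comp (measurable_snd.comp measurable_snd))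
  have b1 : ∀ q : Ω × (ℝ × ℝ), |θ q.2| ≤ 1 := fun q => (hθ1 _).le
  have b2 : ∀ q : Ω × ((ℝ × ℝ) × (ℝ × ℝ)), |θ q.2.1 * θ q.2.2| ≤ 1 := fun q => by
    rw [abs_mul, hθ1, hθ1, one_mul]
  have s1 := hY.smearable_fst (d := d) (t := t) h
  have s2 := hY.smearable_snd (d := d) (t := t) h
  have s3 := hY.smearable_deriv (d := d) (t := t) h
  have s4 := hY.smearable_deriv_swap (d := d) (t := t) h
  -- The mixed moments at widths `ε` and `ε'` converge because both terms of the isometry formula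
  -- do. The corrected increments are square integrable only for `ε ≥ 0`, hence the eventual
  -- statement near `0` from the right.
  refine exists_memLp_of_tendsto_integral_mul (l := 𝓝[>] (0 : ℝ))
    (by filter_upwards [self_mem_nhdsWithin] with ε (hε : 0 < ε) using hY.memLp_regCorr h ht hε.le)
    (((s1.tendsto_integral_mul s2 m1 b1).add (s3.tendsto_integral_mul s4 m2 b2)).congr' ?_)
  filter_upwards [prod_mem_prod (self_mem_nhdsWithin (a := (0 : ℝ)) (s := Ioi 0))
    (self_mem_nhdsWithin (a := (0 : ℝ)) (s := Ioi 0))] with p hp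
  have hp1 : 0 ≤ p.1 := (mem_Ioi.1 hp.1).le
  have hp2 : 0 ≤ p.2 := (mem_Ioi.1 hp.2).le
  obtain ⟨i1, e1⟩ := s1.integral_mul s2 m1 b1 p.1 p.2
  obtain ⟨i2, e2⟩ := s3.integral_mul s4 m2 b2 p.1 p.2
  rw [← e1, ← e2, ← mul_add, ← integral_add i1 i2]
  have e3 := (integrable_integral_mul (hY.memLp_wcorr (d := d) h ht hp1)
    (hY.memLp_wcorr (d := d) h ht hp2) (κ := fun _ => 1) measurable_const (by simp)).2
  have e4 : ∫ x, (∫ q, Y x.1 q.1 * win T d p.1 x.1 q.2.1 * (Y x.2 q.1 * win T d p.2 x.2 q.2.2) * θ q.2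
        ∂P.prod μ.variation) +
      (∫ q, D q.2.1.1 x.1 q.1 * win T d p.1 x.1 q.2.2.2 *
        (D q.2.2.1 x.2 q.1 * win T d p.2 x.2 q.2.1.2)
        * (θ q.2.1 * θ q.2.2) ∂P.prod (μ.variation.prod μ.variation)) ∂(leb t).prod (leb t) =
      ∫ x, ∫ ω, wcorr X T μ d Y D p.1 x.1 ω * wcorr X T μ d Y D p.2 x.2 ω * 1 ∂P
        ∂(leb t).prod (leb t) := by
    refine integral_congr_ae ?_
    filter_upwards [Measure.quasiMeasurePreserving_fst.ae (hY.ae_differentiableAt ht),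
      Measure.quasiMeasurePreserving_snd.ae (hY.ae_differentiableAt ht)] with x hx1 hx2
    rw [← hY.integral_wcorr_mul_eq h hθm hθ1 hθ hx1 hx2 hp1 hp2]
    simp only [mul_one]
  rw [e4, e3, ← integral_const_mul]
  congr with ω
  simp only [regCorr]
  ring

end DominatedProcess

end CovMeasure

end

noncomputable section

namespace CovMeasure

variable {Ω : Type*} [MeasurableSpace Ω] {X : ℝ → Ω → ℝ} {P : Measure Ω} {T : ℝ}
  {μ : SignedMeasure (ℝ × ℝ)} {E' : ℝ → ℝ} {r : ℝ × ℝ → ℝ} {Y : ℝ → Ω → ℝ} {D : ℝ → ℝ → Ω → ℝ}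
  {d t : ℝ}

/-! ### The limit is a Skorohod integral -/

namespace Cyl

/-- The partial derivatives of `G.f` are bounded, and each `|φᵢ(p.1)|` is `|μ|`-integrable because
it is the product of an element of `L_μ` with the constant `1`. The bound is deterministic, so it
multiplies well with the random bound of `Y`. -/
theorem exists_bound_deriv (h : Setting X P T μ E' r) (G : Cyl X P T μ) :
    ∃ κ : ℝ × ℝ → ℝ, Integrable κ μ.variation ∧ ∀ p ω, |G.deriv p.1 ω| ≤ κ p := by
  choose C hC using fun i => G.bddC1.exists_bound_fderiv (Pi.single i 1)
  refine ⟨fun p => ∑ i, C i * |G.φ i p.1|, integrable_finsetSum _ fun i _ => ?_, fun p ω => ?_⟩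
  · have := h.integrable_mul (G.φ_mem i).abs (memL_of_abs_le (μ := μ) (φ := fun _ => 1)
      measurable_const (M := 1) (by simp))
    simp only [mul_one] at this
    exact this.const_mul _
  · refine (Finset.abs_sum_le_sum_abs _ _).trans (Finset.sum_le_sum fun i _ => ?_)
    rw [abs_mul]
    exact mul_le_mul_of_nonneg_right (hC i _) (abs_nonneg _)

theorem aestronglyMeasurable_deriv [SFinite P] (G : Cyl X P T μ) (m : Measure (ℝ × ℝ)) [SFinite m] :
    AEStronglyMeasurable (fun q : Ω × (ℝ × ℝ) => G.deriv q.2.1 q.1) (P.prod m) := by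
  simp only [Cyl.deriv]
  refine Finset.aestronglyMeasurable_fun_sum _ fun i _ => AEStronglyMeasurable.mul ?_ ?_
  · have : AEMeasurable (fun ω => fderiv ℝ G.f (G.vec ω) (Pi.single i 1)) P :=
      (G.bddC1.continuous_fderiv_apply _).measurable.comp_aemeasurable G.aemeasurable_vec
    exact this.aestronglyMeasurable.comp_fst
  · exact ((G.φ_mem i).1.comp (measurable_fst.comp measurable_snd)).aestronglyMeasurable

end Cyl

namespace DominatedProcess

variable [IsProbabilityMeasure P]

/-- The duality formula holds window by window for almost every `s`; averaging over `s` transfers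
the windows to `Y` as a regularization. -/
theorem integral_val_mul_regCorr (h : Setting X P T μ E' r) (hY : DominatedProcess X P T μ Y D)
    (ht : t ≤ T) (G : Cyl X P T μ) {θ : ℝ × ℝ → ℝ} (hθm : Measurable θ) (hθ1 : ∀ x, |θ x| = 1)
    (hθ : ∀ f : ℝ × ℝ → ℝ, ∫ᵛ x, f x ∂•μ = ∫ x, f x * θ x ∂μ.variation) {ε : ℝ} (hε : 0 ≤ ε) :
    ∫ ω, G.val ω * regCorr X T μ d t Y D ε ω ∂P =
      ∫ q, smear T d t (fun s => Y s q.1) q.2.2 ε * (G.deriv q.2.1 q.1 * θ q.2)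
        ∂P.prod μ.variation := by
  obtain ⟨S, hS, hle⟩ := hY.dom
  obtain ⟨κ, hκ, hκle⟩ := G.exists_bound_deriv h
  have hK : AEStronglyMeasurable (fun q : Ω × (ℝ × ℝ) => G.deriv q.2.1 q.1 * θ q.2)
      (P.prod μ.variation) :=
    (G.aestronglyMeasurable_deriv _).mul (hθm.comp measurable_snd).aestronglyMeasurable
  have hB : Integrable (fun q : Ω × (ℝ × ℝ) => S q.1 * κ q.2) (P.prod μ.variation) :=
    (hS.integrable (by norm_num)).mul_prod hκ
  have hm : Measurable fun x : (Ω × (ℝ × ℝ)) × ℝ => Y x.2 x.1.1 :=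
    hY.meas.comp (f := fun x : (Ω × (ℝ × ℝ)) × ℝ => (x.2, x.1.1)) (by fun_prop)
  have hbd : ∀ (q : Ω × (ℝ × ℝ)) (s : ℝ),
      |Y s q.1| * |G.deriv q.2.1 q.1 * θ q.2| ≤ S q.1 * κ q.2 := fun q s => by
    rw [abs_mul (G.deriv _ _), hθ1, mul_one]
    exact mul_le_mul (hle _ _) (hκle _ _) (abs_nonneg _) ((abs_nonneg _).trans (hle s q.1))
  rw [← integral_smear_mul hm (ρ := fun q : Ω × (ℝ × ℝ) => q.2.2) (by fun_prop) hK hB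
    (Eventually.of_forall hbd) ε]
  have hint : Integrable (fun q : ℝ × Ω => G.val q.2 * wcorr X T μ d Y D ε q.1 q.2)
      ((leb t).prod P) :=
    ((Setting.memLp_val G).comp_snd (leb t)).integrable_mul (hY.memLp_wcorr h ht hε)
  have e1 : ∀ ω, G.val ω * regCorr X T μ d t Y D ε ω
      = ε⁻¹ * ∫ s, G.val ω * wcorr X T μ d Y D ε s ω ∂leb t := fun ω => by
    rw [integral_const_mul, regCorr]; ring
  simp only [e1]
  rw [integral_const_mul,
    ← integral_integral_swap (f := fun s ω => G.val ω * wcorr X T μ d Y D ε s ω) hint]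
  congr 1
  refine integral_congr_ae ?_
  filter_upwards [hY.ae_differentiableAt ht] with s hs
  rw [h.integral_val_mul_wcorr hs hε]
  have hi : Integrable (fun q : Ω × (ℝ × ℝ) => Y s q.1 * win T d ε s q.2.2 *
      (G.deriv q.2.1 q.1 * θ q.2)) (P.prod μ.variation) := by
    refine hB.mono' (AEStronglyMeasurable.mul (Measurable.aestronglyMeasurable ?_) hK)
      (Eventually.of_forall fun q => ?_)
    · exact (hY.meas.comp (f := fun q : Ω × (ℝ × ℝ) => (s, q.1)) (by fun_prop)).mul
        ((measurable_win ε).comp (f := fun q : Ω × (ℝ × ℝ) => (s, q.2.2)) (by fun_prop))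
    · rw [norm_mul, norm_mul, Real.norm_eq_abs, Real.norm_eq_abs, Real.norm_eq_abs, mul_right_comm]
      exact (mul_le_of_le_one_right (by positivity) (abs_win_le_one _ _ _)).trans (hbd q s)
  rw [integral_prod _ hi]
  congr with ω
  rw [Cyl.dir, hInner, hθ, ← integral_const_mul]
  congr with p
  ring

/-- Along a sequence of widths the left-hand side converges by `L²` convergence, and the regularized
right-hand side by Lebesgue differentiation with the bound `S(ω) κ(p)`. -/
theorem integral_val_mul_eq (h : Setting X P T μ E' r) (hY : DominatedProcess X P T μ Y D)
    (ht : t ≤ T) {Z : Ω → ℝ} (hZ : MemLp Z 2 P)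
    (hlim : Tendsto (fun ε => eLpNorm (fun ω => regCorr X T μ d t Y D ε ω - Z ω) 2 P)
      (𝓝[>] 0) (𝓝 0)) (G : Cyl X P T μ) :
    ∫ ω, G.val ω * Z ω ∂P = ∫ ω, hInner μ (fun s => G.deriv s ω)
      ((Icc 0 t).indicator fun s => Y s ω) ∂P := by
  obtain ⟨θ, hθm, hθ1, hθ⟩ := h.glue.exists_sign
  obtain ⟨S, hS, hle⟩ := hY.dom
  obtain ⟨κ, hκ, hκle⟩ := G.exists_bound_deriv h
  obtain ⟨e, he⟩ := exists_seq_tendsto (𝓝[>] (0 : ℝ))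
  have he0 : ∀ᶠ k in atTop, 0 < e k := he self_mem_nhdsWithin
  have hK : AEStronglyMeasurable (fun q : Ω × (ℝ × ℝ) => G.deriv q.2.1 q.1 * θ q.2)
      (P.prod μ.variation) :=
    (G.aestronglyMeasurable_deriv _).mul (hθm.comp measurable_snd).aestronglyMeasurable
  have hB : Integrable (fun q : Ω × (ℝ × ℝ) => S q.1 * κ q.2) (P.prod μ.variation) :=
    (hS.integrable (by norm_num)).mul_prod hκ
  have sm := hY.smearable_snd (d := d) (t := t) h
  have hbd : ∀ (q : Ω × (ℝ × ℝ)) (x : ℝ), |x| ≤ S q.1 →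
      ‖x * (G.deriv q.2.1 q.1 * θ q.2)‖ ≤ S q.1 * κ q.2 := fun q x hx => by
    rw [Real.norm_eq_abs, abs_mul, abs_mul, hθ1, mul_one]
    exact mul_le_mul hx (hκle _ _) (abs_nonneg _) ((abs_nonneg _).trans (hle 0 q.1))
  have l1 := tendsto_integral_mul_of_tendsto_eLpNorm (l := atTop) (f := fun _ : ℕ => G.val)
    (Eventually.of_forall fun _ => Setting.memLp_val G)
    (he0.mono fun k hk => hY.memLp_regCorr (d := d) h ht hk.le) (Setting.memLp_val G) hZ (by simp)
    (hlim.comp he)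
  have l2 : Tendsto (fun k => ∫ q, smear T d t (fun s => Y s q.1) q.2.2 (e k) *
      (G.deriv q.2.1 q.1 * θ q.2) ∂P.prod μ.variation) atTop
      (𝓝 (∫ q, (Icc 0 t).indicator (fun s => Y s q.1) q.2.2 *
      (G.deriv q.2.1 q.1 * θ q.2) ∂P.prod μ.variation)) := by
    refine tendsto_integral_filter_of_dominated_convergence (fun q => S q.1 * κ q.2)
      (Eventually.of_forall fun k => ?_) ?_ hB ?_
    · exact (measurable_smear_param sm.meas sm.meas_pt _).aestronglyMeasurable.mul hK
    · filter_upwards [he0] with k hk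
      exact Eventually.of_forall fun q => hbd q _ (abs_smear_le (fun s => hle s q.1) hk _)
    · filter_upwards [sm.conv e he] with q hq
      exact hq.mul_const _
  have hi : Integrable (fun q : Ω × (ℝ × ℝ) => (Icc 0 t).indicator (fun s => Y s q.1) q.2.2 *
      (G.deriv q.2.1 q.1 * θ q.2)) (P.prod μ.variation) := by
    refine hB.mono' ((measurable_indicator_param sm.meas sm.meas_pt).aestronglyMeasurable.mul hK)
      (Eventually.of_forall fun q => hbd q _ ?_)
    by_cases hq : q.2.2 ∈ Icc 0 t
    · rw [indicator_of_mem hq]; exact hle _ _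
    · rw [indicator_of_notMem hq, abs_zero]; exact (abs_nonneg _).trans (hle 0 q.1)
  rw [integral_prod _ hi] at l2
  refine (tendsto_nhds_unique (l1.congr' ?_) l2).trans ?_
  · filter_upwards [he0] with k hk
    exact hY.integral_val_mul_regCorr h ht G hθm hθ1 hθ hk.le
  · congr with ω
    rw [hInner, hθ]
    congr with p
    ring

theorem isSkorohodIntegral (h : Setting X P T μ E' r) (hY : DominatedProcess X P T μ Y D)
    (ht : t ≤ T) {Z : Ω → ℝ} (hZ : MemLp Z 2 P)
    (hlim : Tendsto (fun ε => eLpNorm (fun ω => regCorr X T μ d t Y D ε ω - Z ω) 2 P)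
      (𝓝[>] 0) (𝓝 0)) {u : ℝ → Ω → ℝ} (hu : Measurable fun q : ℝ × Ω => u q.1 q.2)
    (huY : ∀ᵐ ω ∂P, ∀ s ∈ Icc 0 T, u s ω = (Icc 0 t).indicator (fun s => Y s ω) s) :
    IsSkorohodIntegral X P T μ u Z := by
  have hdual : ∀ F : Cyl X P T μ,
      ∫ ω, F.val ω * Z ω ∂P = ∫ ω, hInner μ (fun s => F.deriv s ω) (fun s => u s ω) ∂P := by
    intro F
    rw [hY.integral_val_mul_eq h ht hZ hlim F]
    refine integral_congr_ae ?_
    obtain ⟨θ, -, -, hθ⟩ := h.glue.exists_sign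
    filter_upwards [huY] with ω hω
    rw [hInner, hInner, hθ, hθ]
    refine integral_congr_ae ?_
    filter_upwards [h.glue.qmp_snd.ae (ae_restrict_mem measurableSet_Icc)] with p hp
    rw [hω _ hp]
  refine ⟨hu, ?_, hZ, ?_, hdual⟩
  · obtain ⟨S, hS, hle⟩ := hY.dom
    have hfin : ∫⁻ ω, ‖S ω‖ₑ ^ 2 * μ.variation univ ∂P < ∞ := by
      rw [lintegral_mul_const' _ _ (measure_ne_top _ _)]
      refine ENNReal.mul_lt_top ?_ (measure_lt_top _ _)
      have := hS.integrable_sq.2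
      simpa only [HasFiniteIntegral, enorm_pow] using this
    refine lt_of_le_of_lt (lintegral_mono_ae ?_) hfin
    filter_upwards [huY] with ω hω
    rw [absNormSq, ← lintegral_const]
    have hbd : ∀ s ∈ Icc 0 T, ‖u s ω‖ₑ ≤ ‖S ω‖ₑ := fun s hs => by
      rw [hω s hs, ← ofReal_norm, ← ofReal_norm]
      refine ENNReal.ofReal_le_ofReal ?_
      by_cases hq : s ∈ Icc 0 t
      · rw [indicator_of_mem hq]; exact (hle _ _).trans (le_abs_self _)
      · rw [indicator_of_notMem hq, norm_zero]; exact norm_nonneg _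
    refine lintegral_mono_ae ?_
    filter_upwards [h.glue.qmp_fst.ae (ae_restrict_mem measurableSet_Icc),
      h.glue.qmp_snd.ae (ae_restrict_mem measurableSet_Icc)] with p h1 h2
    rw [sq]
    exact mul_le_mul' (hbd _ h1) (hbd _ h2)
  -- The mean is the duality formula tested with the constant `1`, whose derivative is zero.
  · have := hdual (Cyl.one X P T μ)
    simp only [Cyl.one_val, Cyl.one_deriv, one_mul] at this
    rw [this]
    simp [hInner]

/-! ### The trace term -/

omit [IsProbabilityMeasure P] in
-- The pathwise splitting into the corrected integral and the trace term. The latter is the average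
-- of `⟨DY_s, 1_window⟩_H`, rewritten by Fubini as the `μ`-integral of the regularization of `s ↦
-- D_{p.1}Y_s` at `p.2`.
theorem inv_mul_integral_eq (h : Setting X P T μ E' r) (hY : DominatedProcess X P T μ Y D)
    {θ : ℝ × ℝ → ℝ} (hθm : Measurable θ) (hθ1 : ∀ x, |θ x| = 1)
    (hθ : ∀ f : ℝ × ℝ → ℝ, ∫ᵛ x, f x ∂•μ = ∫ x, f x * θ x ∂μ.variation) (ε : ℝ) (ω : Ω) :
    ε⁻¹ * ∫ s, Y s ω * incr X T d ε s ω ∂leb t = regCorr X T μ d t Y D ε ω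
      + ∫ p, smear T d t (fun s => D p.1 s ω) p.2 ε * θ p ∂μ.variation := by
  obtain ⟨S, hS, hleS⟩ := hY.dom
  obtain ⟨Z, hZ, hleZ⟩ := hY.dom_deriv
  have hcl : Continuous fun s => X (clamp T s) ω :=
    (h.cont ω).comp_continuous continuous_clamp fun s => clamp_mem h.pos.le s
  have hc : Continuous fun s => incr X T d ε s ω :=
    (hcl.comp (f := fun s => s + (1 - d) * ε) (by fun_prop)).sub
      (hcl.comp (f := fun s => s - d * ε) (by fun_prop))
  have i1 : Integrable (fun s => Y s ω * incr X T d ε s ω) (leb t) :=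
    Integrable.bdd_mul (hc.continuousOn.integrableOn_compact isCompact_Icc)
      (hY.meas.comp measurable_prodMk_right).aestronglyMeasurable
      (Eventually.of_forall fun s => hleS s ω)
  have i2 : Integrable (fun s => hInner μ (fun u => D u s ω) (win T d ε s)) (leb t) :=
    (integrable_const (Z ω * 1 * μ.variation.real univ)).mono'
      ((hY.measurable_hInner_win h ε).comp measurable_prodMk_right).aestronglyMeasurable
      (Eventually.of_forall fun s =>
        Setting.abs_hInner_le (fun u => hleZ u s ω) (abs_win_le_one ε s))
  have hm : Measurable fun x : (ℝ × ℝ) × ℝ => D x.1.1 x.2 ω :=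
    hY.meas_deriv.comp (f := fun x : (ℝ × ℝ) × ℝ => (x.1.1, x.2, ω)) (by fun_prop)
  rw [← integral_smear_mul hm (ρ := Prod.snd) measurable_snd hθm.aestronglyMeasurable
    (integrable_const (Z ω)) (Eventually.of_forall fun p s => by
      rw [hθ1, mul_one]; exact hleZ _ _ _) ε, regCorr, ← mul_add]
  simp only [wcorr_eq]
  rw [integral_sub i1 i2]
  simp only [hInner, hθ, sub_add_cancel]

end DominatedProcess

end CovMeasure

end

noncomputable section

namespace CovMeasure

variable {Ω : Type*} [MeasurableSpace Ω] {X : ℝ → Ω → ℝ} {P : Measure Ω} {T : ℝ}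
  {μ : SignedMeasure (ℝ × ℝ)} {E' : ℝ → ℝ} {r : ℝ × ℝ → ℝ} {Y : ℝ → Ω → ℝ} {D : ℝ → ℝ → Ω → ℝ}
  {d t : ℝ}

/-! ### Traces -/

/-- The limit of the means of `D u · ω` over windows at `s` exists. -/
def HasTrace (d : ℝ) (D : ℝ → ℝ → Ω → ℝ) (u s : ℝ) (ω : Ω) : Prop :=
  ∃ l, Tendsto (slideMean d (fun s => D u s ω) s) (𝓝[>] 0) (𝓝 l)

/-- The limit of the means of `D u · ω` over windows at `s`. -/
def trace (d : ℝ) (D : ℝ → ℝ → Ω → ℝ) (u s : ℝ) (ω : Ω) : ℝ :=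
  limUnder (𝓝[>] (0 : ℝ)) (slideMean d (fun s => D u s ω) s)

omit [MeasurableSpace Ω] in
theorem HasTrace.tendsto {u s : ℝ} {ω : Ω} (h : HasTrace d D u s ω) :
    Tendsto (slideMean d (fun s => D u s ω) s) (𝓝[>] 0) (𝓝 (trace d D u s ω)) :=
  tendsto_nhds_limUnder h

theorem slideMean_eventuallyEq (hd : d ∈ Icc (0 : ℝ) 1) {g g' : ℝ → ℝ}
    (h : ∀ᵐ s ∂leb T, g s = g' s) {x : ℝ} (hx : x ∈ Ioo 0 T) :
    slideMean d g x =ᶠ[𝓝[>] 0] slideMean d g' x := by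
  have hδ : 0 < min x (T - x) := lt_min hx.1 (sub_pos.2 hx.2)
  filter_upwards [Ioo_mem_nhdsGT hδ] with ε hε
  have h1 : ε < x := hε.2.trans_le (min_le_left _ _)
  have h2 : ε < T - x := hε.2.trans_le (min_le_right _ _)
  rw [slideMean, slideMean]
  congr 1
  refine intervalIntegral.integral_congr_ae ?_
  filter_upwards [(ae_restrict_iff' measurableSet_Icc).1 h] with s hs hmem
  rw [uIoc_of_le (window_le ε x hε.1.le)] at hmem
  have hε0 := hε.1.le
  refine hs ⟨?_, ?_⟩
  · nlinarith [hmem.1, hd.1, hd.2]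
  · nlinarith [hmem.2, hd.1, hd.2]

theorem ae_mem_Ioo (T : ℝ) : ∀ᵐ s ∂leb T, s ∈ Ioo 0 T := by
  rw [leb, ← restrict_Ioo_eq_restrict_Icc]
  exact ae_restrict_mem measurableSet_Ioo

omit [MeasurableSpace Ω] in
-- A trace depends on the slice `D u ·` only up to null sets of `[0,T]`. The endpoints are excluded
-- because windows around them leave `[0,T]`, where nothing is known.
theorem hasTrace_iff_and_trace_eq (hd : d ∈ Icc (0 : ℝ) 1) {D D' : ℝ → ℝ → Ω → ℝ} {u s : ℝ} {ω : Ω}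
    (h : ∀ᵐ s ∂leb T, D u s ω = D' u s ω) (hs : s ∈ Ioo 0 T) :
    (HasTrace d D u s ω ↔ HasTrace d D' u s ω) ∧ trace d D u s ω = trace d D' u s ω := by
  have he := slideMean_eventuallyEq hd h hs
  refine ⟨exists_congr fun l => tendsto_congr' he, ?_⟩
  rw [trace, trace, limUnder, limUnder, Filter.map_congr he]

namespace DominatedProcess

theorem locallyIntegrable_section (hY : DominatedProcess X P T μ Y D) (u : ℝ) (ω : Ω) :
    LocallyIntegrable fun s => D u s ω := by
  obtain ⟨Z, -, hle⟩ := hY.dom_deriv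
  exact locallyIntegrable_of_abs_le (hY.measurable_deriv_section u ω) fun s => hle u s ω

theorem measurableSet_hasTrace (hY : DominatedProcess X P T μ Y D) (d : ℝ) :
    MeasurableSet {q : (ℝ × ℝ) × Ω | HasTrace d D q.1.1 q.1.2 q.2} :=
  measurableSet_exists_tendsto_slideMean
    (g := fun (q : (ℝ × ℝ) × Ω) s => D q.1.1 s q.2) (ρ := fun q => q.1.2)
    (hY.meas_deriv.comp (f := fun x : ((ℝ × ℝ) × Ω) × ℝ => (x.1.1.1, x.2, x.1.2)) (by fun_prop))
    (by fun_prop) fun q => hY.locallyIntegrable_section q.1.1 q.2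

/-- Lebesgue's theorem on each slice `D u ·`, followed by Fubini. The conclusion is silent on the
diagonal, which is null for area but may carry mass of `μ`. -/
theorem ae_hasTrace_offDiag (hY : DominatedProcess X P T μ Y D) (ω : Ω) :
    ∀ᵐ p ∂(leb T).prod (leb T), HasTrace d D p.1 p.2 ω ∧ trace d D p.1 p.2 ω = D p.1 p.2 ω := by
  have hm : Measurable fun x : (ℝ × ℝ) × ℝ => D x.1.1 x.2 ω :=
    hY.meas_deriv.comp (f := fun x : (ℝ × ℝ) × ℝ => (x.1.1, x.2, ω)) (by fun_prop)
  have hm' : Measurable fun p : ℝ × ℝ => D p.1 p.2 ω :=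
    hY.meas_deriv.comp (f := fun p : ℝ × ℝ => (p.1, p.2, ω)) (by fun_prop)
  obtain ⟨e, he⟩ := exists_seq_tendsto (𝓝[>] (0 : ℝ))
  have key : ∀ u, ∀ᵐ s ∂leb T,
      Tendsto (slideMean d (fun s => D u s ω) s) (𝓝[>] 0) (𝓝 (D u s ω)) := fun u =>
    ae_restrict_of_ae (tendsto_slideMean (hY.locallyIntegrable_section u ω))
  have h1 : ∀ᵐ p ∂(leb T).prod (leb T), HasTrace d D p.1 p.2 ω := by
    refine (Measure.ae_prod_iff_ae_ae (measurable_prodMk_right (hY.measurableSet_hasTrace d))).2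
      (Eventually.of_forall fun u => ?_)
    filter_upwards [key u] with s hs using ⟨_, hs⟩
  have h2 : ∀ᵐ p ∂(leb T).prod (leb T),
      Tendsto (fun k => slideMean d (fun s => D p.1 s ω) p.2 (e k)) atTop (𝓝 (D p.1 p.2 ω)) := by
    refine (Measure.ae_prod_iff_ae_ae (measurableSet_tendsto_fun (fun k =>
      measurable_slideMean_param (g := fun (p : ℝ × ℝ) s => D p.1 s ω) hm measurable_snd (e k))
      hm')).2 (Eventually.of_forall fun u => ?_)
    filter_upwards [key u] with s hs using hs.comp he
  filter_upwards [h1, h2] with p k1 k2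
  exact ⟨k1, tendsto_nhds_unique (k1.tendsto.comp he) k2⟩

/-- On the diagonal the existence of traces is the hypothesis; off the diagonal it follows from
Lebesgue differentiation. Together the two exhaust `|μ|`. -/
theorem ae_ae_hasTrace [SFinite P] (h : Setting X P T μ E' r) (hY : DominatedProcess X P T μ Y D)
    (hdiag : ∀ᵐ s ∂leb T, ∀ᵐ ω ∂P, HasTrace d D s s ω) :
    ∀ᵐ p ∂μ.variation, ∀ᵐ ω ∂P, HasTrace d D p.1 p.2 ω :=
  h.glue.ae_variation hdiag ((Measure.ae_ae_comm (p := fun (p : ℝ × ℝ) ω => HasTrace d D p.1 p.2 ω)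
    (hY.measurableSet_hasTrace d)).2
    (Eventually.of_forall fun ω => (hY.ae_hasTrace_offDiag ω).mono fun _ hp => hp.1))

theorem ae_ae_hasTrace' [SFinite P] (h : Setting X P T μ E' r) (hY : DominatedProcess X P T μ Y D)
    (hdiag : ∀ᵐ s ∂leb T, ∀ᵐ ω ∂P, HasTrace d D s s ω) :
    ∀ᵐ ω ∂P, ∀ᵐ p ∂μ.variation, HasTrace d D p.1 p.2 ω :=
  (Measure.ae_ae_comm (p := fun (p : ℝ × ℝ) ω => HasTrace d D p.1 p.2 ω)
    (hY.measurableSet_hasTrace d)).1 (hY.ae_ae_hasTrace h hdiag)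

theorem integrable_trace (hY : DominatedProcess X P T μ Y D) {ω : Ω}
    (htr : ∀ᵐ p ∂μ.variation, HasTrace d D p.1 p.2 ω) :
    Integrable (fun p : ℝ × ℝ => trace d D p.1 p.2 ω) μ.variation := by
  obtain ⟨Z, -, hle⟩ := hY.dom_deriv
  have hm : Measurable fun x : (ℝ × ℝ) × ℝ => D x.1.1 x.2 ω :=
    hY.meas_deriv.comp (f := fun x : (ℝ × ℝ) × ℝ => (x.1.1, x.2, ω)) (by fun_prop)
  refine (integrable_const (Z ω)).mono' (aestronglyMeasurable_of_tendsto_ae (𝓝[>] (0 : ℝ))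
    (fun ε => (measurable_slideMean_param (g := fun (p : ℝ × ℝ) s => D p.1 s ω) hm measurable_snd
      ε).aestronglyMeasurable) (htr.mono fun p hp => hp.tendsto)) ?_
  filter_upwards [htr] with p hp
  refine le_of_tendsto hp.tendsto.norm ?_
  filter_upwards [self_mem_nhdsWithin] with ε hε
  exact abs_slideMean_le (fun s => hle _ s ω) hε _

/-- Dominated convergence for a fixed `ω`. Points with second coordinate `0`, `T` or `t` are
discarded, as the second marginal of `|μ|` has no atoms; elsewhere the cut at `t` does not interfere
with small windows. -/
theorem tendsto_integral_smear (h : Setting X P T μ E' r) (hY : DominatedProcess X P T μ Y D)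
    (hd : d ∈ Icc (0 : ℝ) 1) {θ : ℝ × ℝ → ℝ} (hθm : Measurable θ) (hθ1 : ∀ x, |θ x| = 1)
    (hθ : ∀ f : ℝ × ℝ → ℝ, ∫ᵛ x, f x ∂•μ = ∫ x, f x * θ x ∂μ.variation) {ω : Ω}
    (htr : ∀ᵐ p ∂μ.variation, HasTrace d D p.1 p.2 ω) :
    Tendsto (fun ε => ∫ p, smear T d t (fun s => D p.1 s ω) p.2 ε * θ p ∂μ.variation) (𝓝[>] 0)
      (𝓝 (∫ᵛ p in Icc 0 T ×ˢ Icc 0 t, trace d D p.1 p.2 ω ∂•μ)) := by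
  obtain ⟨Z, -, hle⟩ := hY.dom_deriv
  have hm : Measurable fun x : (ℝ × ℝ) × ℝ => D x.1.1 x.2 ω :=
    hY.meas_deriv.comp (f := fun x : (ℝ × ℝ) × ℝ => (x.1.1, x.2, ω)) (by fun_prop)
  rw [← VectorMeasure.integral_indicator (measurableSet_Icc.prod measurableSet_Icc), hθ]
  refine tendsto_integral_filter_of_dominated_convergence (fun _ => Z ω)
    (Eventually.of_forall fun ε => ?_) ?_ (integrable_const _) ?_
  · exact ((measurable_smear_param (g := fun (p : ℝ × ℝ) s => D p.1 s ω) hm measurable_snd ε).mul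
      hθm).aestronglyMeasurable
  · filter_upwards [self_mem_nhdsWithin] with ε hε
    refine Eventually.of_forall fun p => ?_
    rw [norm_mul, Real.norm_eq_abs, Real.norm_eq_abs, hθ1, mul_one]
    exact abs_smear_le (fun s => hle _ s ω) hε _
  · filter_upwards [htr, h.glue.qmp_fst.ae (ae_mem_Ioo T), h.glue.qmp_snd.ae (ae_mem_Ioo T),
      h.glue.qmp_snd.ae (ae_restrict_of_ae (Measure.ae_ne volume t))] with p h1 h2 h3 h4
    refine Tendsto.mul_const _ (Tendsto.congr' (smear_eventuallyEq hd _ ⟨h3.1, h3.2.le⟩ h4).symm ?_)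
    by_cases hp : p.2 ∈ Icc 0 t
    · rw [indicator_of_mem (show p ∈ Icc 0 T ×ˢ Icc 0 t from ⟨⟨h2.1.le, h2.2.le⟩, hp⟩)]
      simpa only [indicator_of_mem hp] using h1.tendsto
    · rw [indicator_of_notMem (fun hq => hp hq.2)]
      simp only [indicator_of_notMem hp]
      exact tendsto_const_nhds

end DominatedProcess

/-! ### Convergence in probability -/

/-- For a countably generated filter it is enough to argue along sequences. -/
theorem tendstoInMeasure_of_ae {ι : Type*} {l : Filter ι} [l.IsCountablyGenerated]
    [IsFiniteMeasure P] {f : ι → Ω → ℝ} {g : Ω → ℝ} (hf : ∀ i, AEStronglyMeasurable (f i) P)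
    (h : ∀ᵐ ω ∂P, Tendsto (fun i => f i ω) l (𝓝 (g ω))) : TendstoInMeasure P f l g := by
  intro η hη
  refine tendsto_of_seq_tendsto fun e he => ?_
  exact tendstoInMeasure_of_tendsto_ae (f := fun k => f (e k)) (fun k => hf _)
    (h.mono fun ω hω => hω.comp he) η hη

theorem TendstoInMeasure.fun_add {ι : Type*} {l : Filter ι} {f f' : ι → Ω → ℝ} {g g' : Ω → ℝ}
    (h : TendstoInMeasure P f l g) (h' : TendstoInMeasure P f' l g') :
    TendstoInMeasure P (fun i ω => f i ω + f' i ω) l fun ω => g ω + g' ω := by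
  rw [tendstoInMeasure_iff_dist] at *
  intro η hη
  have h0 := (h (η / 2) (by positivity)).add (h' (η / 2) (by positivity))
  rw [add_zero] at h0
  refine tendsto_of_tendsto_of_tendsto_of_le_of_le tendsto_const_nhds h0 (fun _ => zero_le)
    fun i => (measure_mono fun ω hω => ?_).trans (measure_union_le _ _)
  by_contra hc
  simp only [mem_union, mem_ofPred_eq, not_or, not_le] at hc hω
  have := dist_add_add_le (f i ω) (f' i ω) (g ω) (g' ω)
  linarith [hc.1, hc.2]

end CovMeasure

end

noncomputable section

namespace CovMeasure

variable {Ω : Type*} [MeasurableSpace Ω] {X : ℝ → Ω → ℝ} {P : Measure Ω} {T : ℝ}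
  {μ : SignedMeasure (ℝ × ℝ)} {E' : ℝ → ℝ} {r : ℝ × ℝ → ℝ} {Y : ℝ → Ω → ℝ} {DY : ℝ → ℝ → Ω → ℝ}
  {d t : ℝ}

/-! ### Regularized integrals -/

/-- `J` is the limit in probability of `∫₀ᵗ Y_s (X_{s + (1-d)ε} - X_{s - dε})/ε ds`. -/
def IsRegularizedIntegral (X : ℝ → Ω → ℝ) (P : Measure Ω) (T d : ℝ) (Y : ℝ → Ω → ℝ) (t : ℝ)
    (J : Ω → ℝ) : Prop :=
  AEStronglyMeasurable J P ∧
  TendstoInMeasure P (fun ε ω => ∫ s in (0 : ℝ)..t, Y s ω * (incr X T d ε s ω / ε)) (𝓝[>] (0 : ℝ)) J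

/-- Replacing the process by `0` where it exceeds a measurable version of the bound makes the
domination hold everywhere. Outside a single null set of `ω`, nothing changes at any parameter where
the original bound holds. -/
theorem exists_dominated_modification {Q : Type*} [MeasurableSpace Q] {W : Q × Ω → ℝ}
    (hW : Measurable W) {Z : Ω → ℝ} (hZ : MemLp Z 2 P) :
    ∃ (W' : Q × Ω → ℝ) (Z' : Ω → ℝ), Measurable W' ∧ MemLp Z' 2 P ∧ (∀ q, |W' q| ≤ Z' q.2) ∧
      ∀ᵐ ω ∂P, ∀ q, |W (q, ω)| ≤ Z ω → W' (q, ω) = W (q, ω) := by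
  have hm := hZ.1.stronglyMeasurable_mk.measurable
  have hs : MeasurableSet {q : Q × Ω | |W q| ≤ |hZ.1.mk Z q.2|} :=
    measurableSet_le hW.abs (hm.comp measurable_snd).abs
  refine ⟨{q : Q × Ω | |W q| ≤ |hZ.1.mk Z q.2|}.indicator W, fun ω => |hZ.1.mk Z ω|,
    hW.indicator hs, (hZ.ae_eq hZ.1.ae_eq_mk).abs, fun q => ?_, ?_⟩
  · by_cases hq : q ∈ {q : Q × Ω | |W q| ≤ |hZ.1.mk Z q.2|}
    · rw [indicator_of_mem hq]; exact hq
    · rw [indicator_of_notMem hq, abs_zero]; exact abs_nonneg _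
  · filter_upwards [hZ.1.ae_eq_mk] with ω hω q hq
    refine indicator_of_mem (s := {q : Q × Ω | |W q| ≤ |hZ.1.mk Z q.2|}) ?_ _
    change |W (q, ω)| ≤ |hZ.1.mk Z ω|
    rw [← hω]
    exact hq.trans (le_abs_self _)

namespace DominatedProcess

variable {Y' : ℝ → Ω → ℝ} {D : ℝ → ℝ → Ω → ℝ}

theorem isRegularizedIntegral [IsProbabilityMeasure P] (h : Setting X P T μ E' r)
    (hY : DominatedProcess X P T μ Y' D) (hd : d ∈ Icc (0 : ℝ) 1) (ht : t ∈ Icc 0 T)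
    (hYY : ∀ᵐ ω ∂P, ∀ s ∈ Icc 0 T, Y' s ω = Y s ω)
    (htr : ∀ᵐ ω ∂P, ∀ᵐ p ∂μ.variation, HasTrace d D p.1 p.2 ω) {Z : Ω → ℝ} (hZ : MemLp Z 2 P)
    (hlim : Tendsto (fun ε => eLpNorm (fun ω => regCorr X T μ d t Y' D ε ω - Z ω) 2 P)
      (𝓝[>] 0) (𝓝 0)) :
    IsRegularizedIntegral X P T d Y t fun ω =>
      Z ω + ∫ᵛ p in Icc 0 T ×ˢ Icc 0 t, trace d D p.1 p.2 ω ∂•μ := by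
  obtain ⟨θ, hθm, hθ1, hθ⟩ := h.glue.exists_sign
  have hm : Measurable fun x : (Ω × (ℝ × ℝ)) × ℝ => D x.1.2.1 x.2 x.1.1 :=
    hY.meas_deriv.comp (f := fun x : (Ω × (ℝ × ℝ)) × ℝ => (x.1.2.1, x.2, x.1.1)) (by fun_prop)
  have m1 : ∀ ε, AEStronglyMeasurable
      (fun ω => ∫ p, smear T d t (fun s => D p.1 s ω) p.2 ε * θ p ∂μ.variation) P := fun ε =>
    (StronglyMeasurable.integral_prod_right'
      (f := fun q : Ω × (ℝ × ℝ) => smear T d t (fun s => D q.2.1 s q.1) q.2.2 ε * θ q.2)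
      ((measurable_smear_param (g := fun (q : Ω × (ℝ × ℝ)) s => D q.2.1 s q.1) hm
        (ρ := fun q => q.2.2) (by fun_prop) ε).mul
        (hθm.comp measurable_snd)).stronglyMeasurable).aestronglyMeasurable
  have m2 : ∀ ε, AEStronglyMeasurable (regCorr X T μ d t Y' D ε) P := fun ε =>
    (((hY.measurable_wcorr h ε).stronglyMeasurable.integral_prod_left').const_mul
      ε⁻¹).aestronglyMeasurable
  have l1 : ∀ᵐ ω ∂P, Tendsto
      (fun ε => ∫ p, smear T d t (fun s => D p.1 s ω) p.2 ε * θ p ∂μ.variation) (𝓝[>] 0)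
      (𝓝 (∫ᵛ p in Icc 0 T ×ˢ Icc 0 t, trace d D p.1 p.2 ω ∂•μ)) :=
    htr.mono fun ω hω => hY.tendsto_integral_smear h hd hθm hθ1 hθ hω
  have l2 := tendstoInMeasure_of_tendsto_eLpNorm (p := 2) (by norm_num) m2 hZ.1 hlim
  refine ⟨hZ.1.add (aestronglyMeasurable_of_tendsto_ae (𝓝[>] (0 : ℝ)) m1 l1),
    (TendstoInMeasure.fun_add l2 (tendstoInMeasure_of_ae m1 l1)).congr' ?_ Filter.EventuallyEq.rfl⟩
  refine Eventually.of_forall fun ε => ?_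
  filter_upwards [hYY] with ω hω
  rw [← hY.inv_mul_integral_eq h hθm hθ1 hθ, intervalIntegral.integral_of_le ht.1,
    ← integral_Icc_eq_integral_Ioc, ← integral_const_mul]
  refine setIntegral_congr_fun measurableSet_Icc fun s hs => ?_
  simp only [hω s ⟨hs.1, hs.2.trans ht.2⟩]
  ring

end DominatedProcess

/-- The decomposition of the trace term. -/
theorem setIntegral_trace_eq (h : Setting X P T μ E' r) (ht : t ∈ Icc 0 T) {ω : Ω}
    {f : ℝ × ℝ → ℝ} (hf : Integrable f μ.variation)
    (hoff : ∀ᵐ p ∂(leb T).prod (leb T), f p = DY p.1 p.2 ω) :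
    ∫ᵛ p in Icc 0 T ×ˢ Icc 0 t, f p ∂•μ = (∫ s in (0 : ℝ)..t, f (s, s) * E' s)
      + ∫ p in Icc 0 T ×ˢ Icc 0 t, DY p.1 p.2 ω * r p := by
  have hs : MeasurableSet (Icc 0 T ×ˢ Icc 0 t) := measurableSet_Icc.prod measurableSet_Icc
  have hsub : Icc 0 T ×ˢ Icc 0 t ⊆ square T := prod_mono_right (Icc_subset_Icc_right ht.2)
  rw [← VectorMeasure.integral_indicator hs, h.glue.integral_eq (hf.indicator hs)]
  congr 1
  · rw [intervalIntegral.integral_of_le ht.1, ← integral_Icc_eq_integral_Ioc,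
      ← inter_eq_right.2 (Icc_subset_Icc_right ht.2), ← setIntegral_indicator measurableSet_Icc]
    refine setIntegral_congr_fun measurableSet_Icc fun s hs => ?_
    simp only [inter_eq_right.2 (Icc_subset_Icc_right ht.2 : Icc 0 t ⊆ Icc 0 T)]
    by_cases hst : s ∈ Icc 0 t
    · simp only [indicator_of_mem hst]
      rw [indicator_of_mem (show (s, s) ∈ Icc 0 T ×ˢ Icc 0 t from ⟨hs, hst⟩)]
    · simp only [indicator_of_notMem hst]
      rw [indicator_of_notMem (fun hq => hst hq.2), zero_mul]
  · rw [← inter_eq_right.2 hsub, ← setIntegral_indicator hs, ← leb_prod_leb]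
    refine integral_congr_ae ?_
    filter_upwards [hoff] with p hp
    rw [inter_eq_right.2 hsub]
    by_cases hst : p ∈ Icc 0 T ×ˢ Icc 0 t
    · rw [indicator_of_mem hst, indicator_of_mem hst, hp]
    · rw [indicator_of_notMem hst, indicator_of_notMem hst, zero_mul]

/-- The formula for the regularized integrals, in the general case of windows
`]s - dε, s + (1-d)ε]`. -/
theorem exists_skorohod_and_regularized [IsProbabilityMeasure P] (h : Setting X P T μ E' r)
    (hd : d ∈ Icc (0 : ℝ) 1)
    (hYmeas : Measurable (fun q : ℝ × Ω => Y q.1 q.2))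
    (ha : ∃ S : Ω → ℝ, MemLp S 2 P ∧ ∀ᵐ ω ∂P, ∀ t ∈ Icc 0 T, |Y t ω| ≤ S ω)
    (hDYmeas : Measurable (fun q : ℝ × ℝ × Ω => DY q.1 q.2.1 q.2.2))
    (hbsec : ∀ᵐ s ∂(volume.restrict (Icc 0 T)),
      HasMalliavinDeriv X P T μ (Y s) (fun u ω => DY u s ω))
    (hbdom : ∃ Z₂ : Ω → ℝ, MemLp Z₂ 2 P ∧
      ∀ᵐ p ∂(volume.restrict (square T)), ∀ᵐ ω ∂P, |DY p.1 p.2 ω| ≤ Z₂ ω)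
    (htr : ∀ᵐ s ∂(volume.restrict (Icc 0 T)), ∀ᵐ ω ∂P, HasTrace d DY s s ω) :
    (∃ Z : Ω → ℝ, IsSkorohodIntegral X P T μ Y Z) ∧
    (∀ᵐ p ∂μ.variation, ∀ᵐ ω ∂P, HasTrace d DY p.1 p.2 ω) ∧
    (∀ᵐ ω ∂P, μ.Integrable (fun p => trace d DY p.1 p.2 ω) ∧
      IntegrableOn (fun s => trace d DY s s ω * E' s) (Icc 0 T) ∧
      IntegrableOn (fun p => DY p.1 p.2 ω * r p) (square T)) ∧
    ∀ t ∈ Icc 0 T, ∃ Z : Ω → ℝ,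
      IsSkorohodIntegral X P T μ (fun s ω => (Icc 0 t).indicator (fun s => Y s ω) s) Z ∧
      IsRegularizedIntegral X P T d Y t (fun ω =>
        Z ω + ∫ᵛ p in Icc 0 T ×ˢ Icc 0 t, trace d DY p.1 p.2 ω ∂•μ) ∧
      IsRegularizedIntegral X P T d Y t (fun ω =>
        Z ω + (∫ s in (0 : ℝ)..t, trace d DY s s ω * E' s)
          + ∫ p in Icc 0 T ×ˢ Icc 0 t, DY p.1 p.2 ω * r p) := by
  obtain ⟨S, hS, hYS⟩ := ha
  obtain ⟨Z₂, hZ₂, hDYZ⟩ := hbdom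
  have hDm : Measurable fun q : (ℝ × ℝ) × Ω => DY q.1.1 q.1.2 q.2 :=
    hDYmeas.comp (f := fun q : (ℝ × ℝ) × Ω => (q.1.1, q.1.2, q.2)) (by fun_prop)
  -- Both `Y` and its derivative are replaced by modifications bounded for all parameters and all
  -- `ω`; the results are transferred back at the end.
  obtain ⟨W, S', hWm, hS', hWle, hWeq⟩ := exists_dominated_modification hYmeas hS
  obtain ⟨W₂, Z', hW₂m, hZ', hW₂le, hW₂eq⟩ := exists_dominated_modification hDm hZ₂
  set Y' : ℝ → Ω → ℝ := fun s ω => W (s, ω) with hY'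
  set D : ℝ → ℝ → Ω → ℝ := fun u s ω => W₂ ((u, s), ω) with hD
  have hYY : ∀ᵐ ω ∂P, ∀ s ∈ Icc 0 T, Y' s ω = Y s ω := by
    filter_upwards [hYS, hWeq] with ω h1 h2 s hs using h2 s (h1 s hs)
  have hDD : ∀ᵐ p ∂(leb T).prod (leb T), ∀ᵐ ω ∂P, DY p.1 p.2 ω = D p.1 p.2 ω := by
    rw [leb_prod_leb]
    filter_upwards [hDYZ] with p hp
    filter_upwards [hp, hW₂eq] with ω h1 h2 using (h2 p h1).symm
  have hset : MeasurableSet {q : (ℝ × ℝ) × Ω | DY q.1.1 q.1.2 q.2 = D q.1.1 q.1.2 q.2} :=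
    measurableSet_eq_fun hDm hW₂m
  have R1 : ∀ᵐ ω ∂P, ∀ᵐ p ∂(leb T).prod (leb T), DY p.1 p.2 ω = D p.1 p.2 ω :=
    (Measure.ae_ae_comm (p := fun (p : ℝ × ℝ) ω => DY p.1 p.2 ω = D p.1 p.2 ω) hset).1 hDD
  have hset' : ∀ u, MeasurableSet {q : ℝ × Ω | DY u q.1 q.2 = D u q.1 q.2} := fun u =>
    (show Measurable fun q : ℝ × Ω => ((u, q.1), q.2) by fun_prop) hset
  have hset'' : ∀ s, MeasurableSet {q : ℝ × Ω | DY q.1 s q.2 = D q.1 s q.2} := fun s =>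
    (show Measurable fun q : ℝ × Ω => ((q.1, s), q.2) by fun_prop) hset
  -- The equality of the two versions of the derivative is used in several quantifier orders: `R1`
  -- for integrals over the square, `R2` along slices in `s` for traces, `R3` along slices in `u`
  -- for Malliavin derivatives.
  have R2 : ∀ᵐ u ∂leb T, ∀ᵐ ω ∂P, ∀ᵐ s ∂leb T, DY u s ω = D u s ω := by
    filter_upwards [Measure.ae_ae_of_ae_prod hDD] with u hu
    exact (Measure.ae_ae_comm (p := fun s ω => DY u s ω = D u s ω) (hset' u)).1 hu
  have R3 : ∀ᵐ s ∂leb T, ∀ᵐ ω ∂P, ∀ᵐ u ∂leb T, DY u s ω = D u s ω := by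
    filter_upwards [Measure.ae_ae_of_ae_prod
      (Measure.measurePreserving_swap.quasiMeasurePreserving.ae hDD)] with s hs
    exact (Measure.ae_ae_comm (p := fun u ω => DY u s ω = D u s ω) (hset'' s)).1 hs
  have hP : DominatedProcess X P T μ Y' D := by
    refine ⟨hWm, hW₂m.comp (f := fun q : ℝ × ℝ × Ω => ((q.1, q.2.1), q.2.2)) (by fun_prop),
      ⟨S', hS', fun s ω => hWle (s, ω)⟩, ⟨Z', hZ', fun u s ω => hW₂le ((u, s), ω)⟩, ?_⟩
    filter_upwards [hbsec, R3, ae_restrict_mem measurableSet_Icc] with s h1 h2 h3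
    exact ⟨Y s, fun u ω => DY u s ω, h1,
      hDYmeas.comp (f := fun q : ℝ × Ω => (q.1, s, q.2)) (by fun_prop),
      hYY.mono fun ω hω => (hω s h3).symm, h2⟩
  -- A trace at `(s,s)` depends on the slice `DY s ·` near `s`, not on the value at `(s,s)`.
  -- Agreement of the two versions almost everywhere on the square is therefore enough, although the
  -- diagonal is null there.
  have hdiag : ∀ᵐ s ∂leb T, ∀ᵐ ω ∂P, HasTrace d D s s ω := by
    filter_upwards [htr, R2, ae_mem_Ioo T] with s h1 h2 h3
    filter_upwards [h1, h2] with ω k1 k2 using (hasTrace_iff_and_trace_eq hd k2 h3).1.1 k1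
  have G1 := hP.ae_ae_hasTrace' h hdiag
  have hgood : ∀ᵐ ω ∂P, (∀ᵐ p ∂μ.variation, trace d DY p.1 p.2 ω = trace d D p.1 p.2 ω) ∧
      ∀ᵐ s ∂leb T, trace d DY s s ω = trace d D s s ω := by
    filter_upwards [R1] with ω h1
    have h2 := Measure.ae_ae_of_ae_prod h1
    refine ⟨?_, ?_⟩
    · filter_upwards [h.glue.qmp_fst.ae h2, h.glue.qmp_snd.ae (ae_mem_Ioo T)] with p k1 k2
      exact (hasTrace_iff_and_trace_eq hd k1 k2).2
    · filter_upwards [h2, ae_mem_Ioo T] with s k1 k2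
      exact (hasTrace_iff_and_trace_eq hd k1 k2).2
  have hoff : ∀ᵐ ω ∂P, ∀ᵐ p ∂(leb T).prod (leb T), trace d D p.1 p.2 ω = DY p.1 p.2 ω := by
    filter_upwards [R1] with ω h1
    filter_upwards [h1, hP.ae_hasTrace_offDiag (d := d) ω] with p k1 k2
    rw [k1, k2.2]
  refine ⟨?_, ?_, ?_, fun t ht => ?_⟩
  · obtain ⟨Z, hZ, hlim⟩ := hP.exists_tendsto_regCorr (d := d) h le_rfl
    refine ⟨Z, hP.isSkorohodIntegral h le_rfl hZ hlim hYmeas ?_⟩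
    filter_upwards [hYY] with ω hω s hs
    rw [indicator_of_mem hs, hω s hs]
  · filter_upwards [hP.ae_ae_hasTrace h hdiag, h.glue.qmp_fst.ae R2,
      h.glue.qmp_snd.ae (ae_mem_Ioo T)] with p h1 h2 h3
    filter_upwards [h1, h2] with ω k1 k2 using (hasTrace_iff_and_trace_eq hd k2 h3).1.2 k1
  · filter_upwards [G1, hgood, hoff] with ω h1 h2 h3
    have hi := hP.integrable_trace h1
    refine ⟨hi.congr (h2.1.mono fun p hp => hp.symm), ?_, ?_⟩
    · refine (h.glue.integrableOn_diag hi).congr ?_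
      filter_upwards [h2.2] with s hs
      rw [hs]
    · have := h.glue.integrableOn_square hi
      rw [IntegrableOn, ← leb_prod_leb] at this ⊢
      refine this.congr ?_
      filter_upwards [h3] with p hp
      rw [hp]
  · obtain ⟨Z, hZ, hlim⟩ := hP.exists_tendsto_regCorr (d := d) h ht.2
    have hreg := hP.isRegularizedIntegral (Y := Y) h hd ht hYY G1 hZ hlim
    have hm : Measurable fun q : ℝ × Ω => (Icc 0 t).indicator (fun s => Y s q.2) q.1 :=
      hYmeas.indicator (measurable_fst measurableSet_Icc)
    refine ⟨Z, hP.isSkorohodIntegral h ht.2 hZ hlim hm ?_, ?_, ?_⟩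
    · filter_upwards [hYY] with ω hω s hs
      by_cases hst : s ∈ Icc 0 t
      · simp only [indicator_of_mem hst, hω s hs]
      · simp only [indicator_of_notMem hst]
    · have e : (fun ω => Z ω + ∫ᵛ p in Icc 0 T ×ˢ Icc 0 t, trace d D p.1 p.2 ω ∂•μ) =ᵐ[P]
          fun ω => Z ω + ∫ᵛ p in Icc 0 T ×ˢ Icc 0 t, trace d DY p.1 p.2 ω ∂•μ := by
        obtain ⟨θ, -, -, hθ⟩ := h.glue.exists_sign
        filter_upwards [hgood] with ω hω
        have hs : MeasurableSet (Icc 0 T ×ˢ Icc 0 t) := measurableSet_Icc.prod measurableSet_Icc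
        rw [← VectorMeasure.integral_indicator hs, ← VectorMeasure.integral_indicator hs, hθ, hθ]
        congr 1
        refine integral_congr_ae ?_
        filter_upwards [hω.1] with p hp
        by_cases hst : p ∈ Icc 0 T ×ˢ Icc 0 t
        · rw [indicator_of_mem hst, indicator_of_mem hst, hp]
        · rw [indicator_of_notMem hst, indicator_of_notMem hst]
      exact ⟨hreg.1.congr e, hreg.2.congr (fun _ => Filter.EventuallyEq.rfl) e⟩
    · have e : (fun ω => Z ω + ∫ᵛ p in Icc 0 T ×ˢ Icc 0 t, trace d D p.1 p.2 ω ∂•μ) =ᵐ[P]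
          fun ω => Z ω + (∫ s in (0 : ℝ)..t, trace d DY s s ω * E' s)
            + ∫ p in Icc 0 T ×ˢ Icc 0 t, DY p.1 p.2 ω * r p := by
        filter_upwards [G1, hgood, hoff] with ω h1 h2 h3
        rw [setIntegral_trace_eq h ht (hP.integrable_trace h1) h3, add_assoc,
          intervalIntegral.integral_of_le ht.1, intervalIntegral.integral_of_le ht.1,
          ← integral_Icc_eq_integral_Ioc, ← integral_Icc_eq_integral_Ioc]
        congr 2
        refine integral_congr_ae ?_
        filter_upwards [ae_restrict_of_ae_restrict_of_subset (Icc_subset_Icc_right ht.2) h2.2]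
          with s hs
        rw [hs]
      exact ⟨hreg.1.congr e, hreg.2.congr (fun _ => Filter.EventuallyEq.rfl) e⟩

end CovMeasure

end

/-! ### Forward and backward integrals as the cases `d = 0` and `d = 1`. -/

noncomputable section

namespace CovMeasure

variable {Ω : Type*} [MeasurableSpace Ω] {X : ℝ → Ω → ℝ} {P : Measure Ω} {T : ℝ}
  {Y : ℝ → Ω → ℝ} {t : ℝ} {J : Ω → ℝ}

omit [MeasurableSpace Ω] in
theorem slideMean_zero_eq_leftMean (D : ℝ → ℝ → Ω → ℝ) (u s : ℝ) (ω : Ω) :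
    slideMean 0 (fun v => D u v ω) s = leftMean D u s ω := by
  funext ε
  simp [slideMean, leftMean]

omit [MeasurableSpace Ω] in
theorem slideMean_one_eq_rightMean (D : ℝ → ℝ → Ω → ℝ) (u s : ℝ) (ω : Ω) :
    slideMean 1 (fun v => D u v ω) s = rightMean D u s ω := by
  funext ε
  simp [slideMean, rightMean]

omit [MeasurableSpace Ω] in
theorem hasTrace_zero_eq : @HasTrace Ω 0 = HasLeftTrace := by
  funext D u s ω
  simp only [HasTrace, HasLeftTrace, slideMean_zero_eq_leftMean]

omit [MeasurableSpace Ω] in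
theorem hasTrace_one_eq : @HasTrace Ω 1 = HasRightTrace := by
  funext D u s ω
  simp only [HasTrace, HasRightTrace, slideMean_one_eq_rightMean]

omit [MeasurableSpace Ω] in
theorem trace_zero_eq : @trace Ω 0 = leftTrace := by
  funext D u s ω
  simp only [trace, leftTrace, slideMean_zero_eq_leftMean]

omit [MeasurableSpace Ω] in
theorem trace_one_eq : @trace Ω 1 = rightTrace := by
  funext D u s ω
  simp only [trace, rightTrace, slideMean_one_eq_rightMean]

omit [MeasurableSpace Ω] in
theorem incr_zero_eq (ε s : ℝ) (ω : Ω) :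
    incr X T 0 ε s ω = prolong X T (s + ε) ω - prolong X T s ω := by
  simp [incr, prolong, clamp]

omit [MeasurableSpace Ω] in
theorem incr_one_eq (ε s : ℝ) (ω : Ω) :
    incr X T 1 ε s ω = prolong X T s ω - prolong X T (s - ε) ω := by
  simp [incr, prolong, clamp]

theorem isRegularizedIntegral_zero_iff :
    IsRegularizedIntegral X P T 0 Y t J ↔ IsForwardIntegral X P T Y t J := by
  simp only [IsRegularizedIntegral, IsForwardIntegral, incr_zero_eq]

theorem isRegularizedIntegral_one_iff :
    IsRegularizedIntegral X P T 1 Y t J ↔ IsBackwardIntegral X P T Y t J := by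
  simp only [IsRegularizedIntegral, IsBackwardIntegral, incr_one_eq]

end CovMeasure

end

open CovMeasure

theorem propositionp5p15 {Ω : Type*} [MeasurableSpace Ω] (P : Measure Ω) [IsProbabilityMeasure P]
    (T : ℝ) (hT : 0 < T)
    -- the integrator: a continuous centered Gaussian process with `X₀ = 0`, generating the σ-field
    (X : ℝ → Ω → ℝ)
    (hXmeas : ∀ t ∈ Icc 0 T, Measurable (X t))
    (hXcont : ∀ ω, ContinuousOn (fun t => X t ω) (Icc 0 T))
    (hXgauss : IsGaussianProcess (fun t : Icc (0 : ℝ) T => X t) P)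
    (hXmean : ∀ t ∈ Icc 0 T, ∫ ω, X t ω ∂P = 0)
    (hXzero : ∀ᵐ ω ∂P, X 0 ω = 0)
    (hXgen : ∀ A : Set Ω, MeasurableSet A → ∃ B : Set Ω,
      MeasurableSet[⨆ t ∈ Icc (0 : ℝ) T, MeasurableSpace.comap (X t) inferInstance] B ∧
        A =ᵐ[P] B)
    -- its covariance measure; `L_μ` is a vector space
    (μ : SignedMeasure (ℝ × ℝ)) (hμ : IsCovarianceMeasure X P T μ)
    (hL : ∀ φ ψ : ℝ → ℝ, MemL μ φ → MemL μ ψ → MemL μ (φ + ψ))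
    -- i) the energy function is absolutely continuous, with derivative `E'`
    (E' : ℝ → ℝ) (hE'int : IntegrableOn E' (Icc 0 T))
    (hE' : ∀ t ∈ Icc 0 T, energy μ t = ∫ s in (0 : ℝ)..t, E' s)
    -- ii) the off-diagonal part has density `r = ∂²R/∂s₁∂s₂`
    (r : ℝ × ℝ → ℝ) (hrint : IntegrableOn r (square T))
    (hr : ∀ A : Set (ℝ × ℝ), MeasurableSet A → A ⊆ square T → offDiagPart μ T A = ∫ p in A, r p)
    -- a) `sup_{t ≤ T} |Y_t|` is square integrable
    (Y : ℝ → Ω → ℝ) (hYmeas : Measurable (fun q : ℝ × Ω => Y q.1 q.2))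
    (ha : ∃ S : Ω → ℝ, MemLp S 2 P ∧ ∀ᵐ ω ∂P, ∀ t ∈ Icc 0 T, |Y t ω| ≤ S ω)
    -- b) `Y ∈ |𝔻^{1,2}(L_μ)|`, the derivative `DY t₁ t₂ = D_{t₁}Y_{t₂}` being, for almost every
    -- `t₂`, the Malliavin derivative of the random variable `Y_{t₂}`, and dominated by `Z₂ ∈ L²`
    (DY : ℝ → ℝ → Ω → ℝ)
    (hDYmeas : Measurable (fun q : ℝ × ℝ × Ω => DY q.1 q.2.1 q.2.2))
    (hb : HasMalliavinDerivProc X P T μ Y DY)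
    (hbsec : ∀ᵐ t₂ ∂(volume.restrict (Icc 0 T)),
      HasMalliavinDeriv X P T μ (Y t₂) (fun t₁ ω => DY t₁ t₂ ω))
    (hbdom : ∃ Z₂ : Ω → ℝ, MemLp Z₂ 2 P ∧
      ∀ᵐ p ∂(volume.restrict (square T)), ∀ᵐ ω ∂P, |DY p.1 p.2 ω| ≤ Z₂ ω) :
    -- forward integral
    ((∀ᵐ t ∂(volume.restrict (Icc 0 T)), ∀ᵐ ω ∂P, HasLeftTrace DY t t ω) →
      (∃ Z : Ω → ℝ, IsSkorohodIntegral X P T μ Y Z) ∧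
      (∀ᵐ p ∂μ.variation, ∀ᵐ ω ∂P, HasLeftTrace DY p.1 p.2 ω) ∧
      (∀ᵐ ω ∂P, μ.Integrable (fun p => leftTrace DY p.1 p.2 ω) ∧
        IntegrableOn (fun s => leftTrace DY s s ω * E' s) (Icc 0 T) ∧
        IntegrableOn (fun p => DY p.1 p.2 ω * r p) (square T)) ∧
      ∀ t ∈ Icc 0 T, ∃ Z : Ω → ℝ,
        IsSkorohodIntegral X P T μ (fun s ω => (Icc 0 t).indicator (fun s => Y s ω) s) Z ∧
        IsForwardIntegral X P T Y t (fun ω =>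
          Z ω + ∫ᵛ p in Icc 0 T ×ˢ Icc 0 t, leftTrace DY p.1 p.2 ω ∂•μ) ∧
        IsForwardIntegral X P T Y t (fun ω =>
          Z ω + (∫ s in (0 : ℝ)..t, leftTrace DY s s ω * E' s)
            + ∫ p in Icc 0 T ×ˢ Icc 0 t, DY p.1 p.2 ω * r p)) ∧
    -- backward integral
    ((∀ᵐ t ∂(volume.restrict (Icc 0 T)), ∀ᵐ ω ∂P, HasRightTrace DY t t ω) →
      (∃ Z : Ω → ℝ, IsSkorohodIntegral X P T μ Y Z) ∧
      (∀ᵐ p ∂μ.variation, ∀ᵐ ω ∂P, HasRightTrace DY p.1 p.2 ω) ∧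
      (∀ᵐ ω ∂P, μ.Integrable (fun p => rightTrace DY p.1 p.2 ω) ∧
        IntegrableOn (fun s => rightTrace DY s s ω * E' s) (Icc 0 T) ∧
        IntegrableOn (fun p => DY p.1 p.2 ω * r p) (square T)) ∧
      ∀ t ∈ Icc 0 T, ∃ Z : Ω → ℝ,
        IsSkorohodIntegral X P T μ (fun s ω => (Icc 0 t).indicator (fun s => Y s ω) s) Z ∧
        IsBackwardIntegral X P T Y t (fun ω =>
          Z ω + ∫ᵛ p in Icc 0 T ×ˢ Icc 0 t, rightTrace DY p.1 p.2 ω ∂•μ) ∧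
        IsBackwardIntegral X P T Y t (fun ω =>
          Z ω + (∫ s in (0 : ℝ)..t, rightTrace DY s s ω * E' s)
            + ∫ p in Icc 0 T ×ˢ Icc 0 t, DY p.1 p.2 ω * r p)) := by
  have h : Setting X P T μ E' r :=
    { pos := hT, meas := hXmeas, cont := hXcont, gauss := hXgauss, mean := hXmean, cov := hμ,
      add_mem := hL
      glue :=
        have hg := eq_withDensityᵥ_glueDensity hμ.carried hE'int hE' hrint hr hT
        ⟨hg.1, hg.2⟩ }
  refine ⟨fun htr => ?_, fun htr => ?_⟩
  · have key := exists_skorohod_and_regularized h (d := 0) ⟨le_rfl, zero_le_one⟩ hYmeas ha hDYmeas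
      hbsec hbdom (by rwa [hasTrace_zero_eq])
    simpa only [hasTrace_zero_eq, trace_zero_eq, isRegularizedIntegral_zero_iff] using key
  · have key := exists_skorohod_and_regularized h (d := 1) ⟨zero_le_one, le_rfl⟩ hYmeas ha hDYmeas
      hbsec hbdom (by rwa [hasTrace_one_eq])
    simpa only [hasTrace_one_eq, trace_one_eq, isRegularizedIntegral_one_iff] using key
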